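/- Let $n\in\mathbb N$, $p=2n$, $d=2p+2=4n+2$. Let $M$ be a smooth $d$-dimensional (Hausdorff, second countable) oriented manifold with a smooth Lorentzian metric $g_{\mu\nu}$ of signature $(-,+,\dots,+)$, and let $\boldsymbol\varepsilon$ be its Levi-Civita tensor, $\boldsymbol\varepsilon_{\mu_1\dots\mu_d}=\pm\sqrt{-g}\,[\mu_1\dots\mu_d]$, where $[\mu_1\dots\mu_d]$ is the permutation symbol and the sign is fixed by the orientation. For a $(p+1)$-form put $F^*_{\mu(p+1)}=\frac1{(p+1)!}\boldsymbol\varepsilon_{\mu_1\dots\mu_{p+1}\nu_1\dots\nu_{p+1}}F^{\nu_1\dots\nu_{p+1}}$; for $p$-forms write $\alpha\cdot\beta=\alpha_{\mu_1\dots\mu_p}\beta^{\mu_1\dots\mu_p}$; square brackets denote antisymmetrisation of weight one. Let $A$ be a smooth $p$-form, $a$ a smooth function with everywhere timelike gradient, and $\Lambda$ a smooth self-dual $(p+1)$-form, $\Lambda^*=\Lambda$. Set $$F_{\mu(p+1)}=(p+1)\partial_{[\mu_1}A_{\mu_2\dots\mu_{p+1}]},\quad v_\mu=\frac{\partial_\mu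 a}{\sqrt{-\partial a\cdot\partial a}},\quad E_{\mu(p)}=F_{\mu(p)\nu}v^\nu,\quad B_{\mu(p)}=F^*_{\mu(p)\nu}v^\nu,\quad \lambda_{\mu(p)}=\Lambda_{\mu(p)\nu}v^\nu .$$ For a function $\mathcal V$ of the values of $\Lambda$ and $g$ at a point, and a compact region $D\subset M$, consider the action $$S_D[A,a,\Lambda]=\int_D d^dx\sqrt{-g}\,\mathcal L,\qquad \mathcal L=\frac1{p!}\Big[\tfrac12E\cdot B-\tfrac12B\cdot B+(B+\lambda)\cdot(B+\lambda)\Big]-\mathcal V(\Lambda,g),$$ and the free PST action $S^{\rm free}_D[A,a]=\frac1{p!}\int_D d^dx\sqrt{-g}\,\big[\tfrac12E\cdot B-\tfrac12B\cdot B\big]$. 1. (Symmetries.) For every $\mathcal V$ (an arbitrary function; in the statements about $S_D$ it is assumed that $x\mapsto\mathcal V(\Lambda,g)$ is locally integrable) the action is invariant, up to boundary terms, under the transformations $$\delta A_{\mu(p)}=-\frac{\varphi}{\sqrt{-\partial a\cdot\partial a}}\big[(E-B)+2(B+\lambda)\big]_{\mu(p)},\qquad \delta a=\varphi,\qquad \delta\Lambda=0,$$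 for every smooth function $\varphi$, and, if $p\ge1$, $$\delta A_{\mu(p)}=p\,v_{[\mu_1}\psi_{\mu_2\dots\mu_p]},\qquad \delta a=0,\qquad \delta\Lambda=0,$$ for every smooth $(p-1)$-form $\psi$; $\Lambda$ is inert under both. That is, for each such parameter there is a smooth vector field $K$ on $M$, vanishing wherever the parameter vanishes, such that $\frac{d}{ds}\big|_{s=0}\mathcal L[A+s\,\delta A,a+s\,\delta a,\Lambda]=\nabla_\mu K^\mu$ at every point and $\frac{d}{ds}\big|_{s=0}S_D[A+s\,\delta A,a+s\,\delta a,\Lambda]=\int_D d^dx\sqrt{-g}\,\nabla_\mu K^\mu$ for every compact $D$; the latter derivative is zero if the parameter vanishes outside $D$. 2. (Elimination of $\Lambda$ in the free case.) Let $\mathcal V=0$. The action is stationary under all compactly supported smooth self-dual variations of $\Lambda$ (with $A$, $a$ fixed) if and only if $B+\lambda=0$, and if and only if $$\Lambda_{\mu(p+1)}=(p+1)B_{[\mu_1\dots\mu_p}v_{\mu_{p+1}]}+\frac1{p!}\boldsymbol\varepsilon_{\mu_1\dots\mu_{p+1}\nu_1\dots\nu_{p+1}}B^{\nu_1\dots\nu_p}v^{\nu_{p+1}}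 .$$ The right-hand side is a smooth self-dual form, and for this $\Lambda$ one has $S_D[A,a,\Lambda]=S^{\rm free}_D[A,a]$ for every $D$. -/

import Mathlib

open scoped Manifold ContDiff

noncomputable section

namespace ChiralForm

/-! ### Tensor algebra on the model space of dimension `d = 2p + 2` -/

/-- Space-time indices; there are `d = (p+1)+(p+1) = 2p+2` of them. -/
abbrev Idx (p : ℕ) : Type := Fin (p + 1 + (p + 1))

/-- The model space `ℝ^d`, `d = 2p + 2`. -/
abbrev Model (p : ℕ) : Type := EuclideanSpace ℝ (Idx p)

/-- Alternating `k`-forms on `ℝ^d`. -/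
abbrev Form (p k : ℕ) : Type := Model p [⋀^Fin k]→L[ℝ] ℝ

/-- Bilinear forms on `ℝ^d`. -/
abbrev Bilin (p : ℕ) : Type := Model p →L[ℝ] Model p →L[ℝ] ℝ

variable {p k : ℕ}

/-- The coordinate basis vector `∂_μ`. -/
def e (μ : Idx p) : Model p := EuclideanSpace.single μ 1

/-- The matrix `g_{μν}`. -/
def gram (g : Bilin p) : Matrix (Idx p) (Idx p) ℝ := Matrix.of fun μ ν => g (e μ) (e ν)

/-- The vector `g^{μν} ∂_ν`; inserting these vectors in a form gives its components with raised
indices. -/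
def eUp (g : Bilin p) (μ : Idx p) : Model p := ∑ ν, (gram g)⁻¹ μ ν • e ν

/-- The components `θ_{μ_1 … μ_k}`. -/
def cov (θ : Form p k) (μ : Fin k → Idx p) : ℝ := θ fun i => e (μ i)

/-- The components `θ^{μ_1 … μ_k}`. -/
def con (g : Bilin p) (θ : Form p k) (μ : Fin k → Idx p) : ℝ := θ fun i => eUp g (μ i)

/-- The monomial tensor `dx^{μ_1} ⊗ ⋯ ⊗ dx^{μ_k}`. -/
def dxTensor (μ : Fin k → Idx p) : ContinuousMultilinearMap ℝ (fun _ : Fin k => Model p) ℝ :=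
  (ContinuousMultilinearMap.mkPiAlgebra ℝ (Fin k) ℝ).compContinuousLinearMap
    fun i => EuclideanSpace.proj (μ i)

/-- The form with components `T_{[μ_1 … μ_k]}` (antisymmetrisation of weight one). -/
def ofComp (T : (Fin k → Idx p) → ℝ) : Form p k :=
  (1 / (k.factorial : ℝ)) • ContinuousMultilinearMap.alternatization (∑ μ, T μ • dxTensor μ)

/-- The full contraction `α · β = α_{μ_1 … μ_k} β^{μ_1 … μ_k}`. -/
def dot (g : Bilin p) (α β : Form p k) : ℝ := ∑ μ, cov α μ * con g β μ

/-- The form with components `θ_{μ_1 … μ_k ν} w^ν`. -/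
def contractLast (θ : Form p (k + 1)) (w : Model p) : Form p k :=
  ofComp fun μ => θ (Fin.snoc (α := fun _ => Model p) (fun i => e (μ i)) w)

/-- The dual of a `(p+1)`-form,
`F^*_{μ_1 … μ_{p+1}} = (1/(p+1)!) ε_{μ_1 … μ_{p+1} ν_1 … ν_{p+1}} F^{ν_1 … ν_{p+1}}`. -/
def dual (g : Bilin p) (ε : Form p (p + 1 + (p + 1))) (F : Form p (p + 1)) : Form p (p + 1) :=
  ofComp fun μ => 1 / ((p + 1).factorial : ℝ) *
    ∑ ν : Fin (p + 1) → Idx p, cov ε (Fin.append μ ν) * con g F ν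

/-- `g^{μν} α_μ α_ν` for a covector `α`. -/
def covecSq (g : Bilin p) (α : Model p →L[ℝ] ℝ) : ℝ := ∑ μ, α (e μ) * α (eUp g μ)

/-- `√(- g^{μν} α_μ α_ν)`. -/
def gradNorm (g : Bilin p) (α : Model p →L[ℝ] ℝ) : ℝ := √(-covecSq g α)

/-- `v_μ = α_μ / √(- α · α)`. -/
def unitCov (g : Bilin p) (α : Model p →L[ℝ] ℝ) (μ : Idx p) : ℝ := α (e μ) / gradNorm g α

/-- `v^μ`, as a vector. -/
def unitVec (g : Bilin p) (α : Model p →L[ℝ] ℝ) : Model p := ∑ μ, unitCov g α μ • eUp g μ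

/-- The form with components `p v_{[μ_1} ψ_{μ_2 … μ_p]}` for a `(p-1)`-form `ψ`, `p ≥ 1`. -/
def covWedge (hp : 0 < p) (v : Idx p → ℝ) (ψ : Form p (p - 1)) : Form p p :=
  ofComp fun μ => (p : ℝ) * (v (μ ⟨0, hp⟩) *
    cov ψ fun i : Fin (p - 1) => μ ⟨i.1 + 1, by have := i.2; omega⟩)

/-- The form with components
`(p+1) B_{[μ_1 … μ_p} v_{μ_{p+1}]}
  + (1/p!) ε_{μ_1 … μ_{p+1} ν_1 … ν_{p+1}} B^{ν_1 … ν_p} v^{ν_{p+1}}`. -/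
def selfDualExt (g : Bilin p) (ε : Form p (p + 1 + (p + 1))) (α : Model p →L[ℝ] ℝ)
    (B : Form p p) : Form p (p + 1) :=
  ofComp fun μ =>
    ((p : ℝ) + 1) * (cov B (fun i => μ i.castSucc) * unitCov g α (μ (Fin.last p)))
    + 1 / (p.factorial : ℝ) * ∑ ν : Fin (p + 1) → Idx p,
        cov ε (Fin.append μ ν) *
          (con g B (fun i => ν i.castSucc) * unitVec g α (ν (Fin.last p)))

/-! ### Fields on a space-time manifold -/

/-- The model with corners of a `d`-dimensional manifold without boundary, `d = 2p + 2`. -/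
abbrev mdl (p : ℕ) : ModelWithCorners ℝ (Model p) (Model p) := 𝓡 (p + 1 + (p + 1))

section Fields

variable (p) (M : Type*) [TopologicalSpace M] [ChartedSpace (Model p) M]

/-- Vector fields on `M`. In Mathlib `TangentSpace (mdl p) x` is by definition the model space, a
vector standing for its coordinates in the preferred chart `chartAt _ x`; tensors at `x` are
therefore tensors on `Model p`, and coordinates in other charts are obtained through `mfderiv`. -/
abbrev VecField : Type _ := M → Model p

/-- Fields of `k`-forms on `M`. -/
abbrev FormField (k : ℕ) : Type _ := M → Form p k

/-- Fields of bilinear forms on `M`. -/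
abbrev BilinField : Type _ := M → Bilin p

variable {p M}

/-- The differential at `y` of the inverse of the chart around `x₀`. -/
def chartFrame (x₀ : M) (y : Model p) : Model p →L[ℝ] Model p :=
  mfderiv (mdl p) (mdl p) (chartAt (Model p) x₀).symm y

/-- The coordinate expression of a field of forms in the chart around `x₀`. -/
def chartForm (θ : FormField p M k) (x₀ : M) (y : Model p) : Form p k :=
  (θ ((chartAt (Model p) x₀).symm y)).compContinuousLinearMap (chartFrame x₀ y)

/-- The coordinate expression of a field of bilinear forms in the chart around `x₀`. -/
def chartBilin (g : BilinField p M) (x₀ : M) (y : Model p) : Bilin p :=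
  (g ((chartAt (Model p) x₀).symm y)).bilinearComp (chartFrame x₀ y) (chartFrame x₀ y)

/-- The coordinate expression of a vector field in the chart around `x₀`. -/
def chartVec (K : VecField p M) (x₀ : M) (y : Model p) : Model p :=
  mfderiv (mdl p) (mdl p) (chartAt (Model p) x₀) ((chartAt (Model p) x₀).symm y)
    (K ((chartAt (Model p) x₀).symm y))

/-- The field of forms is smooth. -/
def SmoothForm (θ : FormField p M k) : Prop :=
  ∀ x₀ : M, ContDiffOn ℝ ∞ (chartForm θ x₀) (chartAt (Model p) x₀).target

/-- The vector field is smooth. -/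
def SmoothVec (K : VecField p M) : Prop :=
  ∀ x₀ : M, ContDiffOn ℝ ∞ (chartVec K x₀) (chartAt (Model p) x₀).target

/-- The exterior derivative `F_{μ_1 … μ_{k+1}} = (k+1) ∂_{[μ_1} A_{μ_2 … μ_{k+1}]}`, computed at `x` in
the preferred chart at `x`. -/
def extD (A : FormField p M k) : FormField p M (k + 1) :=
  fun x => extDeriv (chartForm A x) (chartAt (Model p) x x)

/-- The differential `∂_μ a` of a scalar field. -/
def grad (a : M → ℝ) (x : M) : Model p →L[ℝ] ℝ := mfderiv (mdl p) 𝓘(ℝ, ℝ) a x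

variable (p M) in
/-- A smooth Lorentzian metric of signature `(-, +, …, +)`. -/
structure LorentzMetric where
  /-- the bilinear form at each point -/
  val : BilinField p M
  symm : ∀ (x : M) (u w : Model p), val x u w = val x w u
  signature : ∀ x : M, ∃ b : Module.Basis (Idx p) ℝ (Model p), ∀ i j,
    val x (b i) (b j) = if i = j then (if i = 0 then -1 else 1) else 0
  smooth : ∀ x₀ : M, ContDiffOn ℝ ∞ (chartBilin val x₀) (chartAt (Model p) x₀).target

/-- A Levi-Civita tensor of `(M, g)`: a smooth `d`-form taking the values `± √|det g(w_i, w_j)|`. It is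
the same as an orientation of `M`; in a chart its components are `± √(-g)` times the permutation symbol. -/
structure LeviCivita (g : LorentzMetric p M) where
  /-- the `d`-form at each point -/
  val : FormField p M (p + 1 + (p + 1))
  sq : ∀ (x : M) (w : Idx p → Model p),
    val x w ^ 2 = |(Matrix.of fun i j => g.val x (w i) (w j)).det|
  smooth : SmoothForm val

/-- `√(-g)` in the chart around `x₀`. -/
def sqrtDet (g : LorentzMetric p M) (x₀ : M) (y : Model p) : ℝ :=
  √|(gram (chartBilin g.val x₀ y)).det|

/-- The divergence `∇_μ K^μ = (1/√(-g)) ∂_μ (√(-g) K^μ)`, computed at `x` in the preferred chart at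
`x`. -/
def divergence (g : LorentzMetric p M) (K : VecField p M) (x : M) : ℝ :=
  (1 / sqrtDet g x (chartAt (Model p) x x)) *
    ∑ μ : Idx p, fderiv ℝ (fun y : Model p => sqrtDet g x y * chartVec K x y μ)
      (chartAt (Model p) x x) (e μ)

/-- The volume measure `√(-g) d^d x` carried by the domain of the chart around `x₀`. -/
def chartMeasure [MeasurableSpace M] (g : LorentzMetric p M) (x₀ : M) : MeasureTheory.Measure M :=
  (((MeasureTheory.volume : MeasureTheory.Measure (Model p)).restrict
      (chartAt (Model p) x₀).target).withDensity
        fun y => ENNReal.ofReal (sqrtDet g x₀ y)).map (chartAt (Model p) x₀).symm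

/-- The volume measure `√(-g) d^d x` of `(M, g)`: the least measure on `M` that dominates the volume
measures of the chart domains. These agree on overlaps, so that it restricts to each of them. -/
def volMeasure [MeasurableSpace M] (g : LorentzMetric p M) : MeasureTheory.Measure M :=
  ⨆ x₀ : M, chartMeasure g x₀

variable (p M) in
/-- A configuration `(A, a, Λ)` of a `p`-form, a scalar and a `(p+1)`-form, or a variation
`(δA, δa, δΛ)` of such a configuration. -/
structure Config where
  /-- the gauge `p`-form -/
  A : FormField p M p
  /-- the auxiliary scalar -/
  a : M → ℝ
  /-- the auxiliary `(p+1)`-form -/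
  L : FormField p M (p + 1)

/-- The configuration `Φ + s δΦ`. -/
def Config.vary (Φ δΦ : Config p M) (s : ℝ) : Config p M where
  A := fun x => Φ.A x + s • δΦ.A x
  a := fun x => Φ.a x + s * δΦ.a x
  L := fun x => Φ.L x + s • δΦ.L x

variable (g : LorentzMetric p M) (ε : LeviCivita g) (Φ : Config p M)

/-- The gradient of `a` is timelike everywhere. -/
def Timelike (a : M → ℝ) : Prop := ∀ x, covecSq (g.val x) (grad (p := p) a x) < 0

/-- The field of forms is self-dual, `Λ^* = Λ`. -/
def SelfDual (L : FormField p M (p + 1)) : Prop := ∀ x, dual (g.val x) (ε.val x) (L x) = L x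

/-- `v^μ`. -/
def vVec (x : M) : Model p := unitVec (g.val x) (grad Φ.a x)

/-- `E_{μ(p)} = F_{μ(p) ν} v^ν`. -/
def electric (x : M) : Form p p := contractLast (extD Φ.A x) (vVec g Φ x)

/-- `B_{μ(p)} = F^*_{μ(p) ν} v^ν`. -/
def magnetic (x : M) : Form p p :=
  contractLast (dual (g.val x) (ε.val x) (extD Φ.A x)) (vVec g Φ x)

/-- `λ_{μ(p)} = Λ_{μ(p) ν} v^ν`. -/
def lam (x : M) : Form p p := contractLast (Φ.L x) (vVec g Φ x)

/-- The free PST Lagrangian `(1/p!) (½ E·B - ½ B·B)`. It does not involve `Λ`. -/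
def lagPST (x : M) : ℝ :=
  1 / (p.factorial : ℝ) *
    (1 / 2 * dot (g.val x) (electric g Φ x) (magnetic g ε Φ x)
      - 1 / 2 * dot (g.val x) (magnetic g ε Φ x) (magnetic g ε Φ x))

variable (p M) in
/-- Interactions: arbitrary functions of the values of `Λ` and `g` at each point. -/
abbrev Interaction : Type _ := M → Form p (p + 1) → Bilin p → ℝ

/-- The Lagrangian `(1/p!) (½ E·B - ½ B·B + (B + λ)·(B + λ)) - V(Λ, g)`. -/
def lagINZ (V : Interaction p M) (x : M) : ℝ :=
  1 / (p.factorial : ℝ) *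
    (1 / 2 * dot (g.val x) (electric g Φ x) (magnetic g ε Φ x)
      - 1 / 2 * dot (g.val x) (magnetic g ε Φ x) (magnetic g ε Φ x)
      + dot (g.val x) (magnetic g ε Φ x + lam g Φ x) (magnetic g ε Φ x + lam g Φ x))
    - V x (Φ.L x) (g.val x)

/-- The free PST action of a region `D`. -/
def actionPST [MeasurableSpace M] (D : Set M) : ℝ := ∫ x in D, lagPST g ε Φ x ∂(volMeasure g)

/-- The action with auxiliary field and interaction `V`, of a region `D`. -/
def actionINZ [MeasurableSpace M] (V : Interaction p M) (D : Set M) : ℝ :=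
  ∫ x in D, lagINZ g ε Φ V x ∂(volMeasure g)

/-- The transformation with scalar parameter `φ`:
`δA = - (φ/√(-∂a·∂a)) [(E - B) + 2 (B + λ)]`, `δa = φ`, `δΛ = 0`. -/
def deltaPhi (φ : M → ℝ) : Config p M where
  A := fun x => -(φ x / gradNorm (g.val x) (grad Φ.a x)) •
    ((electric g Φ x - magnetic g ε Φ x) + (2 : ℝ) • (magnetic g ε Φ x + lam g Φ x))
  a := φ
  L := fun _ => 0

/-- The transformation whose parameter is a `(p-1)`-form `ψ`:
`δA_{μ(p)} = p v_{[μ_1} ψ_{μ_2 … μ_p]}`, `δa = 0`, `δΛ = 0`. -/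
def deltaPsi (hp : 0 < p) (ψ : FormField p M (p - 1)) : Config p M where
  A := fun x => covWedge hp (unitCov (g.val x) (grad Φ.a x)) (ψ x)
  a := fun _ => 0
  L := fun _ => 0

/-- The action with interaction `V` is invariant at `Φ`, up to boundary terms, under the variation
`δΦ`, whose parameter vanishes at the points of `Z`. That is, the variation of the Lagrangian is the
divergence of a smooth vector field `K` that vanishes wherever the parameter does; the variation of the
action of a compact region `D` is the integral of this divergence; and it is zero if the parameter
vanishes outside `D`. -/
def InvariantUpToBoundary [MeasurableSpace M] (V : Interaction p M) (δΦ : Config p M)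
    (Z : Set M) : Prop :=
  ∃ K : VecField p M, SmoothVec K ∧ (∀ x ∈ Z, K x = 0) ∧
    (∀ x, HasDerivAt (fun s : ℝ => lagINZ g ε (Φ.vary δΦ s) V x) (divergence g K x) 0) ∧
    (MeasureTheory.LocallyIntegrable (fun x => V x (Φ.L x) (g.val x)) (volMeasure g) →
      ∀ D : Set M, IsCompact D →
        HasDerivAt (fun s : ℝ => actionINZ g ε (Φ.vary δΦ s) V D)
          (∫ x in D, divergence g K x ∂(volMeasure g)) 0 ∧
        ((∀ x, x ∉ D → x ∈ Z) →
          HasDerivAt (fun s : ℝ => actionINZ g ε (Φ.vary δΦ s) V D) 0 0))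

/-- The equation of motion of `Λ` in the free theory: the free action is stationary under all
compactly supported self-dual variations of `Λ`. -/
def LambdaStationary [MeasurableSpace M] : Prop :=
  ∀ δL : FormField p M (p + 1), SmoothForm δL → SelfDual g ε δL →
    ∀ D : Set M, IsCompact D → (∀ x, x ∉ D → δL x = 0) →
      HasDerivAt (fun s : ℝ => actionINZ g ε
        (Φ.vary { A := fun _ => 0, a := fun _ => 0, L := δL } s) (fun _ _ _ => 0) D) 0 0

/-- The value of `Λ` in terms of `B`,
`Λ_{μ(p+1)} = (p+1) B_{[μ_1 … μ_p} v_{μ_{p+1}]} + (1/p!) ε_{μ(p+1) ν(p+1)} B^{ν(p)} v^{ν_{p+1}}`. -/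
def lambdaSol : FormField p M (p + 1) :=
  fun x => selfDualExt (g.val x) (ε.val x) (grad Φ.a x) (magnetic g ε Φ x)

end Fields

end ChiralForm

end

open scoped Manifold ContDiff

noncomputable section

namespace ChiralForm

/-! ### Frames and contractions -/

section Algebra

variable {p k : ℕ}

/-! Everything is expressed through the pairing ⟨X,Y⟩ = X·Y^* of (p+1)-forms, a multiple of the
density of X∧Y. For even p it is antisymmetric (`pairing_comm`), the dual is an involution
(`dual_dual`), and a (p+1)-form is rebuilt from its own contraction with v and that of its dual
(`TimelikeData.decompose`). Put α = ∂a, N = √(-α·α), W = (E-B)+2(B+λ), Y = W/N, X = dδA, β = ∂δa.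
For self-dual Λ and δΛ = 0 the first variation of the Lagrangian is then 1/(p+1)! times ½⟨F,X⟩ +
⟨Y∧α,X⟩ - ½⟨Y∧β,Y∧α⟩ (`TimelikeData.hasDerivAt_lagAlg`). The interaction does not contribute,
because Λ is inert.

For the scalar parameter, δA = -φY and β = dφ. The number ⟨Y∧a,Y'∧b⟩ changes sign when a and b are
exchanged and is unchanged when Y and Y' are. As F and α are closed, the variation is -½ times the
total derivative built from ⟨δA∧dx^ρ, F+Y∧α⟩ (`variation_scalar`). For the parameter ψ, δA = α∧χ
with χ = ψ/N; closedness of α leaves a factor α in dδA, so ⟨Y∧α,dδA⟩ = 0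
(`pairing_extDeriv_covWedge`), and ½⟨F,dδA⟩ is a total derivative because dF = 0
(`sum_pairing_fderiv_extDeriv`). The density √(-g)⟨·,·⟩ depends on the orientation only
(`sqrt_mul_pairing`), so these total derivatives are covariant divergences of a `current`. It is
linear in δA, hence zero wherever the parameter is.

The action is handled by differentiation under the integral over a compact region
(`hasDerivAt_setIntegral`) and by the divergence theorem, proved with a partition of unity
(`integral_divergence`). Both rest on the volume measure restricting to √(-g) d^dx in each chart
(`volMeasure_restrict_source`).

For the elimination of Λ, put b = B+λ. The variation is (2/p!) b·δλ. The self-dual test form χ times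
the self-dual extension of b has δλ = -χ b, and b·b is positive unless b = 0, since the directions
orthogonal to the timelike v are spacelike. So stationarity means b = 0 (`lambdaStationary_iff`),
and a self-dual form is determined by its electric part (`TimelikeData.eq_selfDualExt`). -/

theorem eq_sum_e (u : Model p) : u = ∑ μ, u μ • e μ := by
  ext i
  simp [e, Pi.single_apply]

/-- Two frames that are dual to each other with respect to `g`. -/
def DualFrames (g : Bilin p) (b b' : Idx p → Model p) : Prop :=
  ∀ i j, g (b i) (b' j) = if i = j then 1 else 0

theorem finrank_model : Module.finrank ℝ (Model p) = Fintype.card (Idx p) := by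
  simp

namespace DualFrames

variable {g : Bilin p} {b b' c c' : Idx p → Model p}

theorem flip (h : DualFrames g b b') : DualFrames g.flip b' b := fun i j => by
  simp [h j i, eq_comm]

theorem linearIndependent (h : DualFrames g b b') : LinearIndependent ℝ b := by
  rw [Fintype.linearIndependent_iff]
  intro a ha i
  have := congrArg (fun u => g u (b' i)) ha
  simpa [h _ i] using this

/-- The basis underlying a frame. -/
def basis (h : DualFrames g b b') : Module.Basis (Idx p) ℝ (Model p) :=
  basisOfLinearIndependentOfCardEqFinrank h.linearIndependent finrank_model.symm

theorem coe_basis (h : DualFrames g b b') : ⇑h.basis = b :=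
  coe_basisOfLinearIndependentOfCardEqFinrank _ _

theorem expand (h : DualFrames g b b') (u : Model p) : u = ∑ j, g u (b' j) • b j := by
  have hu := h.basis.sum_repr u
  rw [coe_basis] at hu
  have : ∀ j, g u (b' j) = h.basis.repr u j := fun j => by
    conv_lhs => rw [← hu]
    simp [h _ j]
  simp only [this, hu]

theorem expand_flip (h : DualFrames g b b') (u : Model p) : u = ∑ j, g (b j) u • b' j :=
  h.flip.expand u

/-- A full contraction does not depend on the frame. -/
theorem sum_smul {F : Type*} [AddCommGroup F] [Module ℝ F] (hb : DualFrames g b b')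
    (hc : DualFrames g c c') (f : MultilinearMap ℝ (fun _ : Fin k => Model p) F)
    (h : MultilinearMap ℝ (fun _ : Fin k => Model p) ℝ) :
    ∑ I : Fin k → Idx p, h (fun i => b' (I i)) • f (fun i => b (I i)) =
      ∑ I : Fin k → Idx p, h (fun i => c' (I i)) • f (fun i => c (I i)) := by
  -- Expanding b in the frame c and expanding c' in the frame b' produce the same coefficients
  -- g(b_I, c'_S); both sides become one double sum.
  have h1 : ∀ I : Fin k → Idx p, f (fun i => b (I i)) =
      ∑ S : Fin k → Idx p, (∏ i, g (b (I i)) (c' (S i))) • f (fun i => c (S i)) := fun I => by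
    conv_lhs => rw [show (fun i => b (I i)) = fun i => ∑ j, g (b (I i)) (c' j) • c j from
      funext fun i => hc.expand _]
    rw [MultilinearMap.map_sum]
    exact Finset.sum_congr rfl fun S _ => MultilinearMap.map_smul_univ _ _ _
  have h2 : ∀ S : Fin k → Idx p, h (fun i => c' (S i)) =
      ∑ I : Fin k → Idx p, (∏ i, g (b (I i)) (c' (S i))) • h (fun i => b' (I i)) := fun S => by
    conv_lhs => rw [show (fun i => c' (S i)) = fun i => ∑ j, g (b j) (c' (S i)) • b' j from
      funext fun i => hb.expand_flip _]
    rw [MultilinearMap.map_sum]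
    exact Finset.sum_congr rfl fun S _ => MultilinearMap.map_smul_univ _ _ _
  simp only [h1, h2, Finset.smul_sum, Finset.sum_smul]
  rw [Finset.sum_comm]
  refine Finset.sum_congr rfl fun S _ => Finset.sum_congr rfl fun I _ => ?_
  rw [smul_smul, smul_eq_mul, mul_comm]

theorem sum_mul (hb : DualFrames g b b')
    (hc : DualFrames g c c') (f h : MultilinearMap ℝ (fun _ : Fin k => Model p) ℝ) :
    ∑ I : Fin k → Idx p, f (fun i => b (I i)) * h (fun i => b' (I i)) =
      ∑ I : Fin k → Idx p, f (fun i => c (I i)) * h (fun i => c' (I i)) := by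
  simpa only [smul_eq_mul, mul_comm] using sum_smul hb hc f h

end DualFrames

/-- A nondegenerate symmetric bilinear form. -/
structure NonDeg (g : Bilin p) : Prop where
  symm : ∀ u w, g u w = g w u
  det_ne : (gram g).det ≠ 0

theorem gram_isSymm {g : Bilin p} (hg : ∀ u w, g u w = g w u) : (gram g).IsSymm := by
  ext i j
  simp [gram, hg (e i)]

/-- Raising indices with the inverse matrix is passage to the dual frame. Every index contraction
can therefore be recomputed in an orthonormal frame or in a transported one. -/
theorem NonDeg.dualFrames {g : Bilin p} (hg : NonDeg g) : DualFrames g e (eUp g) := by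
  intro i j
  have h1 : gram g * (gram g)⁻¹ = 1 := Matrix.mul_nonsing_inv _ (Ne.isUnit hg.det_ne)
  have hs : (gram g)⁻¹.IsSymm := by
    rw [Matrix.IsSymm, Matrix.transpose_nonsing_inv, gram_isSymm hg.symm]
  have h2 := congrFun (congrFun h1 i) j
  rw [Matrix.mul_apply, Matrix.one_apply] at h2
  rw [← h2, eUp]
  simp only [map_sum, map_smul, smul_eq_mul]
  refine Finset.sum_congr rfl fun ν _ => ?_
  rw [mul_comm, show (gram g)⁻¹ j ν = (gram g)⁻¹ ν j from hs.apply ν j]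
  rfl

/-- A vector in the kernel of the Gram matrix is g-orthogonal to everything, so all its coefficients
in the dual frame vanish. -/
theorem DualFrames.nonDeg {g : Bilin p} (hs : ∀ u w, g u w = g w u) {b b' : Idx p → Model p}
    (h : DualFrames g b b') : NonDeg g := by
  refine ⟨hs, ?_⟩
  intro h0
  obtain ⟨v, hv, hv0⟩ := Matrix.exists_mulVec_eq_zero_iff.2 h0
  apply hv
  have h1 : ∀ u, g u (∑ j, v j • e j) = 0 := by
    intro u
    rw [eq_sum_e u]
    simp only [map_sum, FunLike.coe_sum, Finset.sum_apply, map_smul,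
      smul_apply, smul_eq_mul, Finset.mul_sum]
    rw [Finset.sum_comm]
    refine Finset.sum_eq_zero fun i _ => ?_
    have := congrFun hv0 i
    simp only [Matrix.mulVec, dotProduct, gram, Matrix.of_apply, Pi.zero_apply] at this
    calc _ = u i * ∑ x, g (e i) (e x) * v x := by
          rw [Finset.mul_sum]; exact Finset.sum_congr rfl fun _ _ => by ring
      _ = 0 := by rw [this, mul_zero]
  have h2 : (∑ j, v j • e j : Model p) = 0 := by
    rw [h.expand_flip (∑ j, v j • e j)]
    simp [h1]
  ext i
  have := congrArg (fun w : Model p => w i) h2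
  simpa [e, Pi.single_apply] using this

/-! ### Components of forms -/

theorem form_ext_basis {ι : Type*} (b : Module.Basis ι ℝ (Model p)) {α β : Form p k}
    (h : ∀ I : Fin k → ι, Function.Injective I → α (fun i => b (I i)) = β (fun i => b (I i))) :
    α = β := by
  apply ContinuousAlternatingMap.toAlternatingMap_injective
  exact Module.Basis.ext_alternating b fun I hI => h I hI

theorem basisFun_eq_e (μ : Idx p) : (EuclideanSpace.basisFun (Idx p) ℝ).toBasis μ = e μ := by
  simp [e]

theorem form_ext_cov {α β : Form p k} (h : ∀ μ, cov α μ = cov β μ) : α = β := by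
  refine form_ext_basis (EuclideanSpace.basisFun (Idx p) ℝ).toBasis fun I _ => ?_
  simp only [basisFun_eq_e]
  exact h I

theorem map_perm {k : ℕ} (α : Form p k) (u : Fin k → Model p) (σ : Equiv.Perm (Fin k)) :
    α (fun i => u (σ i)) = (Equiv.Perm.sign σ : ℤ) * α u := by
  have := α.toAlternatingMap.map_perm u σ
  rw [Units.smul_def, zsmul_eq_mul] at this
  exact this

/-- The sum of the monomials weighted by the components of a multilinear map is that map, so the
antisymmetrisation can be evaluated on arbitrary vectors and not only on the coordinate basis. -/
theorem ofComp_apply (M : MultilinearMap ℝ (fun _ : Fin k => Model p) ℝ) (u : Fin k → Model p) :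
    ofComp (fun μ => M fun i => e (μ i)) u =
      1 / (k.factorial : ℝ) * ∑ σ : Equiv.Perm (Fin k), (Equiv.Perm.sign σ : ℤ) *
        M fun i => u (σ i) := by
  have h : ∀ w : Fin k → Model p, (∑ μ : Fin k → Idx p, (M fun i => e (μ i)) • dxTensor μ :
      ContinuousMultilinearMap ℝ (fun _ : Fin k => Model p) ℝ) w = M w := fun w => by
    conv_rhs => rw [show w = fun i => ∑ j, w i j • e j from funext fun i => eq_sum_e _]
    rw [MultilinearMap.map_sum, sum_apply]
    refine Finset.sum_congr rfl fun S _ => ?_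
    rw [MultilinearMap.map_smul_univ]
    simp [dxTensor, mul_comm]
  rw [ofComp, ContinuousAlternatingMap.smul_apply, smul_eq_mul,
    ContinuousMultilinearMap.alternatization_apply_apply]
  congr 1
  refine Finset.sum_congr rfl fun σ _ => ?_
  rw [Units.smul_def, zsmul_eq_mul]
  congr 1
  exact h _

theorem cov_ofComp (T : (Fin k → Idx p) → ℝ) (μ : Fin k → Idx p) :
    cov (ofComp T) μ = 1 / (k.factorial : ℝ) * ∑ σ : Equiv.Perm (Fin k),
      (Equiv.Perm.sign σ : ℤ) * T fun i => μ (σ i) := by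
  rw [cov, ofComp, ContinuousAlternatingMap.smul_apply, smul_eq_mul,
    ContinuousMultilinearMap.alternatization_apply_apply]
  congr 1
  refine Finset.sum_congr rfl fun σ _ => ?_
  rw [Units.smul_def, zsmul_eq_mul]
  congr 1
  rw [sum_apply]
  rw [Finset.sum_eq_single fun i => μ (σ i)]
  · simp [dxTensor, e]
  · intro ν _ hν
    obtain ⟨i, hi⟩ := Function.ne_iff.1 hν
    simp only [dxTensor, smul_apply,
      ContinuousMultilinearMap.compContinuousLinearMap_apply,
      ContinuousMultilinearMap.mkPiAlgebra_apply, smul_eq_mul, mul_eq_zero]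
    right
    refine Finset.prod_eq_zero (Finset.mem_univ i) ?_
    simp [e, hi]
  · simp

/-- The components `T` are antisymmetric. -/
def Antisymm (T : (Fin k → Idx p) → ℝ) : Prop :=
  ∀ μ (σ : Equiv.Perm (Fin k)), T (fun i => μ (σ i)) = (Equiv.Perm.sign σ : ℤ) * T μ

theorem sign_mul_self_real {n : ℕ} (σ : Equiv.Perm (Fin n)) :
    ((Equiv.Perm.sign σ : ℤ) : ℝ) * ((Equiv.Perm.sign σ : ℤ) : ℝ) = 1 := by
  rcases Int.units_eq_one_or (Equiv.Perm.sign σ) with h | h <;> simp [h]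

theorem antisymm_cov (θ : Form p k) : Antisymm (cov θ) := fun μ σ =>
  map_perm θ (fun i => e (μ i)) σ

theorem cov_ofComp_of_antisymm {T : (Fin k → Idx p) → ℝ} (hT : Antisymm T) (μ : Fin k → Idx p) :
    cov (ofComp T) μ = T μ := by
  rw [cov_ofComp]
  simp only [hT μ, ← mul_assoc, sign_mul_self_real, one_mul]
  have : (k.factorial : ℝ) ≠ 0 := by positivity
  simp [Fintype.card_perm]
  field_simp

theorem ofComp_eq_of_cov {T : (Fin k → Idx p) → ℝ} {θ : Form p k} (h : ∀ μ, T μ = cov θ μ) :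
    ofComp T = θ := by
  refine form_ext_cov fun μ => ?_
  rw [show T = cov θ from funext h, cov_ofComp_of_antisymm (antisymm_cov θ)]

/-- Each permutation in the antisymmetrisation is moved onto `S` by relabelling the summation
indices. The two signs cancel, and the k! equal terms absorb the weight. -/
theorem sum_antisymm_mul_cov_ofComp {S : (Fin k → Idx p) → ℝ} (hS : Antisymm S)
    (T : (Fin k → Idx p) → ℝ) : ∑ μ, S μ * cov (ofComp T) μ = ∑ μ, S μ * T μ := by
  have h : ∀ σ : Equiv.Perm (Fin k), ∑ μ : Fin k → Idx p, S μ *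
      ((Equiv.Perm.sign σ : ℤ) * T fun i => μ (σ i)) = ∑ μ, S μ * T μ := fun σ => by
    rw [← Equiv.sum_comp (σ.arrowCongr (Equiv.refl (Idx p)))
      (fun μ => S μ * ((Equiv.Perm.sign σ : ℤ) * T fun i => μ (σ i)))]
    refine Finset.sum_congr rfl fun μ _ => ?_
    have h1 : (fun i => (σ.arrowCongr (Equiv.refl (Idx p))) μ (σ i)) = μ := by
      ext i; simp [Equiv.arrowCongr]
    have h2 := hS ((σ.arrowCongr (Equiv.refl (Idx p))) μ) σ
    rw [h1] at h2
    rw [h1, h2]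
    ring
  simp only [cov_ofComp, Finset.mul_sum]
  rw [Finset.sum_comm]
  have hk : (k.factorial : ℝ) ≠ 0 := by positivity
  calc _ = ∑ σ : Equiv.Perm (Fin k), 1 / (k.factorial : ℝ) * ∑ μ : Fin k → Idx p, S μ *
      ((Equiv.Perm.sign σ : ℤ) * T fun i => μ (σ i)) := by
        refine Finset.sum_congr rfl fun σ _ => ?_
        rw [Finset.mul_sum]
        exact Finset.sum_congr rfl fun μ _ => by ring
    _ = _ := by
        simp only [h]
        simp [Fintype.card_perm]
        field_simp

end Algebra

section Algebra

variable {p k : ℕ}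

/-! ### Products and partial evaluations of multilinear maps -/

/-- The map `w ↦ ε (u, w)`. -/
def rightML {a b : ℕ} (ε : Form p (a + b)) (u : Fin a → Model p) :
    MultilinearMap ℝ (fun _ : Fin b => Model p) ℝ :=
  (ε.toMultilinearMap.domDomCongr finSumFinEquiv.symm).currySum u

theorem rightML_apply {a b : ℕ} (ε : Form p (a + b)) (u : Fin a → Model p) (w : Fin b → Model p) :
    rightML ε u w = ε (Fin.append u w) := by
  rw [rightML, MultilinearMap.currySum_apply', MultilinearMap.domDomCongr_apply]
  change ε _ = ε _
  congr 1
  ext i : 1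
  refine Fin.addCases (fun i => ?_) (fun i => ?_) i <;> simp

/-- The map `u ↦ ε (u, w)`. -/
def leftML {a b : ℕ} (ε : Form p (a + b)) (w : Fin b → Model p) :
    MultilinearMap ℝ (fun _ : Fin a => Model p) ℝ :=
  (ε.toMultilinearMap.domDomCongr
    (finSumFinEquiv.symm.trans (Equiv.sumComm (Fin a) (Fin b)))).currySum w

theorem leftML_apply {a b : ℕ} (ε : Form p (a + b)) (u : Fin a → Model p) (w : Fin b → Model p) :
    leftML ε w u = ε (Fin.append u w) := by
  rw [leftML, MultilinearMap.currySum_apply', MultilinearMap.domDomCongr_apply]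
  change ε _ = ε _
  congr 1
  ext i : 1
  refine Fin.addCases (fun i => ?_) (fun i => ?_) i <;> simp

theorem comp_append {α β : Type*} {a b : ℕ} (f : α → β) (u : Fin a → α) (w : Fin b → α) :
    (fun i => f (Fin.append u w i)) = Fin.append (fun i => f (u i)) (fun i => f (w i)) := by
  ext i : 1
  refine Fin.addCases (fun i => ?_) (fun i => ?_) i <;> simp

theorem comp_snoc {α β : Type*} {a : ℕ} (f : α → β) (u : Fin a → α) (w : α) :
    (fun i => f (Fin.snoc (α := fun _ => α) u w i)) =
      Fin.snoc (α := fun _ => β) (fun i => f (u i)) (f w) := by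
  ext i : 1
  refine Fin.lastCases ?_ (fun i => ?_) i <;> simp

theorem map_append_perm_right {a b : ℕ} (ε : Form p (a + b)) (u : Fin a → Model p)
    (w : Fin b → Model p) (σ : Equiv.Perm (Fin b)) :
    ε (Fin.append u (fun i => w (σ i))) = (Equiv.Perm.sign σ : ℤ) * ε (Fin.append u w) := by
  let τ : Equiv.Perm (Fin (a + b)) := finSumFinEquiv.permCongr (Equiv.Perm.sumCongr 1 σ)
  have hτ : Equiv.Perm.sign τ = Equiv.Perm.sign σ := by
    simp [τ, Equiv.Perm.sign_permCongr, Equiv.Perm.sign_sumCongr]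
  rw [← hτ, ← map_perm]
  congr 1
  ext i : 1
  refine Fin.addCases (fun i => ?_) (fun i => ?_) i <;> simp [τ, Equiv.permCongr_apply]

theorem map_append_perm_left {a b : ℕ} (ε : Form p (a + b)) (u : Fin a → Model p)
    (w : Fin b → Model p) (σ : Equiv.Perm (Fin a)) :
    ε (Fin.append (fun i => u (σ i)) w) = (Equiv.Perm.sign σ : ℤ) * ε (Fin.append u w) := by
  let τ : Equiv.Perm (Fin (a + b)) := finSumFinEquiv.permCongr (Equiv.Perm.sumCongr σ 1)
  have hτ : Equiv.Perm.sign τ = Equiv.Perm.sign σ := by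
    simp [τ, Equiv.Perm.sign_permCongr, Equiv.Perm.sign_sumCongr]
  rw [← hτ, ← map_perm]
  congr 1
  ext i : 1
  refine Fin.addCases (fun i => ?_) (fun i => ?_) i <;> simp [τ, Equiv.permCongr_apply]

/-- Exchanging two blocks of equal length. -/
theorem map_append_comm {a : ℕ} (ε : Form p (a + a)) (u w : Fin a → Model p) :
    ε (Fin.append w u) = (-1) ^ a * ε (Fin.append u w) := by
  -- Indexing the slots by a position and a block turns the exchange into `a` independent flips of
  -- the block label, each of sign -1.
  let s : Fin a × Bool ≃ Fin (a + a) :=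
    ((Equiv.prodComm _ _).trans (Equiv.boolProdEquivSum _)).trans finSumFinEquiv
  let τ : Equiv.Perm (Fin (a + a)) := s.permCongr (Equiv.prodCongrRight fun _ => Equiv.boolNot)
  have hτ : Equiv.Perm.sign τ = (-1) ^ a := by
    simp only [τ, Equiv.Perm.sign_permCongr, Equiv.Perm.sign_prodCongrRight]
    have : Equiv.Perm.sign Equiv.boolNot = -1 := by decide
    simp [this]
  have := map_perm ε (Fin.append u w) τ
  rw [hτ] at this
  push_cast at this
  rw [← this]
  congr 1
  ext i : 1
  refine Fin.addCases (fun i => ?_) (fun i => ?_) i <;>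
    simp [τ, s, Equiv.permCongr_apply, Equiv.boolProdEquivSum, -Fin.natAdd_eq_addNat]

/-! ### Basic operations, evaluated on vectors -/

theorem ofComp_apply_of_alt (M : MultilinearMap ℝ (fun _ : Fin k => Model p) ℝ)
    (hM : ∀ u (σ : Equiv.Perm (Fin k)), M (fun i => u (σ i)) = (Equiv.Perm.sign σ : ℤ) * M u)
    (u : Fin k → Model p) : ofComp (fun μ => M fun i => e (μ i)) u = M u := by
  rw [ofComp_apply]
  simp only [hM u, ← mul_assoc, sign_mul_self_real, one_mul]
  have : (k.factorial : ℝ) ≠ 0 := by positivity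
  simp [Fintype.card_perm]
  field_simp

theorem map_snoc (θ : Form p (k + 1)) (u : Fin k → Model p) (w : Model p) :
    θ (Fin.snoc (α := fun _ => Model p) u w) = (-1) ^ k * θ.curryLeft w u := by
  have := θ.map_insertNth (Fin.last k) w u
  rw [Fin.insertNth_last'] at this
  simpa using this

theorem contractLast_eq (θ : Form p (k + 1)) (w : Model p) :
    contractLast θ w = (-1 : ℝ) ^ k • θ.curryLeft w := by
  refine ofComp_eq_of_cov fun μ => ?_
  rw [map_snoc, cov, ContinuousAlternatingMap.smul_apply, smul_eq_mul]

theorem contractLast_apply (θ : Form p (k + 1)) (w : Model p) (u : Fin k → Model p) :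
    contractLast θ w u = θ (Fin.snoc (α := fun _ => Model p) u w) := by
  rw [contractLast_eq, map_snoc, ContinuousAlternatingMap.smul_apply, smul_eq_mul]

theorem contractLast_add (θ θ' : Form p (k + 1)) (w : Model p) :
    contractLast (θ + θ') w = contractLast θ w + contractLast θ' w := by
  ext u; simp [contractLast_apply]

theorem contractLast_smul (c : ℝ) (θ : Form p (k + 1)) (w : Model p) :
    contractLast (c • θ) w = c • contractLast θ w := by
  ext u; simp [contractLast_apply]

/-- Transversality of E, B and λ to v enters only in this form: they vanish as soon as one argument
is v. -/
theorem contractLast_apply_eq_zero (θ : Form p (k + 1)) {w : Model p} {u : Fin k → Model p}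
    {i : Fin k} (h : u i = w) : contractLast θ w u = 0 := by
  rw [contractLast_apply]
  exact θ.map_eq_zero_of_eq _ (i := i.castSucc) (j := Fin.last k) (by simp [h])
    (Fin.castSucc_lt_last i).ne

/-- The defining sum is already alternating in its free slots, so the outer antisymmetrisation
changes nothing. -/
theorem dual_apply (g : Bilin p) (ε : Form p (p + 1 + (p + 1))) (F : Form p (p + 1))
    (u : Fin (p + 1) → Model p) :
    dual g ε F u = 1 / ((p + 1).factorial : ℝ) *
      ∑ ν : Fin (p + 1) → Idx p, ε (Fin.append u fun i => e (ν i)) * con g F ν := by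
  let M : MultilinearMap ℝ (fun _ : Fin (p + 1) => Model p) ℝ :=
    (1 / ((p + 1).factorial : ℝ)) • ∑ ν : Fin (p + 1) → Idx p,
      con g F ν • leftML ε (fun i => e (ν i))
  have hM : ∀ u, M u = 1 / ((p + 1).factorial : ℝ) *
      ∑ ν : Fin (p + 1) → Idx p, ε (Fin.append u fun i => e (ν i)) * con g F ν := fun u => by
    simp [M, leftML_apply, mul_comm]
  rw [← hM, ← ofComp_apply_of_alt M ?_]
  · simp only [hM]
    refine congrArg (fun T => (ofComp T : Form p (p + 1)) u) (funext fun μ => ?_)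
    refine congrArg _ (Finset.sum_congr rfl fun ν _ => ?_)
    rw [cov, comp_append]
  · intro u σ
    simp only [hM, map_append_perm_left, Finset.mul_sum]
    refine Finset.sum_congr rfl fun ν _ => by ring

theorem dual_apply_frame {g : Bilin p} (hg : NonDeg g) (ε : Form p (p + 1 + (p + 1)))
    (F : Form p (p + 1)) {b b' : Idx p → Model p} (hb : DualFrames g b b')
    (u : Fin (p + 1) → Model p) :
    dual g ε F u = 1 / ((p + 1).factorial : ℝ) *
      ∑ I : Fin (p + 1) → Idx p, ε (Fin.append u fun i => b (I i)) * F fun i => b' (I i) := by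
  rw [dual_apply]
  congr 1
  have := hg.dualFrames.sum_mul hb (rightML ε u) F.toMultilinearMap
  simp only [rightML_apply] at this
  exact this

theorem dual_add (g : Bilin p) (ε : Form p (p + 1 + (p + 1))) (F F' : Form p (p + 1)) :
    dual g ε (F + F') = dual g ε F + dual g ε F' := by
  ext u
  simp only [dual_apply, ContinuousAlternatingMap.add_apply, con, mul_add, Finset.sum_add_distrib]

theorem dual_smul (g : Bilin p) (ε : Form p (p + 1 + (p + 1))) (c : ℝ) (F : Form p (p + 1)) :
    dual g ε (c • F) = c • dual g ε F := by
  ext u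
  simp only [dual_apply, ContinuousAlternatingMap.smul_apply, con, smul_eq_mul, Finset.mul_sum]
  exact Finset.sum_congr rfl fun _ _ => by ring

theorem dual_neg (g : Bilin p) (ε : Form p (p + 1 + (p + 1))) (F : Form p (p + 1)) :
    dual g ε (-F) = -dual g ε F := by
  ext u
  simp only [dual_apply, ContinuousAlternatingMap.neg_apply, con, mul_neg, Finset.sum_neg_distrib]

theorem dot_frame {g : Bilin p} (hg : NonDeg g) (α β : Form p k) {b b' : Idx p → Model p}
    (hb : DualFrames g b b') :
    dot g α β = ∑ I : Fin k → Idx p, (α fun i => b (I i)) * β fun i => b' (I i) :=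
  hg.dualFrames.sum_mul hb α.toMultilinearMap β.toMultilinearMap

theorem NonDeg.dualFrames' {g : Bilin p} (hg : NonDeg g) : DualFrames g (eUp g) e := fun i j => by
  rw [hg.symm, hg.dualFrames j i]
  simp [eq_comm]

theorem dot_comm {g : Bilin p} (hg : NonDeg g) (α β : Form p k) : dot g α β = dot g β α := by
  rw [dot_frame hg α β hg.dualFrames']
  exact Finset.sum_congr rfl fun _ _ => mul_comm _ _

theorem dot_add_left (g : Bilin p) (α α' β : Form p k) :
    dot g (α + α') β = dot g α β + dot g α' β := by
  simp [dot, cov, add_mul, Finset.sum_add_distrib]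

theorem dot_add_right (g : Bilin p) (α β β' : Form p k) :
    dot g α (β + β') = dot g α β + dot g α β' := by
  simp [dot, con, mul_add, Finset.sum_add_distrib]

theorem dot_smul_left (g : Bilin p) (c : ℝ) (α β : Form p k) :
    dot g (c • α) β = c * dot g α β := by
  simp [dot, cov, Finset.mul_sum, mul_assoc]

theorem dot_smul_right (g : Bilin p) (c : ℝ) (α β : Form p k) :
    dot g α (c • β) = c * dot g α β := by
  simp only [dot, con, ContinuousAlternatingMap.smul_apply, smul_eq_mul, Finset.mul_sum]
  exact Finset.sum_congr rfl fun _ _ => by ring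

theorem dot_neg_left (g : Bilin p) (α β : Form p k) : dot g (-α) β = -dot g α β := by
  simp [dot, cov]

theorem dot_neg_right (g : Bilin p) (α β : Form p k) : dot g α (-β) = -dot g α β := by
  simp [dot, con]

/-! ### Raising the index of a covector -/

/-- The vector `g^{μν} c_μ ∂_ν`. -/
def sharp (g : Bilin p) (c : Model p →L[ℝ] ℝ) : Model p := ∑ μ, c (e μ) • eUp g μ

theorem apply_sharp {g : Bilin p} (hg : NonDeg g) (c : Model p →L[ℝ] ℝ) (u : Model p) :
    g u (sharp g c) = c u := by
  conv_rhs => rw [hg.dualFrames.expand u]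
  simp [sharp, mul_comm]

theorem sharp_frame {g : Bilin p} (hg : NonDeg g) (c : Model p →L[ℝ] ℝ) {b b' : Idx p → Model p}
    (hb : DualFrames g b b') : sharp g c = ∑ i, c (b i) • b' i := by
  rw [hb.expand_flip (sharp g c)]
  simp only [apply_sharp hg]

theorem covecSq_eq (g : Bilin p) (α : Model p →L[ℝ] ℝ) : covecSq g α = α (sharp g α) := by
  simp [covecSq, sharp]

/-- `v_μ`, as a covector. -/
def unitForm (g : Bilin p) (α : Model p →L[ℝ] ℝ) : Model p →L[ℝ] ℝ := (gradNorm g α)⁻¹ • α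

theorem unitCov_eq (g : Bilin p) (α : Model p →L[ℝ] ℝ) (μ : Idx p) :
    unitCov g α μ = unitForm g α (e μ) := by
  simp [unitCov, unitForm, div_eq_inv_mul]

theorem unitVec_eq (g : Bilin p) (α : Model p →L[ℝ] ℝ) :
    unitVec g α = sharp g (unitForm g α) := by
  simp only [unitVec, sharp, unitCov_eq]

theorem sharp_smul (g : Bilin p) (r : ℝ) (c : Model p →L[ℝ] ℝ) : sharp g (r • c) = r • sharp g c := by
  simp [sharp, Finset.smul_sum, smul_smul]

theorem sharp_add (g : Bilin p) (c c' : Model p →L[ℝ] ℝ) :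
    sharp g (c + c') = sharp g c + sharp g c' := by
  simp [sharp, add_smul, Finset.sum_add_distrib]

theorem gradNorm_pos {g : Bilin p} {α : Model p →L[ℝ] ℝ} (h : covecSq g α < 0) :
    0 < gradNorm g α := Real.sqrt_pos.2 (by linarith)

theorem gradNorm_sq {g : Bilin p} {α : Model p →L[ℝ] ℝ} (h : covecSq g α < 0) :
    gradNorm g α ^ 2 = -covecSq g α := Real.sq_sqrt (by linarith)

theorem unitForm_unitVec {g : Bilin p} {α : Model p →L[ℝ] ℝ} (h : covecSq g α < 0) :
    unitForm g α (unitVec g α) = -1 := by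
  have h1 := gradNorm_sq h
  have h2 := (gradNorm_pos h).ne'
  rw [covecSq_eq] at h1
  rw [unitVec_eq, unitForm, sharp_smul]
  simp only [smul_apply, map_smul, smul_eq_mul]
  field_simp
  linarith

theorem apply_unitVec {g : Bilin p} (hg : NonDeg g) (α : Model p →L[ℝ] ℝ) (u : Model p) :
    g u (unitVec g α) = unitForm g α u := by
  rw [unitVec_eq, apply_sharp hg]

end Algebra

section Algebra

variable {p k : ℕ}

/-! ### Lorentzian bilinear forms and adapted frames -/

/-- A symmetric bilinear form of signature `(-, +, …, +)`. -/
structure Lorentzian (g : Bilin p) : Prop where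
  symm : ∀ u w, g u w = g w u
  signature : ∃ b : Module.Basis (Idx p) ℝ (Model p), ∀ i j,
    g (b i) (b j) = if i = j then (if i = 0 then -1 else 1) else 0

/-- A frame that is orthonormal for a form of signature `(-, +, …, +)`. -/
def OrthoFrame (g : Bilin p) (b : Idx p → Model p) : Prop :=
  ∀ i j, g (b i) (b j) = if i = j then (if i = 0 then -1 else 1) else 0

/-- The diagonal entries `(-1, 1, …, 1)`. -/
def eta (i : Idx p) : ℝ := if i = 0 then -1 else 1

theorem prod_eta : ∏ i : Idx p, eta i = -1 := by
  simp only [eta]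
  rw [Finset.prod_ite_eq' Finset.univ (0 : Idx p) (fun _ => (-1 : ℝ))]
  simp

theorem OrthoFrame.dualFrames {g : Bilin p} {b : Idx p → Model p} (h : OrthoFrame g b) :
    DualFrames g b (fun i => eta i • b i) := by
  intro i j
  simp only [map_smul, smul_eq_mul, h i j, eta]
  split_ifs <;> simp_all

theorem Lorentzian.nonDeg {g : Bilin p} (hg : Lorentzian g) : NonDeg g := by
  obtain ⟨b, hb⟩ := hg.signature
  exact DualFrames.nonDeg hg.symm (OrthoFrame.dualFrames (b := b) hb)

theorem OrthoFrame.apply_eq {g : Bilin p} {b : Module.Basis (Idx p) ℝ (Model p)}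
    (hb : OrthoFrame g b) (u w : Model p) :
    g u w = -(b.repr u 0 * b.repr w 0) +
      ∑ i ∈ Finset.univ.erase 0, b.repr u i * b.repr w i := by
  have : g u w = ∑ i, eta i * (b.repr u i * b.repr w i) := by
    conv_lhs => rw [← b.sum_repr u, ← b.sum_repr w]
    simp only [map_sum, FunLike.coe_sum, Finset.sum_apply, map_smul, smul_apply, smul_eq_mul,
      hb _ _]
    refine Finset.sum_congr rfl fun i _ => ?_
    simp [eta]
    ring_nf
  rw [this, ← Finset.add_sum_erase _ _ (Finset.mem_univ (0 : Idx p))]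
  congr 1
  · simp [eta]
  · refine Finset.sum_congr rfl fun i hi => ?_
    simp [eta, Finset.ne_of_mem_erase hi]

/-- The orthogonal complement of a timelike vector is spacelike. -/
theorem Lorentzian.pos_of_orthogonal {g : Bilin p} (hg : Lorentzian g) {v u : Model p}
    (hv : g v v = -1) (hvu : g v u = 0) (hu : u ≠ 0) : 0 < g u u := by
  obtain ⟨b, hb⟩ := hg.signature
  have hb' : OrthoFrame g b := hb
  rw [hb'.apply_eq] at hv hvu ⊢
  have hcs := Finset.sum_mul_sq_le_sq_mul_sq (Finset.univ.erase (0 : Idx p))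
    (fun i => b.repr v i) (fun i => b.repr u i)
  simp only [← pow_two] at *
  have hP : 0 ≤ ∑ i ∈ Finset.univ.erase (0 : Idx p), b.repr u i ^ 2 :=
    Finset.sum_nonneg fun _ _ => sq_nonneg _
  have hQ : 0 ≤ ∑ i ∈ Finset.univ.erase (0 : Idx p), b.repr v i ^ 2 :=
    Finset.sum_nonneg fun _ _ => sq_nonneg _
  have h0 : ∑ i ∈ Finset.univ.erase (0 : Idx p), b.repr u i ^ 2 = 0 → b.repr u 0 = 0 → False := by
    intro h1 h2
    rw [Finset.sum_eq_zero_iff_of_nonneg fun _ _ => sq_nonneg _] at h1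
    apply hu
    rw [← b.sum_repr u]
    refine Finset.sum_eq_zero fun i _ => ?_
    by_cases hi : i = 0
    · rw [hi, h2, zero_smul]
    · rw [pow_eq_zero_iff two_ne_zero |>.1 (h1 i (Finset.mem_erase.2 ⟨hi, Finset.mem_univ _⟩)),
        zero_smul]
  set P := ∑ i ∈ Finset.univ.erase (0 : Idx p), b.repr u i ^ 2
  set Q := ∑ i ∈ Finset.univ.erase (0 : Idx p), b.repr v i ^ 2
  set R := ∑ i ∈ Finset.univ.erase (0 : Idx p), b.repr v i * b.repr u i
  set c := b.repr v 0
  set d := b.repr u 0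
  have hR : R = c * d := by linarith
  have hQ' : Q = c ^ 2 - 1 := by linarith
  rw [hR, hQ'] at hcs
  have hc : 1 ≤ c ^ 2 := by linarith
  rcases hP.eq_or_lt with h | h
  · exfalso
    refine h0 h.symm ?_
    rw [← h, mul_zero] at hcs
    have : (c * d) ^ 2 = 0 := le_antisymm hcs (sq_nonneg _)
    rw [pow_eq_zero_iff two_ne_zero, mul_eq_zero] at this
    rcases this with h | h
    · rw [h] at hc; norm_num at hc
    · exact h
  -- Cauchy–Schwarz on the spatial components reads c²d² ≤ (c²-1)P, that is c²(P-d²) ≥ P > 0.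
  · have : 0 < c ^ 2 * (P - d ^ 2) := by nlinarith
    have := (pos_iff_pos_of_mul_pos this).1 (by linarith)
    linarith

/-- An orthonormal basis of a positive definite form that contains a given unit vector. -/
theorem exists_basis_of_posDef {V ι : Type*} [AddCommGroup V] [Module ℝ V] [FiniteDimensional ℝ V]
    [Fintype ι] [DecidableEq ι] (hc : Module.finrank ℝ V = Fintype.card ι) (h : V →ₗ[ℝ] V →ₗ[ℝ] ℝ)
    (hs : ∀ u w, h u w = h w u) (hp : ∀ u, u ≠ 0 → 0 < h u u) (i₀ : ι) (v : V) (hv : h v v = 1) :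
    ∃ b : ι → V, b i₀ = v ∧ ∀ i j, h (b i) (b j) = if i = j then 1 else 0 := by
  let core : InnerProductSpace.Core ℝ V :=
    { inner := fun u w => h u w
      conj_inner_symm := fun u w => by simp [hs u w]
      re_inner_nonneg := fun u => by
        by_cases hu : u = 0
        · simp [hu]
        · simpa using (hp u hu).le
      add_left := fun u w z => by simp
      smul_left := fun u w r => by simp
      definite := fun u hu => by
        by_contra h0
        exact (hp u h0).ne' hu }
  let _ : NormedAddCommGroup V := core.toNormedAddCommGroup
  let _ : InnerProductSpace ℝ V := InnerProductSpace.ofCore core.toCore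
  have hin : ∀ u w : V, inner ℝ u w = h u w := fun _ _ => rfl
  have hn : ‖v‖ = 1 := by
    have := real_inner_self_eq_norm_sq v
    rw [hin, hv] at this
    nlinarith [norm_nonneg v]
  have ho : Orthonormal ℝ (Set.domRestrict {i₀} fun _ : ι => v) := by
    constructor
    · rintro ⟨i, hi⟩; exact hn
    · rintro ⟨i, hi⟩ ⟨j, hj⟩ hij
      simp only [Set.mem_singleton_iff] at hi hj
      exact absurd (Subtype.ext (hi.trans hj.symm)) hij
  obtain ⟨b, hb⟩ := ho.exists_orthonormalBasis_extension_of_card_eq hc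
  refine ⟨b, hb i₀ rfl, fun i j => ?_⟩
  rw [← hin]
  exact orthonormal_iff_ite.1 b.orthonormal i j

/-- Reversing the sign of g along v gives g + 2 g(v,·)⊗g(v,·), which is positive definite and gives
v length one. An orthonormal basis for it that contains v is orthonormal for g, with v as the
timelike member. -/
theorem Lorentzian.exists_orthoFrame {g : Bilin p} (hg : Lorentzian g) {v : Model p}
    (hv : g v v = -1) : ∃ b : Idx p → Model p, b 0 = v ∧ OrthoFrame g b := by
  let h : Model p →ₗ[ℝ] Model p →ₗ[ℝ] ℝ :=
    LinearMap.mk₂ ℝ (fun u w => g u w + 2 * (g v u * g v w))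
      (fun _ _ _ => by simp; ring) (fun _ _ _ => by simp; ring)
      (fun _ _ _ => by simp; ring) (fun _ _ _ => by simp; ring)
  have hh : ∀ u w, h u w = g u w + 2 * (g v u * g v w) := fun _ _ => rfl
  obtain ⟨b, hb0, hb⟩ := exists_basis_of_posDef finrank_model h
    (fun u w => by rw [hh, hh, hg.symm u w]; ring)
    (fun u hu => by
      rw [hh]
      -- The vector u + g(v,u)v is the component of u orthogonal to v; if it is nonzero it is
      -- spacelike, and otherwise u is a multiple of v.
      by_cases ht : u + g v u • v = 0
      · have hu' : u = -(g v u) • v := by rw [neg_smul]; exact eq_neg_of_add_eq_zero_left ht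
        have h0 : g v u ≠ 0 := fun h0 => hu (by rw [hu', h0]; simp)
        have h1 : g u u = -(g v u) ^ 2 := by
          conv_lhs => rw [hu']
          simp [hv]
          ring
        rw [h1]
        have := sq_pos_of_ne_zero h0
        nlinarith
      · have := hg.pos_of_orthogonal hv (u := u + g v u • v) (by simp [hv]) ht
        simp only [map_add, add_apply, map_smul, smul_apply, smul_eq_mul, hv, hg.symm u v] at this
        nlinarith) 0 v (by rw [hh, hv]; norm_num)
  refine ⟨b, hb0, fun i j => ?_⟩
  have h1 : ∀ i, g v (b i) = if i = 0 then -1 else 0 := fun i => by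
    have := hb 0 i
    rw [hh, hb0, hv] at this
    split_ifs at this ⊢ with h h' h'
    · linarith
    · exact absurd h.symm h'
    · exact absurd h'.symm h
    · linarith
  have := hb i j
  rw [hh, h1, h1] at this
  split_ifs at this ⊢ <;> simp_all

/-! ### The exterior product with a covector -/

theorem ofComp_add {T T' : (Fin k → Idx p) → ℝ} : (ofComp (fun μ => T μ + T' μ) : Form p k) =
    ofComp T + ofComp T' := by
  refine form_ext_cov fun μ => ?_
  have : cov (ofComp T + ofComp T') μ = cov (ofComp T) μ + cov (ofComp T') μ := rfl
  rw [this]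
  simp only [cov_ofComp, mul_add, Finset.sum_add_distrib]

theorem ofComp_sum {ι : Type*} (s : Finset ι) (T : ι → (Fin k → Idx p) → ℝ) :
    (ofComp (fun μ => ∑ i ∈ s, T i μ) : Form p k) = ∑ i ∈ s, ofComp (T i) := by
  classical
  induction s using Finset.induction_on with
  | empty =>
    refine form_ext_cov fun μ => ?_
    rw [cov_ofComp]
    simp [cov]
  | insert a s ha ih =>
    simp only [Finset.sum_insert ha, ofComp_add, ih]

theorem ofComp_smul (c : ℝ) (T : (Fin k → Idx p) → ℝ) :
    (ofComp (fun μ => c * T μ) : Form p k) = c • ofComp T := by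
  refine form_ext_cov fun μ => ?_
  have : cov (c • ofComp T : Form p k) μ = c * cov (ofComp T) μ := rfl
  rw [this]
  simp only [cov_ofComp, Finset.mul_sum]
  exact Finset.sum_congr rfl fun _ _ => by ring

/-- Composition with τ permutes the terms of the antisymmetrisation, at the cost of the sign of τ.
-/
theorem ofComp_perm (T : (Fin k → Idx p) → ℝ) (τ : Equiv.Perm (Fin k)) :
    (ofComp (fun μ => T fun i => μ (τ i)) : Form p k) =
      ((Equiv.Perm.sign τ : ℤ) : ℝ) • ofComp T := by
  refine form_ext_cov fun μ => ?_
  have : cov (((Equiv.Perm.sign τ : ℤ) : ℝ) • ofComp T : Form p k) μ =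
    ((Equiv.Perm.sign τ : ℤ) : ℝ) * cov (ofComp T) μ := rfl
  rw [this, cov_ofComp, cov_ofComp, mul_left_comm]
  refine congrArg _ ?_
  rw [Finset.mul_sum, ← Equiv.sum_comp (Equiv.mulRight τ⁻¹)]
  refine Finset.sum_congr rfl fun σ _ => ?_
  have hτ : ∀ i, τ⁻¹ (τ i) = i := τ.symm_apply_apply
  simp only [Equiv.coe_mulRight, Equiv.Perm.sign_mul, Equiv.Perm.sign_inv, Units.val_mul,
    Equiv.Perm.coe_mul, Function.comp_apply, hτ, Int.cast_mul]
  ring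

/-- This reconciles the signed sum over the slot that goes first with antisymmetrisation of weight
one: bringing slot i to the front is a cycle of sign (-1)^i, so the k+1 summands have the same
antisymmetrisation. In particular it identifies `extDeriv` with (k+1)∂_[μ A_…]. -/
theorem alternatizeUncurryFin_eq_ofComp (f : Model p →L[ℝ] Form p k) :
    ContinuousAlternatingMap.alternatizeUncurryFin f =
      ofComp fun μ => ((k : ℝ) + 1) * cov (f (e (μ 0))) (Fin.tail μ) := by
  rw [ofComp_smul]
  have h : ∀ i : Fin (k + 1), (ofComp (fun μ : Fin (k + 1) → Idx p =>
      (-1 : ℝ) ^ (i : ℕ) * cov (f (e (μ i))) (i.removeNth μ)) : Form p (k + 1)) =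
      ofComp fun μ => cov (f (e (μ 0))) (Fin.tail μ) := fun i => by
    rw [ofComp_smul]
    have h1 := ofComp_perm (fun μ : Fin (k + 1) → Idx p => cov (f (e (μ 0))) (Fin.tail μ))
      i.cycleRange.symm
    simp only [Fin.cycleRange_symm_zero, Equiv.Perm.sign_symm, Fin.sign_cycleRange] at h1
    have h2 : ∀ μ : Fin (k + 1) → Idx p,
        (Fin.tail fun j => μ (i.cycleRange.symm j)) = i.removeNth μ := fun μ => by
      ext j; simp [Fin.tail, Fin.removeNth]
    simp only [h2] at h1
    rw [h1, smul_smul]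
    push_cast
    rw [← mul_pow]
    simp
  have h3 : ((k : ℝ) + 1) • (ofComp fun μ : Fin (k + 1) → Idx p =>
      cov (f (e (μ 0))) (Fin.tail μ) : Form p (k + 1)) =
      ∑ i : Fin (k + 1), ofComp fun μ : Fin (k + 1) → Idx p =>
      (-1 : ℝ) ^ (i : ℕ) * cov (f (e (μ i))) (i.removeNth μ) := by
    simp only [h]
    simp [← Nat.cast_smul_eq_nsmul ℝ]
  rw [h3, ← ofComp_sum]
  symm
  refine ofComp_eq_of_cov fun μ => ?_
  rw [cov, ContinuousAlternatingMap.alternatizeUncurryFin_apply]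
  simp only [zsmul_eq_mul]
  refine Finset.sum_congr rfl fun i _ => ?_
  push_cast
  rfl

/-- The form with components `(k+1) B_{[μ_1 … μ_k} c_{μ_{k+1}]}`. -/
def wedgeLast (B : Form p k) (c : Model p →L[ℝ] ℝ) : Form p (k + 1) :=
  ofComp fun μ => ((k : ℝ) + 1) * (cov B (fun i => μ i.castSucc) * c (e (μ (Fin.last k))))

theorem wedgeLast_eq (B : Form p k) (c : Model p →L[ℝ] ℝ) :
    wedgeLast B c =
      (-1 : ℝ) ^ k • ContinuousAlternatingMap.alternatizeUncurryFin (c.smulRight B) := by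
  rw [alternatizeUncurryFin_eq_ofComp, wedgeLast, ofComp_smul, ofComp_smul, smul_comm]
  congr 1
  have h := ofComp_perm (fun μ : Fin (k + 1) → Idx p =>
    cov (c.smulRight B (e (μ 0))) (Fin.tail μ)) (finRotate (k + 1)).symm
  have hs : (((Equiv.Perm.sign (finRotate (k + 1)).symm : ℤˣ) : ℤ) : ℝ) = (-1) ^ k := by
    rw [Equiv.Perm.sign_symm, sign_finRotate]; simp
  rw [hs] at h
  rw [← h]
  congr 1
  ext μ
  have h0 : (finRotate (k + 1)).symm 0 = Fin.last k := by
    rw [Equiv.symm_apply_eq]; simp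
  have h1 : ∀ i : Fin k, (finRotate (k + 1)).symm i.succ = i.castSucc := fun i => by
    rw [Equiv.symm_apply_eq]; exact (finRotate_of_lt i.2).symm
  simp only [h0, cov, Fin.tail, h1, ContinuousLinearMap.smulRight_apply,
    ContinuousAlternatingMap.smul_apply, smul_eq_mul]
  ring

/-- Of the terms in the antisymmetrisation only the one that puts v into c survives; the others put
v into B, which it annihilates. -/
theorem contractLast_wedgeLast {B : Form p k} (c : Model p →L[ℝ] ℝ) {v : Model p}
    (hB : ∀ u i, u i = v → B u = 0) : contractLast (wedgeLast B c) v = c v • B := by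
  ext u
  rw [contractLast_eq, wedgeLast_eq]
  change (-1 : ℝ) ^ k • ((-1 : ℝ) ^ k • ContinuousAlternatingMap.alternatizeUncurryFin
    (c.smulRight B) (Matrix.vecCons v u)) = c v * B u
  rw [smul_smul, ← mul_pow]
  simp only [mul_neg, mul_one, neg_neg, one_pow, one_smul,
    ContinuousAlternatingMap.alternatizeUncurryFin_apply, Fin.sum_univ_succ]
  rw [Finset.sum_eq_zero]
  · simp
  · intro i _
    cases k with
    | zero => exact i.elim0
    | succ k =>
      rw [ContinuousLinearMap.smulRight_apply, ContinuousAlternatingMap.smul_apply,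
        hB (i.succ.removeNth (Matrix.vecCons v u)) 0 (by simp [Fin.removeNth])]
      simp

end Algebra

section Algebra

variable {p k : ℕ}

/-! ### The dual -/

/-- A volume form of the bilinear form `g`. -/
def IsVolume (g : Bilin p) (ε : Form p (p + 1 + (p + 1))) : Prop :=
  ∀ w : Idx p → Model p, ε w ^ 2 = |(Matrix.of fun i j => g (w i) (w j)).det|

theorem det_diagonal_eta {g : Bilin p} {b : Idx p → Model p} (hb : OrthoFrame g b) :
    (Matrix.of fun i j => g (b i) (b j)).det = -1 := by
  rw [show (Matrix.of fun i j => g (b i) (b j)) = Matrix.diagonal eta from ?_]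
  · rw [Matrix.det_diagonal, prod_eta]
  · ext i j
    simp only [Matrix.of_apply, hb i j, Matrix.diagonal_apply, eta]

theorem IsVolume.sq_frame {g : Bilin p} {ε : Form p (p + 1 + (p + 1))} (hε : IsVolume g ε)
    {b : Idx p → Model p} (hb : OrthoFrame g b) : ε b ^ 2 = 1 := by
  rw [hε b, det_diagonal_eta hb]
  simp

theorem IsVolume.sq_perm {g : Bilin p} {ε : Form p (p + 1 + (p + 1))} (hε : IsVolume g ε)
    {b : Idx p → Model p} (hb : OrthoFrame g b) {κ : Idx p → Idx p} (hκ : Function.Injective κ) :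
    (ε fun i => b (κ i)) ^ 2 = 1 := by
  let σ : Equiv.Perm (Idx p) := Equiv.ofBijective κ (Finite.injective_iff_bijective.1 hκ)
  have := map_perm ε b σ
  change (ε fun i => b (κ i)) = _ at this
  rw [this, mul_pow, hε.sq_frame hb, pow_two, sign_mul_self_real, one_mul]

/-- Half of the indices are completed to a permutation of all of them; in an orthonormal frame the
dual exchanges the two halves. -/
theorem exists_complement {I : Fin (p + 1) → Idx p} (hI : Function.Injective I) :
    ∃ J : Fin (p + 1) → Idx p, Function.Injective (Fin.append I J) := by
  have hc : Fintype.card ((Finset.univ.image I)ᶜ : Finset (Idx p)) = Fintype.card (Fin (p + 1)) := by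
    rw [Fintype.card_coe, Finset.card_compl, Finset.card_image_of_injective _ hI]
    simp
  let s := (Fintype.equivOfCardEq hc).symm
  refine ⟨fun i => s i, ?_⟩
  rw [Fin.append_injective_iff]
  refine ⟨hI, fun i j h => s.injective (Subtype.ext h), fun i j h => ?_⟩
  have := (s j).2
  rw [← h] at this
  simp at this

/-- The dual of a form in an orthonormal frame. -/
theorem dual_apply_orthoFrame {g : Bilin p} (hg : NonDeg g) (ε : Form p (p + 1 + (p + 1)))
    (F : Form p (p + 1)) {b b' : Idx p → Model p} (hb : DualFrames g b b')
    {I J : Fin (p + 1) → Idx p} (hIJ : Function.Injective (Fin.append I J)) :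
    dual g ε F (fun i => b (I i)) =
      ε (fun i => b (Fin.append I J i)) * F fun i => b' (J i) := by
  have hIJ' := Fin.append_injective_iff.1 hIJ
  rw [dual_apply_frame hg ε F hb]
  have h1 : ∑ K : Fin (p + 1) → Idx p,
      ε (Fin.append (fun i => b (I i)) fun i => b (K i)) * (F fun i => b' (K i)) =
      ∑ σ : Equiv.Perm (Fin (p + 1)), ε (fun i => b (Fin.append I J i)) * F fun i => b' (J i) := by
    symm
    -- Only index tuples complementary to `I` give a nonzero value of ε, and those are the
    -- rearrangements of `J`. Each contributes equally, since ε and F change by the same sign; the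
    -- (p+1)! terms cancel the prefactor.
    refine Finset.sum_of_injOn (fun (σ : Equiv.Perm (Fin (p + 1))) => fun i => J (σ i)) ?_ ?_ ?_ ?_
    · intro σ _ τ _ h
      ext i : 1
      exact hIJ'.2.1 (congrFun h i)
    · simp
    · intro K _ hK
      rw [← comp_append, ContinuousAlternatingMap.map_eq_zero_of_not_injective, zero_mul]
      intro hinj
      have hinj2 : Function.Injective (Fin.append I K) := fun i j h => hinj (by simp only [h])
      have hIK := Fin.append_injective_iff.1 hinj2
      apply hK
      have hbij := Finite.injective_iff_bijective.1 hIJ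
      have hex : ∀ i, ∃ j, J j = K i := fun i => by
        obtain ⟨m, hm⟩ := hbij.2 (K i)
        revert hm
        refine Fin.addCases (fun m hm => ?_) (fun m hm => ⟨m, by
        simpa [-Fin.natAdd_eq_addNat] using hm⟩) m
        exact absurd (by simpa using hm) (hIK.2.2 m i)
      choose f hf using hex
      have hfi : Function.Injective f := fun i j h => hIK.2.1 (by rw [← hf, ← hf, h])
      refine ⟨Equiv.ofBijective f (Finite.injective_iff_bijective.1 hfi), by simp, ?_⟩
      ext i : 1
      exact hf i
    · intro σ _
      rw [map_append_perm_right ε _ (fun i => b (J i)) σ, map_perm F (fun i => b' (J i)) σ,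
        comp_append]
      linear_combination (-(ε (Fin.append (fun i => b (I i)) fun i => b (J i)) *
        F fun i => b' (J i))) * sign_mul_self_real σ
  rw [h1]
  have : ((p + 1).factorial : ℝ) ≠ 0 := by positivity
  simp only [Finset.sum_const, Finset.card_univ, Fintype.card_perm, Fintype.card_fin, nsmul_eq_mul]
  field_simp

/-- Two signs cancel: -1 from the Lorentzian signature, and (-1)^(p+1) = -1 from exchanging the two
blocks of ε. This is where the middle degree p+1 must be odd. -/
theorem dual_dual (hp : Even p) {g : Bilin p} (hg : Lorentzian g) {ε : Form p (p + 1 + (p + 1))}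
    (hε : IsVolume g ε) (F : Form p (p + 1)) : dual g ε (dual g ε F) = F := by
  obtain ⟨b, hb⟩ := hg.signature
  have hb' : OrthoFrame g b := hb
  have hd := hb'.dualFrames
  refine form_ext_basis b fun I hI => ?_
  obtain ⟨J, hJ⟩ := exists_complement hI
  have hJ2 : Function.Injective (Fin.append J I) := by
    have := Fin.append_injective_iff.1 hJ
    exact Fin.append_injective_iff.2 ⟨this.2.1, this.1, fun i j h => this.2.2 j i h.symm⟩
  rw [dual_apply_orthoFrame hg.nonDeg ε _ hd hJ]
  have h1 : ∀ (θ : Form p (p + 1)) (K : Fin (p + 1) → Idx p), (θ fun i => eta (K i) • b (K i)) =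
      (∏ i, eta (K i)) * θ fun i => b (K i) := fun θ K => by
    rw [ContinuousAlternatingMap.map_smul_univ, smul_eq_mul]
  rw [h1, dual_apply_orthoFrame hg.nonDeg ε _ hd hJ2, h1, comp_append, comp_append,
    map_append_comm ε (fun i => b (I i))]
  have h2 : (∏ i, eta (I i)) * ∏ i, eta (J i) = -1 := by
    have hbij := Finite.injective_iff_bijective.1 hJ
    have := (Equiv.ofBijective _ hbij).prod_comp (fun i => eta i)
    rw [prod_eta, Fin.prod_univ_add] at this
    simpa [-Fin.natAdd_eq_addNat] using this
  have h3 := hε.sq_perm hb' hJ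
  rw [comp_append] at h3
  rw [(hp.add_one).neg_one_pow]
  linear_combination (-(F fun i => b (I i)) * (ε (Fin.append (fun i => b (I i))
    fun i => b (J i))) ^ 2) * h2 + (F fun i => b (I i)) * h3

/-- A form is determined by its electric and magnetic parts. -/
theorem eq_zero_of_contractLast_eq_zero {g : Bilin p} (hg : Lorentzian g)
    {ε : Form p (p + 1 + (p + 1))} (hε : IsVolume g ε) {v : Model p} (hv : g v v = -1)
    {Z : Form p (p + 1)} (h1 : contractLast Z v = 0) (h2 : contractLast (dual g ε Z) v = 0) :
    Z = 0 := by
  obtain ⟨b, hb0, hb⟩ := hg.exists_orthoFrame hv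
  have hd := hb.dualFrames
  -- A transposition moves v to the last slot, so vanishing contraction there means vanishing
  -- whenever v occurs anywhere.
  have key : ∀ θ : Form p (p + 1), contractLast θ v = 0 → ∀ (u : Fin (p + 1) → Model p) i, u i = v →
      θ u = 0 := by
    intro θ hθ u i hi
    let τ := Equiv.swap i (Fin.last p)
    have h3 := map_perm θ u τ
    have h4 : (fun j => u (τ j)) = Fin.snoc (α := fun _ => Model p) (fun j => u (τ j.castSucc)) v := by
      ext j : 1
      refine Fin.lastCases ?_ (fun j => ?_) j <;> simp [τ, hi]
    rw [h4, ← contractLast_apply, hθ] at h3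
    simpa using h3
  refine form_ext_basis hd.basis fun J hJ => ?_
  rw [hd.coe_basis]
  change (Z fun i => b (J i)) = 0
  by_cases h0 : ∃ i, J i = 0
  · obtain ⟨i, hi⟩ := h0
    exact key Z h1 _ i (by rw [hi, hb0])
  -- If v is absent from the indices `J`, it is present in the complement `I`, and the value of Z on
  -- `J` is, up to a nonzero factor, the value of its dual on `I`.
  · obtain ⟨I, hI⟩ := exists_complement hJ
    have hI' := Fin.append_injective_iff.1 hI
    have hI2 : Function.Injective (Fin.append I J) :=
      Fin.append_injective_iff.2 ⟨hI'.2.1, hI'.1, fun i j h => hI'.2.2 j i h.symm⟩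
    have h4 := dual_apply_orthoFrame hg.nonDeg ε Z hd hI2
    have h5 : ∃ i, I i = 0 := by
      obtain ⟨m, hm⟩ := (Finite.injective_iff_bijective.1 hI).2 0
      revert hm
      refine Fin.addCases (fun m hm => ?_) (fun m hm => ⟨m, by
        simpa [-Fin.natAdd_eq_addNat] using hm⟩) m
      exact absurd ⟨m, by simpa using hm⟩ h0
    obtain ⟨i, hi⟩ := h5
    rw [key _ h2 _ i (by rw [hi, hb0]), ContinuousAlternatingMap.map_smul_univ] at h4
    have h6 := hε.sq_perm hb hI2
    have h7 : ∏ i, eta (J i) ≠ 0 := Finset.prod_ne_zero_iff.2 fun i _ => by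
      unfold eta; split_ifs <;> norm_num
    have h8 : (ε fun i => b (Fin.append I J i)) ≠ 0 := fun h => by rw [h] at h6; norm_num at h6
    rw [smul_eq_mul, eq_comm, mul_eq_zero, mul_eq_zero] at h4
    simpa [h7, h8] using h4

/-- The square of a form without electric part is positive. -/
theorem dot_self_nonneg {g : Bilin p} (hg : Lorentzian g) {v : Model p} (hv : g v v = -1)
    {α : Form p k} (hα : ∀ u i, u i = v → α u = 0) :
    0 ≤ dot g α α ∧ (dot g α α = 0 → α = 0) := by
  obtain ⟨b, hb0, hb⟩ := hg.exists_orthoFrame hv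
  have hd := hb.dualFrames
  have h1 : dot g α α = ∑ I : Fin k → Idx p, (α fun i => b (I i)) ^ 2 := by
    rw [dot_frame hg.nonDeg α α hd]
    refine Finset.sum_congr rfl fun I _ => ?_
    rw [ContinuousAlternatingMap.map_smul_univ]
    by_cases h0 : ∃ i, I i = 0
    · obtain ⟨i, hi⟩ := h0
      rw [hα (fun i => b (I i)) i (by rw [hi, hb0])]
      simp
    · push Not at h0
      simp [eta, h0]
      ring
  refine ⟨h1 ▸ Finset.sum_nonneg fun _ _ => sq_nonneg _, fun h => ?_⟩
  rw [h1, Finset.sum_eq_zero_iff_of_nonneg fun _ _ => sq_nonneg _] at h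
  refine form_ext_basis hd.basis fun I _ => ?_
  rw [hd.coe_basis]
  simpa using h I (Finset.mem_univ _)

end Algebra

section Algebra

variable {p k : ℕ}

/-! ### Contractions with the exterior product by a covector -/

theorem sum_snoc {β : Type*} [AddCommMonoid β] (f : (Fin (k + 1) → Idx p) → β) :
    ∑ ν, f ν = ∑ μ : Fin k → Idx p, ∑ l : Idx p, f (Fin.snoc (α := fun _ => Idx p) μ l) := by
  rw [← Equiv.sum_comp (Fin.snocEquiv fun _ => Idx p), Fintype.sum_prod_type_right]
  rfl

theorem sum_snoc_sharp (g : Bilin p) (c : Model p →L[ℝ] ℝ)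
    (M : MultilinearMap ℝ (fun _ : Fin (k + 1) => Model p) ℝ) (u : Fin k → Model p) :
    ∑ l, M (Fin.snoc (α := fun _ => Model p) u (eUp g l)) * c (e l) =
      M (Fin.snoc (α := fun _ => Model p) u (sharp g c)) := by
  have h : ∀ x, M (Fin.snoc (α := fun _ => Model p) u x) = M.curryRight u x := fun _ => rfl
  simp only [h, sharp, map_sum, map_smul, smul_eq_mul, mul_comm]

theorem antisymm_con (g : Bilin p) (θ : Form p k) : Antisymm (con g θ) := fun μ σ =>
  map_perm θ (fun i => eUp g (μ i)) σ

theorem antisymm_append_right {a b : ℕ} (ε : Form p (a + b)) (u : Fin a → Model p)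
    (f : Idx p → Model p) : Antisymm fun ν : Fin b → Idx p => ε (Fin.append u fun i => f (ν i)) :=
  fun ν σ => map_append_perm_right ε u (fun i => f (ν i)) σ

/-- The antisymmetrisation of the wedge is redundant against an antisymmetric tensor, and the last
index then contracts into the raised covector. The factor k+1 is the one in `wedgeLast`. -/
theorem sum_mul_wedgeLast {g : Bilin p} (M : MultilinearMap ℝ (fun _ : Fin (k + 1) => Model p) ℝ)
    (hM : Antisymm fun ν : Fin (k + 1) → Idx p => M fun i => eUp g (ν i)) (B : Form p k)
    (c : Model p →L[ℝ] ℝ) :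
    ∑ ν, (M fun i => eUp g (ν i)) * cov (wedgeLast B c) ν = ((k : ℝ) + 1) *
      ∑ μ : Fin k → Idx p,
        M (Fin.snoc (α := fun _ => Model p) (fun i => eUp g (μ i)) (sharp g c)) * cov B μ := by
  rw [wedgeLast, sum_antisymm_mul_cov_ofComp hM, sum_snoc, Finset.mul_sum]
  refine Finset.sum_congr rfl fun μ _ => ?_
  rw [← sum_snoc_sharp, Finset.sum_mul, Finset.mul_sum]
  refine Finset.sum_congr rfl fun l _ => ?_
  simp only [comp_snoc (eUp g), Fin.snoc_castSucc, Fin.snoc_last]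
  ring

theorem dual_wedgeLast {g : Bilin p} (hg : NonDeg g) (ε : Form p (p + 1 + (p + 1))) (B : Form p p)
    (c : Model p →L[ℝ] ℝ) (w : Fin (p + 1) → Model p) :
    dual g ε (wedgeLast B c) w = 1 / (p.factorial : ℝ) * ∑ μ : Fin p → Idx p,
      ε (Fin.append w (Fin.snoc (α := fun _ => Model p) (fun i => eUp g (μ i)) (sharp g c))) *
        cov B μ := by
  rw [dual_apply_frame hg ε _ hg.dualFrames']
  have h := sum_mul_wedgeLast (g := g) (rightML ε w) (by
    simp only [rightML_apply]; exact antisymm_append_right ε w (eUp g)) B c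
  simp only [rightML_apply] at h
  have hk : (p.factorial : ℝ) ≠ 0 := by positivity
  refine (congrArg _ h).trans ?_
  rw [Nat.factorial_succ]
  push_cast
  field_simp

/-- Contraction with the raised covector is adjoint to exterior multiplication by it; the factor k+1
reflects that `dot` is the full contraction, not divided by a factorial. -/
theorem dot_contractLast (g : Bilin p) (α : Form p k) (θ : Form p (k + 1))
    (c : Model p →L[ℝ] ℝ) :
    ((k : ℝ) + 1) * dot g α (contractLast θ (sharp g c)) = dot g (wedgeLast α c) θ := by
  have h := sum_mul_wedgeLast (g := g) θ.toMultilinearMap (antisymm_con g θ) α c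
  have h2 : dot g (wedgeLast α c) θ = ∑ ν, (θ fun i => eUp g (ν i)) * cov (wedgeLast α c) ν :=
    Finset.sum_congr rfl fun _ _ => mul_comm _ _
  rw [h2]
  refine Eq.trans ?_ h.symm
  congr 1
  refine Finset.sum_congr rfl fun μ _ => ?_
  rw [con, contractLast_apply, mul_comm]
  rfl

/-- The number `X_{μ} (Y^*)^{μ}`, which up to a factor represents `X ∧ Y`. -/
def pairing (g : Bilin p) (ε : Form p (p + 1 + (p + 1))) (X Y : Form p (p + 1)) : ℝ :=
  dot g X (dual g ε Y)

theorem pairing_eq {g : Bilin p} (hg : NonDeg g) (ε : Form p (p + 1 + (p + 1)))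
    (X Y : Form p (p + 1)) : pairing g ε X Y = 1 / ((p + 1).factorial : ℝ) *
      ∑ μ : Fin (p + 1) → Idx p, ∑ ν : Fin (p + 1) → Idx p,
        con g ε (Fin.append μ ν) * cov X μ * cov Y ν := by
  rw [pairing, dot, Finset.mul_sum]
  refine Finset.sum_congr rfl fun μ _ => ?_
  rw [con, dual_apply_frame hg ε Y hg.dualFrames', mul_left_comm, Finset.mul_sum]
  refine congrArg _ (Finset.sum_congr rfl fun ν _ => ?_)
  rw [con, comp_append, cov, cov]
  ring

/-- Exchanging X and Y exchanges two blocks of odd length p+1 in ε. -/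
theorem pairing_comm (hp : Even p) {g : Bilin p} (hg : NonDeg g) (ε : Form p (p + 1 + (p + 1)))
    (X Y : Form p (p + 1)) : pairing g ε X Y = -pairing g ε Y X := by
  rw [pairing_eq hg, pairing_eq hg, Finset.sum_comm, ← mul_neg, ← Finset.sum_neg_distrib]
  refine congrArg _ (Finset.sum_congr rfl fun μ _ => ?_)
  rw [← Finset.sum_neg_distrib]
  refine Finset.sum_congr rfl fun ν _ => ?_
  rw [con, con, comp_append, comp_append, map_append_comm ε (fun i => eUp g (μ i)),
    hp.add_one.neg_one_pow]
  ring

/-- The two arguments differ by the transposition of the last slots of the two blocks. -/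
theorem map_append_snoc_swap (ε : Form p (p + 1 + (p + 1))) (u w : Fin p → Model p)
    (x y : Model p) :
    ε (Fin.append (Fin.snoc (α := fun _ => Model p) u x)
      (Fin.snoc (α := fun _ => Model p) w y)) =
    -ε (Fin.append (Fin.snoc (α := fun _ => Model p) u y)
      (Fin.snoc (α := fun _ => Model p) w x)) := by
  have hne : Fin.castAdd (p + 1) (Fin.last p) ≠ Fin.natAdd (p + 1) (Fin.last p) := by
    intro h
    have := congrArg Fin.val h
    simp at this
  have := map_perm ε (Fin.append (Fin.snoc (α := fun _ => Model p) u y)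
      (Fin.snoc (α := fun _ => Model p) w x))
    (Equiv.swap (Fin.castAdd (p + 1) (Fin.last p)) (Fin.natAdd (p + 1) (Fin.last p)))
  rw [Equiv.Perm.sign_swap hne] at this
  simp only [Units.val_neg, Units.val_one, Int.cast_neg, Int.cast_one, neg_mul, one_mul] at this
  rw [← this]
  congr 1
  ext i : 1
  have hl : ∀ j : Fin p, Fin.castAdd (p + 1) j.castSucc ≠ Fin.castAdd (p + 1) (Fin.last p) := by
    intro j h; have := congrArg Fin.val h; simp at this; omega
  have hl' : ∀ j : Fin p, Fin.castAdd (p + 1) j.castSucc ≠ Fin.natAdd (p + 1) (Fin.last p) := by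
    intro j h; have := congrArg Fin.val h; simp at this; omega
  have hr : ∀ j : Fin p, Fin.natAdd (p + 1) j.castSucc ≠ Fin.castAdd (p + 1) (Fin.last p) := by
    intro j h; have := congrArg Fin.val h; simp at this; omega
  have hr' : ∀ j : Fin p, Fin.natAdd (p + 1) j.castSucc ≠ Fin.natAdd (p + 1) (Fin.last p) := by
    intro j h; have := congrArg Fin.val h; simp at this; omega
  refine Fin.addCases (fun i => ?_) (fun i => ?_) i
  · refine Fin.lastCases ?_ (fun i => ?_) i
    · rw [Equiv.swap_apply_left, Fin.append_left, Fin.append_right, Fin.snoc_last, Fin.snoc_last]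
    · rw [Equiv.swap_apply_of_ne_of_ne (hl i) (hl' i), Fin.append_left, Fin.append_left,
        Fin.snoc_castSucc, Fin.snoc_castSucc]
  · refine Fin.lastCases ?_ (fun i => ?_) i
    · rw [Equiv.swap_apply_right, Fin.append_left, Fin.append_right, Fin.snoc_last, Fin.snoc_last]
    · rw [Equiv.swap_apply_of_ne_of_ne (hr i) (hr' i), Fin.append_right, Fin.append_right,
        Fin.snoc_castSucc, Fin.snoc_castSucc]

theorem pairing_wedgeLast {g : Bilin p} (hg : NonDeg g) (ε : Form p (p + 1 + (p + 1)))
    (α β : Form p p) (a b : Model p →L[ℝ] ℝ) :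
    pairing g ε (wedgeLast α a) (wedgeLast β b) = ((p : ℝ) + 1) / (p.factorial : ℝ) *
      ∑ μ : Fin p → Idx p, ∑ ν : Fin p → Idx p,
        ε (Fin.append (Fin.snoc (α := fun _ => Model p) (fun i => eUp g (μ i)) (sharp g a))
          (Fin.snoc (α := fun _ => Model p) (fun i => eUp g (ν i)) (sharp g b))) *
        cov α μ * cov β ν := by
  rw [pairing, ← dot_contractLast, dot, div_eq_mul_one_div, mul_assoc]
  congr 1
  rw [Finset.mul_sum]
  refine Finset.sum_congr rfl fun μ _ => ?_
  rw [con, contractLast_apply, dual_wedgeLast hg, mul_left_comm, Finset.mul_sum]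
  refine congrArg _ (Finset.sum_congr rfl fun ν _ => ?_)
  ring

/-- The two covectors occupy two slots of ε. In particular the pairing vanishes when they coincide,
which is how a common factor ∂a is eliminated later. -/
theorem pairing_wedgeLast_swap {g : Bilin p} (hg : NonDeg g) (ε : Form p (p + 1 + (p + 1)))
    (α β : Form p p) (a b : Model p →L[ℝ] ℝ) :
    pairing g ε (wedgeLast α a) (wedgeLast β b) = -pairing g ε (wedgeLast α b) (wedgeLast β a) := by
  rw [pairing_wedgeLast hg, pairing_wedgeLast hg, ← mul_neg, ← Finset.sum_neg_distrib]
  refine congrArg _ (Finset.sum_congr rfl fun μ _ => ?_)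
  rw [← Finset.sum_neg_distrib]
  refine Finset.sum_congr rfl fun ν _ => ?_
  rw [map_append_snoc_swap]
  ring

theorem pairing_wedgeLast_comm (hp : Even p) {g : Bilin p} (hg : NonDeg g)
    (ε : Form p (p + 1 + (p + 1))) (α β : Form p p) (a b : Model p →L[ℝ] ℝ) :
    pairing g ε (wedgeLast α a) (wedgeLast β b) = pairing g ε (wedgeLast β a) (wedgeLast α b) := by
  rw [pairing_comm hp hg, pairing_wedgeLast_swap hg, neg_neg]

theorem wedgeLast_add_left (α β : Form p k) (c : Model p →L[ℝ] ℝ) :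
    wedgeLast (α + β) c = wedgeLast α c + wedgeLast β c := by
  rw [wedgeLast, wedgeLast, wedgeLast, ← ofComp_add]
  congr 1; ext μ
  simp [cov]; ring

theorem wedgeLast_smul_left (r : ℝ) (α : Form p k) (c : Model p →L[ℝ] ℝ) :
    wedgeLast (r • α) c = r • wedgeLast α c := by
  rw [wedgeLast, wedgeLast, ← ofComp_smul]
  congr 1; ext μ
  simp [cov]; ring

theorem wedgeLast_add_right (α : Form p k) (c c' : Model p →L[ℝ] ℝ) :
    wedgeLast α (c + c') = wedgeLast α c + wedgeLast α c' := by
  rw [wedgeLast, wedgeLast, wedgeLast, ← ofComp_add]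
  congr 1; ext μ
  simp; ring

theorem wedgeLast_smul_right (r : ℝ) (α : Form p k) (c : Model p →L[ℝ] ℝ) :
    wedgeLast α (r • c) = r • wedgeLast α c := by
  rw [wedgeLast, wedgeLast, ← ofComp_smul]
  congr 1; ext μ
  simp; ring

theorem pairing_add_left (g : Bilin p) (ε : Form p (p + 1 + (p + 1))) (X X' Y : Form p (p + 1)) :
    pairing g ε (X + X') Y = pairing g ε X Y + pairing g ε X' Y := dot_add_left _ _ _ _

theorem pairing_add_right (g : Bilin p) (ε : Form p (p + 1 + (p + 1))) (X Y Y' : Form p (p + 1)) :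
    pairing g ε X (Y + Y') = pairing g ε X Y + pairing g ε X Y' := by
  rw [pairing, dual_add, dot_add_right]; rfl

theorem pairing_smul_left (g : Bilin p) (ε : Form p (p + 1 + (p + 1))) (r : ℝ)
    (X Y : Form p (p + 1)) : pairing g ε (r • X) Y = r * pairing g ε X Y := dot_smul_left _ _ _ _

theorem pairing_smul_right (g : Bilin p) (ε : Form p (p + 1 + (p + 1))) (r : ℝ)
    (X Y : Form p (p + 1)) : pairing g ε X (r • Y) = r * pairing g ε X Y := by
  rw [pairing, dual_smul, dot_smul_right]; rfl

/-! ### Electric and magnetic parts -/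

/-- Data at a point of a Lorentzian space with a timelike covector. -/
structure TimelikeData (g : Bilin p) (ε : Form p (p + 1 + (p + 1))) (α : Model p →L[ℝ] ℝ) :
    Prop where
  lorentzian : Lorentzian g
  volume : IsVolume g ε
  timelike : covecSq g α < 0

namespace TimelikeData

variable {g : Bilin p} {ε : Form p (p + 1 + (p + 1))} {α : Model p →L[ℝ] ℝ}

theorem unitVec_sq (h : TimelikeData g ε α) : g (unitVec g α) (unitVec g α) = -1 := by
  rw [apply_unitVec h.lorentzian.nonDeg, unitForm_unitVec h.timelike]

/-- The vector v would occupy two slots of ε. -/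
theorem contractLast_dual_wedgeLast (h : TimelikeData g ε α) (B : Form p p) :
    contractLast (dual g ε (wedgeLast B (unitForm g α))) (unitVec g α) = 0 := by
  ext u
  rw [contractLast_apply, dual_wedgeLast h.lorentzian.nonDeg, ← unitVec_eq]
  change _ = (0 : ℝ)
  rw [Finset.sum_eq_zero, mul_zero]
  intro μ _
  have : (ε (Fin.append (Fin.snoc (α := fun _ => Model p) u (unitVec g α))
      (Fin.snoc (α := fun _ => Model p) (fun i => eUp g (μ i)) (unitVec g α)))) = 0 := by
    have := map_append_snoc_swap ε u (fun i => eUp g (μ i)) (unitVec g α) (unitVec g α)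
    linarith
  rw [this, zero_mul]

theorem contractLast_wedgeLast (h : TimelikeData g ε α) {B : Form p k}
    (hB : ∀ u i, u i = unitVec g α → B u = 0) :
    contractLast (wedgeLast B (unitForm g α)) (unitVec g α) = -B := by
  rw [ChiralForm.contractLast_wedgeLast _ hB, unitForm_unitVec h.timelike]
  ext u
  simp

/-- A form is built from its electric and magnetic parts. -/
theorem decompose (hp : Even p) (h : TimelikeData g ε α) (Z : Form p (p + 1)) :
    Z = -(wedgeLast (contractLast Z (unitVec g α)) (unitForm g α) +
      dual g ε (wedgeLast (contractLast (dual g ε Z) (unitVec g α)) (unitForm g α))) := by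
  rw [← sub_eq_zero, sub_neg_eq_add]
  -- The difference of the two sides has vanishing electric and magnetic parts. The sign of the
  -- formula comes from v_μ v^μ = -1.
  apply eq_zero_of_contractLast_eq_zero h.lorentzian h.volume h.unitVec_sq
  · rw [contractLast_add, contractLast_add, h.contractLast_dual_wedgeLast,
      h.contractLast_wedgeLast fun u i hi => contractLast_apply_eq_zero _ hi]
    abel
  · rw [dual_add, dual_add, dual_dual hp h.lorentzian h.volume, contractLast_add, contractLast_add,
      h.contractLast_dual_wedgeLast,
      h.contractLast_wedgeLast fun u i hi => contractLast_apply_eq_zero _ hi]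
    abel

/-- `B · (i_v X)` in terms of the pairing. -/
theorem dot_magnetic_contractLast (hp : Even p) (h : TimelikeData g ε α) (F X : Form p (p + 1)) :
    ((p : ℝ) + 1) * dot g (contractLast (dual g ε F) (unitVec g α))
        (contractLast X (unitVec g α)) =
      pairing g ε F X +
        pairing g ε (wedgeLast (contractLast F (unitVec g α)) (unitForm g α)) X := by
  have hn := h.lorentzian.nonDeg
  conv_lhs => rw [unitVec_eq, dot_contractLast, ← unitVec_eq]
  have h1 := congrArg (fun Z => dot g Z X) (h.decompose hp (dual g ε F))
  simp only [dual_dual hp h.lorentzian h.volume, dot_neg_left, dot_add_left] at h1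
  have h2 : ∀ Y, dot g (dual g ε Y) X = -pairing g ε Y X := fun Y => by
    rw [dot_comm hn, ← pairing_comm hp hn]; rfl
  rw [h2, h2] at h1
  linarith

theorem dot_contractLast_dual (β : Form p p) (X : Form p (p + 1)) :
    ((p : ℝ) + 1) * dot g β (contractLast (dual g ε X) (unitVec g α)) =
      pairing g ε (wedgeLast β (unitForm g α)) X := by
  rw [unitVec_eq, dot_contractLast]; rfl

/-- `β · (i_w Z)` for a vector `w` orthogonal to `v`. -/
theorem dot_contractLast_orthogonal (hp : Even p) (h : TimelikeData g ε α) {β : Form p p}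
    (hβ : ∀ u i, u i = unitVec g α → β u = 0) {c : Model p →L[ℝ] ℝ} (hc : c (unitVec g α) = 0)
    (Z : Form p (p + 1)) :
    ((p : ℝ) + 1) * dot g β (contractLast Z (sharp g c)) =
      -pairing g ε (wedgeLast β c)
        (wedgeLast (contractLast (dual g ε Z) (unitVec g α)) (unitForm g α)) := by
  have hn := h.lorentzian.nonDeg
  rw [dot_contractLast]
  conv_lhs => rw [h.decompose hp Z]
  rw [dot_neg_right, dot_add_right]
  -- This term contracts β∧c with v. As β annihilates v, only c(v)β could survive, and c(v) = 0.
  have : dot g (wedgeLast β c) (wedgeLast (contractLast Z (unitVec g α)) (unitForm g α)) = 0 := by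
    rw [dot_comm hn, ← dot_contractLast, ← unitVec_eq, ChiralForm.contractLast_wedgeLast c hβ, hc,
      zero_smul]
    simp [dot, con]
  rw [this, zero_add]
  rfl

end TimelikeData

end Algebra

section Algebra

variable {p k : ℕ}

/-! ### The Lagrangian as a function of the fields at a point -/

/-- The Lagrangian without interaction, as a function of `g`, `ε`, `F`, `∂a` and `Λ` at a point. -/
def lagAlg (g : Bilin p) (ε : Form p (p + 1 + (p + 1))) (F : Form p (p + 1)) (α : Model p →L[ℝ] ℝ)
    (L : Form p (p + 1)) : ℝ :=
  1 / (p.factorial : ℝ) *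
    (1 / 2 * dot g (contractLast F (unitVec g α)) (contractLast (dual g ε F) (unitVec g α))
      - 1 / 2 * dot g (contractLast (dual g ε F) (unitVec g α))
          (contractLast (dual g ε F) (unitVec g α))
      + dot g (contractLast (dual g ε F) (unitVec g α) + contractLast L (unitVec g α))
          (contractLast (dual g ε F) (unitVec g α) + contractLast L (unitVec g α)))

theorem hasDerivAt_contractLast {F : Form p (k + 1)} (X : Form p (k + 1)) {v : ℝ → Model p}
    {w : Model p} (hv : HasDerivAt v w 0) :
    HasDerivAt (fun s : ℝ => contractLast (F + s • X) (v s))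
      (contractLast F w + contractLast X (v 0)) 0 := by
  simp only [contractLast_eq]
  have h1 : HasDerivAt (fun s => F.curryLeft (v s)) (F.curryLeft w) 0 :=
    F.curryLeft.hasFDerivAt.comp_hasDerivAt 0 hv
  have h2 : HasDerivAt (fun s => X.curryLeft (v s)) (X.curryLeft w) 0 :=
    X.curryLeft.hasFDerivAt.comp_hasDerivAt 0 hv
  have h3 := (h1.add ((hasDerivAt_id (0 : ℝ)).smul h2)).const_smul ((-1 : ℝ) ^ k)
  refine h3.congr_deriv ?_
  simp

theorem hasDerivAt_dot (g : Bilin p) {E B : ℝ → Form p k} {E' B' : Form p k} {t : ℝ}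
    (hE : HasDerivAt E E' t) (hB : HasDerivAt B B' t) :
    HasDerivAt (fun s => dot g (E s) (B s)) (dot g E' (B t) + dot g (E t) B') t := by
  simp only [dot, ← Finset.sum_add_distrib]
  refine HasDerivAt.fun_sum fun μ _ => ?_
  have h : ∀ {E : ℝ → Form p k} {E' : Form p k} (_ : HasDerivAt E E' t) (u : Fin k → Model p),
      HasDerivAt (fun s => E s u) (E' u) t := fun hE u =>
    ((ContinuousAlternatingMap.apply ℝ (Model p) ℝ u).hasFDerivAt.comp_hasDerivAt t hE)
  exact (h hE _).mul (h hB _)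

/-- The first variation of the Lagrangian. -/
theorem hasDerivAt_lagAlg {g : Bilin p} (hg : NonDeg g) (ε : Form p (p + 1 + (p + 1)))
    (F X : Form p (p + 1)) (α β : Model p →L[ℝ] ℝ) (L Ξ : Form p (p + 1)) {w : Model p}
    (hv : HasDerivAt (fun s : ℝ => unitVec g (α + s • β)) w 0) :
    HasDerivAt (fun s : ℝ => lagAlg g ε (F + s • X) (α + s • β) (L + s • Ξ))
      (1 / (p.factorial : ℝ) *
        (1 / 2 * (dot g (contractLast (dual g ε F) (unitVec g α))
              (contractLast F w + contractLast X (unitVec g α))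
            + dot g (contractLast F (unitVec g α))
              (contractLast (dual g ε F) w + contractLast (dual g ε X) (unitVec g α)))
          - dot g (contractLast (dual g ε F) (unitVec g α))
              (contractLast (dual g ε F) w + contractLast (dual g ε X) (unitVec g α))
          + 2 * dot g (contractLast (dual g ε F) (unitVec g α) + contractLast L (unitVec g α))
              (contractLast (dual g ε F) w + contractLast (dual g ε X) (unitVec g α) +
                (contractLast L w + contractLast Ξ (unitVec g α))))) 0 := by
  unfold lagAlg
  refine HasDerivAt.const_mul _ ?_
  simp only [dual_add, dual_smul]
  have hE := hasDerivAt_contractLast (F := F) X hv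
  have hB := hasDerivAt_contractLast (F := dual g ε F) (dual g ε X) hv
  have hl := hasDerivAt_contractLast (F := L) Ξ hv
  have h := (((hasDerivAt_dot g hE hB).const_mul (1 / 2)).sub
    ((hasDerivAt_dot g hB hB).const_mul (1 / 2))).add (hasDerivAt_dot g (hB.add hl) (hB.add hl))
  refine h.congr_deriv ?_
  simp only [zero_smul, add_zero, Pi.add_apply]
  rw [dot_comm hg (contractLast F w + contractLast X (unitVec g α)),
    dot_comm hg (contractLast (dual g ε F) w + contractLast (dual g ε X) (unitVec g α)),
    dot_comm hg (contractLast (dual g ε F) w + contractLast (dual g ε X) (unitVec g α) + _)]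
  ring

theorem covecSq_add_smul {g : Bilin p} (hg : NonDeg g) (α β : Model p →L[ℝ] ℝ) (s : ℝ) :
    covecSq g (α + s • β) = covecSq g α + 2 * s * β (sharp g α) + s ^ 2 * covecSq g β := by
  have h : α (sharp g β) = β (sharp g α) := by
    rw [← apply_sharp hg α (sharp g β), ← apply_sharp hg β (sharp g α), hg.symm]
  simp only [covecSq_eq, sharp_add, sharp_smul, add_apply, smul_apply, map_add, map_smul,
    smul_eq_mul, h]
  ring

/-- The covector `δv_μ` produced by the variation `β` of `∂a`. -/
def unitFormVar (g : Bilin p) (α β : Model p →L[ℝ] ℝ) : Model p →L[ℝ] ℝ :=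
  (gradNorm g α)⁻¹ • β + (β (sharp g α) / gradNorm g α ^ 3) • α

/-- Only the normalisation is nonlinear: the square of the gradient is quadratic in s, and the
derivative of N⁻¹ is (α·β)/N³. -/
theorem hasDerivAt_unitVec {g : Bilin p} (hg : NonDeg g) {α : Model p →L[ℝ] ℝ}
    (hα : covecSq g α < 0) (β : Model p →L[ℝ] ℝ) :
    HasDerivAt (fun s : ℝ => unitVec g (α + s • β)) (sharp g (unitFormVar g α β)) 0 := by
  have hN := gradNorm_pos hα
  have h1 : HasDerivAt (fun s : ℝ => gradNorm g (α + s • β))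
      (-(β (sharp g α)) / gradNorm g α) 0 := by
    simp only [gradNorm, covecSq_add_smul hg]
    have h2 : HasDerivAt (fun s : ℝ => -(covecSq g α + 2 * s * β (sharp g α) + s ^ 2 * covecSq g β))
        (-(2 * β (sharp g α))) 0 := by
      have := (((((hasDerivAt_id (0 : ℝ)).const_mul 2).mul_const (β (sharp g α))).const_add
        (covecSq g α)).add (((hasDerivAt_id (0 : ℝ)).pow 2).mul_const (covecSq g β))).neg
      refine this.congr_deriv ?_
      simp
    have h3 := h2.sqrt (by simp [hα.ne])
    refine h3.congr_deriv ?_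
    have : √(-covecSq g α) ≠ 0 := hN.ne'
    simp
    field_simp
  have h4 : HasDerivAt (fun s : ℝ => (gradNorm g (α + s • β))⁻¹)
      (β (sharp g α) / gradNorm g α ^ 3) 0 := by
    refine (h1.inv (by simpa using hN.ne')).congr_deriv ?_
    simp only [zero_smul, add_zero]
    field_simp
  have h5 : HasDerivAt (fun s : ℝ => sharp g α + s • sharp g β) (sharp g β) 0 := by
    simpa using ((hasDerivAt_id (0 : ℝ)).smul_const (sharp g β)).const_add (sharp g α)
  have h6 := h4.smul h5
  have h7 : (fun s : ℝ => unitVec g (α + s • β)) =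
      fun s : ℝ => (gradNorm g (α + s • β))⁻¹ • (sharp g α + s • sharp g β) := by
    ext1 s
    rw [unitVec_eq, unitForm, sharp_smul, sharp_add, sharp_smul]
  rw [h7]
  refine h6.congr_deriv ?_
  simp [unitFormVar, sharp_add, sharp_smul]

/-- The covector v keeps length -1 along the variation, so its derivative is orthogonal to v. -/
theorem unitFormVar_unitVec {g : Bilin p} {α : Model p →L[ℝ] ℝ}
    (hα : covecSq g α < 0) (β : Model p →L[ℝ] ℝ) : unitFormVar g α β (unitVec g α) = 0 := by
  have hN := gradNorm_pos hα
  have h2 := gradNorm_sq hα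
  rw [covecSq_eq] at h2
  have h3 : α (sharp g α) = -gradNorm g α ^ 2 := by linarith
  rw [unitVec_eq, unitForm, sharp_smul, unitFormVar]
  simp only [map_smul, add_apply, smul_apply, smul_eq_mul, h3]
  field_simp
  ring

namespace TimelikeData

variable {g : Bilin p} {ε : Form p (p + 1 + (p + 1))} {α : Model p →L[ℝ] ℝ}

/-- The combination `(E - B) + 2 (B + λ)`. -/
def _root_.ChiralForm.fieldW (g : Bilin p) (ε : Form p (p + 1 + (p + 1))) (F : Form p (p + 1))
    (α : Model p →L[ℝ] ℝ) (L : Form p (p + 1)) : Form p p :=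
  (contractLast F (unitVec g α) - contractLast (dual g ε F) (unitVec g α)) +
    (2 : ℝ) • (contractLast (dual g ε F) (unitVec g α) + contractLast L (unitVec g α))

/-- The variation of the Lagrangian under variations of `F` and `∂a`, for self-dual `Λ`. -/
theorem hasDerivAt_lagAlg (hp : Even p) (h : TimelikeData g ε α) (F X : Form p (p + 1))
    (β : Model p →L[ℝ] ℝ) {L : Form p (p + 1)} (hL : dual g ε L = L) :
    HasDerivAt (fun s : ℝ => lagAlg g ε (F + s • X) (α + s • β) L)
      (1 / ((p + 1).factorial : ℝ) *
        (1 / 2 * pairing g ε F X + pairing g ε (wedgeLast (fieldW g ε F α L) (unitForm g α)) X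
          - 1 / 2 * pairing g ε
            (wedgeLast ((gradNorm g α)⁻¹ • fieldW g ε F α L) β)
            (wedgeLast ((gradNorm g α)⁻¹ • fieldW g ε F α L) α))) 0 := by
  have hn := h.lorentzian.nonDeg
  have hd := ChiralForm.hasDerivAt_lagAlg hn ε F X α β L 0 (hasDerivAt_unitVec hn h.timelike β)
  simp only [smul_zero, add_zero] at hd
  refine hd.congr_deriv ?_
  have hN := (gradNorm_pos h.timelike).ne'
  have hfac : (1 / ((p + 1).factorial : ℝ)) = 1 / (p.factorial : ℝ) * (1 / ((p : ℝ) + 1)) := by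
    rw [Nat.factorial_succ]; push_cast; field_simp
  rw [hfac, mul_assoc]
  congr 1
  have hp1 : ((p : ℝ) + 1) ≠ 0 := by positivity
  rw [eq_comm, ← mul_right_inj' hp1, ← mul_assoc, mul_one_div_cancel hp1, one_mul]
  set v := unitVec g α with hv
  set E := contractLast F v with hE
  set B := contractLast (dual g ε F) v with hB
  set l := contractLast L v with hl
  set c := unitFormVar g α β
  set W := fieldW g ε F α L with hW
  have hc : c v = 0 := unitFormVar_unitVec h.timelike β
  have oE : ∀ u i, u i = v → E u = 0 := fun u i hi => contractLast_apply_eq_zero _ hi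
  have oB : ∀ u i, u i = v → B u = 0 := fun u i hi => contractLast_apply_eq_zero _ hi
  have ol : ∀ u i, u i = v → l u = 0 := fun u i hi => contractLast_apply_eq_zero _ hi
  have z0 : contractLast (0 : Form p (p + 1)) v = 0 := by ext u; rw [contractLast_apply]; rfl
  have dF : dual g ε (dual g ε F) = F := dual_dual hp h.lorentzian h.volume F
  have hX1 : ((p : ℝ) + 1) * dot g B (contractLast X v) =
      pairing g ε F X + pairing g ε (wedgeLast E (unitForm g α)) X :=
    h.dot_magnetic_contractLast hp F X
  have hX2 : ∀ β : Form p p, ((p : ℝ) + 1) * dot g β (contractLast (dual g ε X) v) =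
      pairing g ε (wedgeLast β (unitForm g α)) X := fun β => dot_contractLast_dual β X
  have hwF : ∀ β : Form p p, (∀ u i, u i = v → β u = 0) →
      ((p : ℝ) + 1) * dot g β (contractLast F (sharp g c)) =
        -pairing g ε (wedgeLast β c) (wedgeLast B (unitForm g α)) := fun β hβ =>
    h.dot_contractLast_orthogonal hp hβ hc F
  have hwB : ∀ β : Form p p, (∀ u i, u i = v → β u = 0) →
      ((p : ℝ) + 1) * dot g β (contractLast (dual g ε F) (sharp g c)) =
        -pairing g ε (wedgeLast β c) (wedgeLast E (unitForm g α)) := fun β hβ => by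
    have := h.dot_contractLast_orthogonal hp hβ hc (dual g ε F)
    rw [dF] at this
    exact this
  have hwL : ∀ β : Form p p, (∀ u i, u i = v → β u = 0) →
      ((p : ℝ) + 1) * dot g β (contractLast L (sharp g c)) =
        -pairing g ε (wedgeLast β c) (wedgeLast l (unitForm g α)) := fun β hβ => by
    have := h.dot_contractLast_orthogonal hp hβ hc L
    rw [hL] at this
    exact this
  -- The part of δv proportional to ∂a drops out, because ⟨W∧α,W∧α⟩ = 0; the part β/N supplies one
  -- of the two factors N⁻¹, and v = α/N the other.
  have hβc : pairing g ε (wedgeLast ((gradNorm g α)⁻¹ • W) β) (wedgeLast ((gradNorm g α)⁻¹ • W) α) =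
      pairing g ε (wedgeLast W c) (wedgeLast W (unitForm g α)) := by
    have h0 : pairing g ε (wedgeLast W α) (wedgeLast W α) = 0 := by
      have := pairing_wedgeLast_swap hn ε W W α α
      linarith
    simp only [c, unitFormVar, unitForm, wedgeLast_smul_left, wedgeLast_add_right,
      wedgeLast_smul_right, pairing_add_left, pairing_smul_left, pairing_smul_right, h0]
    ring
  have hWe : W = E + B + (2 : ℝ) • l := by
    rw [hW, fieldW]
    ext u
    simp only [ContinuousAlternatingMap.add_apply, ContinuousAlternatingMap.sub_apply,
      ContinuousAlternatingMap.smul_apply, smul_eq_mul]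
    ring
  rw [hβc, hWe]
  have sEB := pairing_wedgeLast_comm hp hn ε E B c (unitForm g α)
  have sEl := pairing_wedgeLast_comm hp hn ε E l c (unitForm g α)
  have sBl := pairing_wedgeLast_comm hp hn ε B l c (unitForm g α)
  simp only [z0, add_zero, dot_add_left, dot_add_right, wedgeLast_add_left, wedgeLast_smul_left,
    pairing_add_left, pairing_add_right, pairing_smul_left, pairing_smul_right]
  -- The terms in X add up to ½⟨F,X⟩ + ⟨W∧v,X⟩ with W = E+B+2λ. The terms in δv complete to the
  -- square -½⟨W∧δv,W∧v⟩; the symmetry of the pairing in the two p-forms merges the mixed products.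
  linear_combination (-1 / 2 : ℝ) * hX1 - 1 / 2 * hX2 E - hX2 B - 2 * hX2 l - 1 / 2 * hwF B oB
    - 1 / 2 * hwB E oE - hwB B oB - 2 * hwB l ol - 2 * hwL B oB - 2 * hwL l ol
    - 1 / 2 * sEB - sEl + sBl

end TimelikeData

end Algebra

section Algebra

variable {p k : ℕ}

/-! ### Behaviour under linear changes of coordinates -/

/-- The pullback of a bilinear form. -/
abbrev pullBilin (g : Bilin p) (L : Model p ≃L[ℝ] Model p) : Bilin p :=
  g.bilinearComp (L : Model p →L[ℝ] Model p) (L : Model p →L[ℝ] Model p)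

/-- The pullback of a form. -/
abbrev pullForm (θ : Form p k) (L : Model p ≃L[ℝ] Model p) : Form p k :=
  θ.compContinuousLinearMap (L : Model p →L[ℝ] Model p)

/-- The pullback of a covector. -/
abbrev pullCov (c : Model p →L[ℝ] ℝ) (L : Model p ≃L[ℝ] Model p) : Model p →L[ℝ] ℝ :=
  c.comp (L : Model p →L[ℝ] Model p)

variable {g : Bilin p} (L : Model p ≃L[ℝ] Model p)

theorem DualFrames.pull {b b' : Idx p → Model p} (h : DualFrames g b b') :
    DualFrames (pullBilin g L) (fun i => L.symm (b i)) (fun i => L.symm (b' i)) := fun i j => by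
  simp [h i j]

theorem DualFrames.push {b b' : Idx p → Model p} (h : DualFrames (pullBilin g L) b b') :
    DualFrames g (fun i => L (b i)) (fun i => L (b' i)) := fun i j => by
  have := h i j
  simpa using this

theorem NonDeg.pull (hg : NonDeg g) : NonDeg (pullBilin g L) :=
  (hg.dualFrames.pull L).nonDeg fun u w => by simp [hg.symm (L u)]

theorem Lorentzian.pull (hg : Lorentzian g) : Lorentzian (pullBilin g L) := by
  refine ⟨fun u w => by simp [hg.symm (L u)], ?_⟩
  obtain ⟨b, hb⟩ := hg.signature
  refine ⟨b.map L.symm.toLinearEquiv, fun i j => ?_⟩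
  simp [hb i j]

theorem IsVolume.pull {ε : Form p (p + 1 + (p + 1))} (h : IsVolume g ε) :
    IsVolume (pullBilin g L) (pullForm ε L) := fun w => by
  have := h fun i => L (w i)
  exact this

/-- This and the naturality statements that follow for contractions with the metric come from frame
independence: the coordinate frame upstairs is carried by `L` to a frame dual with respect to g. -/
theorem sharp_pull (hg : NonDeg g) (c : Model p →L[ℝ] ℝ) :
    L (sharp (pullBilin g L) (pullCov c L)) = sharp g c := by
  rw [sharp_frame hg c ((hg.pull L).dualFrames.push L), sharp]
  simp

theorem covecSq_pull (hg : NonDeg g) (c : Model p →L[ℝ] ℝ) :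
    covecSq (pullBilin g L) (pullCov c L) = covecSq g c := by
  rw [covecSq_eq, covecSq_eq, ← sharp_pull L hg]
  rfl

theorem gradNorm_pull (hg : NonDeg g) (c : Model p →L[ℝ] ℝ) :
    gradNorm (pullBilin g L) (pullCov c L) = gradNorm g c := by
  rw [gradNorm, gradNorm, covecSq_pull L hg]

theorem unitForm_pull (hg : NonDeg g) (c : Model p →L[ℝ] ℝ) :
    unitForm (pullBilin g L) (pullCov c L) = pullCov (unitForm g c) L := by
  rw [unitForm, unitForm, gradNorm_pull L hg]
  rfl

theorem unitVec_pull (hg : NonDeg g) (c : Model p →L[ℝ] ℝ) :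
    L (unitVec (pullBilin g L) (pullCov c L)) = unitVec g c := by
  rw [unitVec_eq, unitVec_eq, unitForm_pull L hg, sharp_pull L hg]

theorem contractLast_pull (θ : Form p (k + 1)) (w : Model p) :
    contractLast (pullForm θ L) w = pullForm (contractLast θ (L w)) L := by
  ext u
  rw [contractLast_apply]
  change θ _ = contractLast θ (L w) _
  rw [contractLast_apply]
  congr 1
  exact comp_snoc _ u w

theorem dual_pull (hg : NonDeg g) (ε : Form p (p + 1 + (p + 1))) (F : Form p (p + 1)) :
    dual (pullBilin g L) (pullForm ε L) (pullForm F L) = pullForm (dual g ε F) L := by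
  ext u
  change _ = dual g ε F fun i => L (u i)
  rw [dual_apply_frame hg ε F ((hg.pull L).dualFrames.push L), dual_apply]
  refine congrArg _ (Finset.sum_congr rfl fun ν _ => ?_)
  have : (pullForm ε L) (Fin.append u fun i => e (ν i)) =
      ε (Fin.append (fun i => L (u i)) fun i => L (e (ν i))) := by
    rw [← comp_append]; rfl
  rw [this]
  rfl

theorem dot_pull (hg : NonDeg g) (α β : Form p k) :
    dot (pullBilin g L) (pullForm α L) (pullForm β L) = dot g α β := by
  rw [dot_frame hg α β ((hg.pull L).dualFrames.push L)]
  rfl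

theorem alternatizeUncurryFin_pull (c : Model p →L[ℝ] ℝ) (B : Form p k) :
    ContinuousAlternatingMap.alternatizeUncurryFin ((pullCov c L).smulRight (pullForm B L)) =
      pullForm (ContinuousAlternatingMap.alternatizeUncurryFin (c.smulRight B)) L := by
  ext u
  change _ = ContinuousAlternatingMap.alternatizeUncurryFin (c.smulRight B) fun i => L (u i)
  rw [ContinuousAlternatingMap.alternatizeUncurryFin_apply,
    ContinuousAlternatingMap.alternatizeUncurryFin_apply]
  rfl

theorem wedgeLast_pull (B : Form p k) (c : Model p →L[ℝ] ℝ) :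
    wedgeLast (pullForm B L) (pullCov c L) = pullForm (wedgeLast B c) L := by
  rw [wedgeLast_eq, wedgeLast_eq, alternatizeUncurryFin_pull]
  rfl

theorem pairing_pull (hg : NonDeg g) (ε : Form p (p + 1 + (p + 1))) (X Y : Form p (p + 1)) :
    pairing (pullBilin g L) (pullForm ε L) (pullForm X L) (pullForm Y L) = pairing g ε X Y := by
  rw [pairing, dual_pull L hg, dot_pull L hg]; rfl

theorem pullForm_add (θ θ' : Form p k) : pullForm (θ + θ') L = pullForm θ L + pullForm θ' L := rfl

theorem fieldW_pull (hg : NonDeg g) (ε : Form p (p + 1 + (p + 1))) (F : Form p (p + 1))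
    (α : Model p →L[ℝ] ℝ) (Λ : Form p (p + 1)) :
    fieldW (pullBilin g L) (pullForm ε L) (pullForm F L) (pullCov α L) (pullForm Λ L) =
      pullForm (fieldW g ε F α Λ) L := by
  simp only [fieldW, dual_pull L hg, contractLast_pull, unitVec_pull L hg]
  rfl

theorem lagAlg_pull (hg : NonDeg g) (ε : Form p (p + 1 + (p + 1))) (F : Form p (p + 1))
    (α : Model p →L[ℝ] ℝ) (Λ : Form p (p + 1)) :
    lagAlg (pullBilin g L) (pullForm ε L) (pullForm F L) (pullCov α L) (pullForm Λ L) =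
      lagAlg g ε F α Λ := by
  simp only [lagAlg, dual_pull L hg, contractLast_pull, unitVec_pull L hg, ← pullForm_add,
    dot_pull L hg]

/-! ### Products with covectors and currents -/

theorem covWedge_eq {m : ℕ} (hp : 0 < m + 1) (c : Model (m + 1) →L[ℝ] ℝ)
    (ψ : Form (m + 1) m) :
    covWedge hp (fun μ => c (e μ)) ψ =
      ContinuousAlternatingMap.alternatizeUncurryFin (c.smulRight ψ) := by
  rw [alternatizeUncurryFin_eq_ofComp, covWedge]
  congr 1
  ext μ
  simp only [ContinuousLinearMap.smulRight_apply, cov, ContinuousAlternatingMap.smul_apply,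
    smul_eq_mul, Nat.cast_add, Nat.cast_one]
  rfl

theorem covWedge_pull (hp : 0 < p) (c : Model p →L[ℝ] ℝ) (ψ : Form p (p - 1)) :
    covWedge hp (fun μ => pullCov c L (e μ)) (pullForm ψ L) =
      pullForm (covWedge hp (fun μ => c (e μ)) ψ) L := by
  cases p with
  | zero => exact absurd hp (lt_irrefl 0)
  | succ m =>
    rw [covWedge_eq, covWedge_eq]
    exact alternatizeUncurryFin_pull L c _

theorem covWedge_add_left (hp : 0 < p) (c c' : Model p →L[ℝ] ℝ) (ψ : Form p (p - 1)) :
    covWedge hp (fun μ => (c + c') (e μ)) ψ =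
      covWedge hp (fun μ => c (e μ)) ψ + covWedge hp (fun μ => c' (e μ)) ψ := by
  rw [covWedge, covWedge, covWedge, ← ofComp_add]
  congr 1; ext μ
  simp; ring

theorem covWedge_smul_left (hp : 0 < p) (r : ℝ) (c : Model p →L[ℝ] ℝ) (ψ : Form p (p - 1)) :
    covWedge hp (fun μ => (r • c) (e μ)) ψ = r • covWedge hp (fun μ => c (e μ)) ψ := by
  rw [covWedge, covWedge, ← ofComp_smul]
  congr 1; ext μ
  simp; ring

theorem covWedge_add_right (hp : 0 < p) (c : Model p →L[ℝ] ℝ) (ψ ψ' : Form p (p - 1)) :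
    covWedge hp (fun μ => c (e μ)) (ψ + ψ') =
      covWedge hp (fun μ => c (e μ)) ψ + covWedge hp (fun μ => c (e μ)) ψ' := by
  rw [covWedge, covWedge, covWedge, ← ofComp_add]
  congr 1; ext μ
  simp [cov]; ring

theorem covWedge_smul_right (hp : 0 < p) (r : ℝ) (c : Model p →L[ℝ] ℝ) (ψ : Form p (p - 1)) :
    covWedge hp (fun μ => c (e μ)) (r • ψ) = r • covWedge hp (fun μ => c (e μ)) ψ := by
  rw [covWedge, covWedge, ← ofComp_smul]
  congr 1; ext μ
  simp [cov]; ring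

/-- The tensor c⊗c is symmetric, so antisymmetrising twice annihilates it. -/
theorem wedgeLast_covWedge_self (hp : 0 < p) (c : Model p →L[ℝ] ℝ) (ψ : Form p (p - 1)) :
    wedgeLast (covWedge hp (fun μ => c (e μ)) ψ) c = 0 := by
  cases p with
  | zero => exact absurd hp (lt_irrefl 0)
  | succ m =>
    rw [covWedge_eq, wedgeLast_eq]
    have h := ContinuousAlternatingMap.alternatizeUncurryFin_alternatizeUncurryFinCLM_comp_of_symmetric
      (f := c.smulRight (c.smulRight (ψ : Form (m + 1) m))) (fun x y => by
        simp [smul_smul, mul_comm])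
    have h2 : (ContinuousAlternatingMap.alternatizeUncurryFinCLM ℝ (Model (m + 1)) ℝ ∘L
        c.smulRight (c.smulRight (ψ : Form (m + 1) m))) =
        c.smulRight (ContinuousAlternatingMap.alternatizeUncurryFin (c.smulRight ψ)) := by
      ext1 x
      simp
    rw [h2] at h
    rw [h, smul_zero]

/-- Polarisation of `wedgeLast_covWedge_self`. -/
theorem wedgeLast_covWedge_swap (hp : 0 < p) (a b : Model p →L[ℝ] ℝ) (ψ : Form p (p - 1)) :
    wedgeLast (covWedge hp (fun μ => a (e μ)) ψ) b +
      wedgeLast (covWedge hp (fun μ => b (e μ)) ψ) a = 0 := by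
  have h := wedgeLast_covWedge_self hp (a + b) ψ
  rw [covWedge_add_left, wedgeLast_add_left, wedgeLast_add_right, wedgeLast_add_right,
    wedgeLast_covWedge_self, wedgeLast_covWedge_self] at h
  simpa using h

/-- The coordinate covector `dx^ρ`. -/
def dx (ρ : Idx p) : Model p →L[ℝ] ℝ := EuclideanSpace.proj ρ

theorem dx_apply (ρ : Idx p) (u : Model p) : dx ρ u = u ρ := rfl

theorem eq_sum_dx (c : Model p →L[ℝ] ℝ) : c = ∑ ρ, c (e ρ) • dx ρ := by
  ext u
  conv_lhs => rw [eq_sum_e u]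
  simp [dx_apply, mul_comm]

/-- The vector `K` with `c(K) = (B ∧ c) · X^*` for all covectors `c`. -/
def current (g : Bilin p) (ε : Form p (p + 1 + (p + 1))) (B : Form p p) (X : Form p (p + 1)) :
    Model p := ∑ ρ, pairing g ε (wedgeLast B (dx ρ)) X • e ρ

theorem current_apply (g : Bilin p) (ε : Form p (p + 1 + (p + 1))) (B : Form p p)
    (X : Form p (p + 1)) (ρ : Idx p) : current g ε B X ρ = pairing g ε (wedgeLast B (dx ρ)) X := by
  simp [current, e, Pi.single_apply]

theorem pairing_sum_left {ι : Type*} (s : Finset ι) (ε : Form p (p + 1 + (p + 1)))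
    (X : ι → Form p (p + 1)) (Y : Form p (p + 1)) :
    pairing g ε (∑ i ∈ s, X i) Y = ∑ i ∈ s, pairing g ε (X i) Y := by
  classical
  induction s using Finset.induction_on with
  | empty => simp [pairing, dot, cov]
  | insert a s ha ih => rw [Finset.sum_insert ha, Finset.sum_insert ha, pairing_add_left, ih]

theorem wedgeLast_sum_right {ι : Type*} (s : Finset ι) (B : Form p k) (c : ι → Model p →L[ℝ] ℝ) :
    wedgeLast B (∑ i ∈ s, c i) = ∑ i ∈ s, wedgeLast B (c i) := by
  classical
  induction s using Finset.induction_on with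
  | empty => simpa using wedgeLast_smul_right 0 B 0
  | insert a s ha ih => rw [Finset.sum_insert ha, Finset.sum_insert ha, wedgeLast_add_right, ih]

theorem covector_current (ε : Form p (p + 1 + (p + 1))) (B : Form p p) (X : Form p (p + 1))
    (c : Model p →L[ℝ] ℝ) : c (current g ε B X) = pairing g ε (wedgeLast B c) X := by
  conv_rhs => rw [eq_sum_dx c, wedgeLast_sum_right, pairing_sum_left]
  simp [current, wedgeLast_smul_right, pairing_smul_left, mul_comm]

/-- The values c(K) = ⟨B∧c,X⟩ characterise K without reference to coordinates, so naturality of the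
pairing suffices. -/
theorem current_pull (hg : NonDeg g) (ε : Form p (p + 1 + (p + 1))) (B : Form p p)
    (X : Form p (p + 1)) :
    L (current (pullBilin g L) (pullForm ε L) (pullForm B L) (pullForm X L)) =
      current g ε B X := by
  ext ρ
  have h1 := covector_current (g := pullBilin g L) (pullForm ε L) (pullForm B L) (pullForm X L)
    (pullCov (dx ρ) L)
  rw [wedgeLast_pull, pairing_pull L hg] at h1
  rw [current_apply, ← h1]
  rfl

/-- The exterior derivative as a sum of products with `dx^ρ`. -/
theorem alternatizeUncurryFin_eq_sum (hk : Even k) (f : Model p →L[ℝ] Form p k) :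
    ContinuousAlternatingMap.alternatizeUncurryFin f = ∑ ρ, wedgeLast (f (e ρ)) (dx ρ) := by
  simp only [wedgeLast_eq, hk.neg_one_pow, one_smul]
  have h : f = ∑ ρ, (dx ρ).smulRight (f (e ρ)) := by
    ext1 u
    conv_lhs => rw [eq_sum_e u]
    simp [dx_apply]
  conv_lhs => rw [h]
  simp only [← ContinuousAlternatingMap.alternatizeUncurryFinCLM_apply, map_sum]

/-! ### Finite-dimensionality -/

/-- The components of a form. -/
def covLin : Form p k →ₗ[ℝ] ((Fin k → Idx p) → ℝ) where
  toFun θ := cov θ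
  map_add' _ _ := rfl
  map_smul' _ _ := rfl

/-- Finite dimension makes every algebraic bilinear operation on forms continuous, which gives the
product rule without estimates. -/
instance : FiniteDimensional ℝ (Form p k) :=
  FiniteDimensional.of_injective (covLin (p := p) (k := k))
    fun _ _ h => form_ext_cov fun μ => congrFun h μ

end Algebra

section Calculus

variable {p k : ℕ}

/-! ### Densities -/

/-- The Gram matrix is congruent to diag(-1,1,…,1), so its determinant is minus a nonzero square. -/
theorem Lorentzian.det_gram_neg {g : Bilin p} (hg : Lorentzian g) : (gram g).det < 0 := by
  obtain ⟨b, hb⟩ := hg.signature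
  have hb' : OrthoFrame g b := hb
  let P : Matrix (Idx p) (Idx p) ℝ := Matrix.of fun i j => b.repr (e i) j
  have hP : gram g = P * Matrix.diagonal eta * P.transpose := by
    ext i j
    rw [Matrix.mul_apply]
    simp only [gram, Matrix.of_apply, hb'.apply_eq, Matrix.mul_diagonal, Matrix.transpose_apply, P]
    rw [← Finset.add_sum_erase _ _ (Finset.mem_univ (0 : Idx p))]
    congr 1
    · simp [eta]
    · refine Finset.sum_congr rfl fun l hl => ?_
      simp [eta, Finset.ne_of_mem_erase hl]
  have hd : (gram g).det = -(P.det ^ 2) := by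
    rw [hP, Matrix.det_mul, Matrix.det_mul, Matrix.det_transpose, Matrix.det_diagonal, prod_eta]
    ring
  have h0 := hg.nonDeg.det_ne
  rw [hd] at h0 ⊢
  have : P.det ≠ 0 := fun h => by rw [h] at h0; simp at h0
  have := sq_pos_of_ne_zero this
  linarith

theorem IsVolume.sq_e {g : Bilin p} {ε : Form p (p + 1 + (p + 1))} (h : IsVolume g ε) :
    ε e ^ 2 = |(gram g).det| := h e

theorem map_eq_det (ε : Form p (p + 1 + (p + 1))) (u : Idx p → Model p) :
    ε u = ε e * (Matrix.of fun i j => u i j).det := by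
  have h := congrArg (fun f => f u) (AlternatingMap.eq_smul_basis_det
    (EuclideanSpace.basisFun (Idx p) ℝ).toBasis ε.toAlternatingMap)
  have h2 : ⇑(EuclideanSpace.basisFun (Idx p) ℝ).toBasis = e := funext basisFun_eq_e
  simp only [h2, AlternatingMap.smul_apply, smul_eq_mul] at h
  refine h.trans ?_
  change ε e * _ = _
  congr 1
  rw [Module.Basis.det_apply, ← Matrix.det_transpose]
  congr 1

/-- Raising all indices of a top form multiplies it by det g⁻¹; the remaining determinant is the
permutation symbol. -/
theorem con_volume (g : Bilin p) (ε : Form p (p + 1 + (p + 1))) (κ : Idx p → Idx p) :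
    con g ε κ = ε e * ((gram g).det⁻¹ *
      ((1 : Matrix (Idx p) (Idx p) ℝ).submatrix κ id).det) := by
  rw [con, map_eq_det]
  congr 1
  have : (Matrix.of fun i j => (eUp g (κ i)) j) =
      ((1 : Matrix (Idx p) (Idx p) ℝ).submatrix κ id) * (gram g)⁻¹ := by
    ext i j
    simp [eUp, e, Matrix.mul_apply, Matrix.one_apply, Pi.single_apply]
  rw [this, Matrix.det_mul, Matrix.det_nonsing_inv, Ring.inverse_eq_inv']
  ring

/-- The densitised tensor `√(-g) ε^{μ_1 … μ_d}` depends on the orientation only. -/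
theorem sqrt_mul_con {g g₀ : Bilin p} {ε ε₀ : Form p (p + 1 + (p + 1))} (hg : Lorentzian g)
    (hε : IsVolume g ε) (hg₀ : Lorentzian g₀) (hε₀ : IsVolume g₀ ε₀) (h : 0 < ε e * ε₀ e)
    (κ : Idx p → Idx p) :
    √|(gram g).det| * con g ε κ = √|(gram g₀).det| * con g₀ ε₀ κ := by
  -- Since det g = -ε(e)², the factor √|det g| ε(e)/det g is minus the sign of ε(e): the metric
  -- disappears and the orientation remains.
  have key : ∀ {g : Bilin p} {ε : Form p (p + 1 + (p + 1))}, Lorentzian g → IsVolume g ε →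
      √|(gram g).det| * (ε e * (gram g).det⁻¹) = -(|ε e| / ε e) := by
    intro g ε hg hε
    have h1 := hε.sq_e
    have h2 := hg.det_gram_neg
    rw [abs_of_neg h2] at h1
    rw [← hε.sq_e, Real.sqrt_sq_eq_abs]
    have h3 : (gram g).det = -(ε e ^ 2) := by linarith
    have h4 : ε e ≠ 0 := fun h => by rw [h] at h3; simp at h3; exact h2.ne h3
    rw [h3]
    field_simp
  have hs : |ε e| / ε e = |ε₀ e| / ε₀ e := by
    rcases pos_and_pos_or_neg_and_neg_of_mul_pos h with ⟨h1, h2⟩ | ⟨h1, h2⟩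
    · rw [abs_of_pos h1, abs_of_pos h2, div_self h1.ne', div_self h2.ne']
    · rw [abs_of_neg h1, abs_of_neg h2, neg_div, neg_div, div_self h1.ne, div_self h2.ne]
  rw [con_volume, con_volume]
  linear_combination ((1 : Matrix (Idx p) (Idx p) ℝ).submatrix κ id).det *
    (key hg hε - key hg₀ hε₀ - hs)

/-- It allows the metric to be frozen at one point when the density is differentiated, so no
derivative of g or ε appears in the divergence of a current. -/
theorem sqrt_mul_pairing {g g₀ : Bilin p} {ε ε₀ : Form p (p + 1 + (p + 1))} (hg : Lorentzian g)
    (hε : IsVolume g ε) (hg₀ : Lorentzian g₀) (hε₀ : IsVolume g₀ ε₀) (h : 0 < ε e * ε₀ e)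
    (X Y : Form p (p + 1)) :
    √|(gram g).det| * pairing g ε X Y = √|(gram g₀).det| * pairing g₀ ε₀ X Y := by
  rw [pairing_eq hg.nonDeg, pairing_eq hg₀.nonDeg, mul_left_comm,
    mul_left_comm √|(gram g₀).det|]
  simp only [Finset.mul_sum]
  refine Finset.sum_congr rfl fun μ _ => Finset.sum_congr rfl fun ν _ => ?_
  linear_combination (1 / ((p + 1).factorial : ℝ) * cov X μ * cov Y ν) *
    sqrt_mul_con hg hε hg₀ hε₀ h (Fin.append μ ν)

/-! ### The divergence of a current -/

theorem isBilinearMap_pairing (g : Bilin p) (ε : Form p (p + 1 + (p + 1))) (c : Model p →L[ℝ] ℝ) :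
    IsBilinearMap ℝ fun (B : Form p p) (X : Form p (p + 1)) => pairing g ε (wedgeLast B c) X where
  add_left _ _ _ := by simp only [wedgeLast_add_left, pairing_add_left]
  smul_left _ _ _ := by simp only [wedgeLast_smul_left, pairing_smul_left, smul_eq_mul]
  add_right _ _ _ := pairing_add_right _ _ _ _ _
  smul_right _ _ _ := pairing_smul_right _ _ _ _ _

theorem IsBilinearMap.fderiv_apply {E F G H : Type*} [NormedAddCommGroup E] [NormedSpace ℝ E]
    [FiniteDimensional ℝ E] [NormedAddCommGroup F] [NormedSpace ℝ F] [FiniteDimensional ℝ F]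
    [NormedAddCommGroup G] [NormedSpace ℝ G] [NormedAddCommGroup H] [NormedSpace ℝ H]
    {b : E → F → G} (hb : IsBilinearMap ℝ b) {f : H → E} {h : H → F} {x : H}
    (hf : DifferentiableAt ℝ f x) (hh : DifferentiableAt ℝ h x) (u : H) :
    fderiv ℝ (fun y => b (f y) (h y)) x u = b (fderiv ℝ f x u) (h x) + b (f x) (fderiv ℝ h x u) := by
  have := (hb.toContinuousBilinearMap.hasFDerivAt_of_bilinear hf.hasFDerivAt hh.hasFDerivAt).fderiv
  simp only [IsBilinearMap.toContinuousBilinearMap_apply] at this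
  rw [this]
  simp [add_comm]

/-- The divergence of a current, in coordinates. -/
theorem divergence_current (hp : Even p) {g : Model p → Bilin p}
    {ε : Model p → Form p (p + 1 + (p + 1))} {B : Model p → Form p p}
    {X : Model p → Form p (p + 1)} {y : Model p}
    (hg : ∀ᶠ z in nhds y, Lorentzian (g z) ∧ IsVolume (g z) (ε z)) (hε : ContinuousAt ε y)
    (hB : DifferentiableAt ℝ B y) (hX : DifferentiableAt ℝ X y) (r : ℝ) :
    (1 / √|(gram (g y)).det|) * ∑ μ : Idx p, fderiv ℝ (fun z => √|(gram (g z)).det| *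
      (r • current (g z) (ε z) (B z) (X z)) μ) y (e μ) =
    r * (pairing (g y) (ε y) (extDeriv B y) (X y) +
      ∑ ρ, pairing (g y) (ε y) (wedgeLast (B y) (dx ρ)) (fderiv ℝ X y (e ρ))) := by
  obtain ⟨hgy, hεy⟩ := hg.self_of_nhds
  have hs : 0 < √|(gram (g y)).det| :=
    Real.sqrt_pos.2 (abs_pos.2 hgy.nonDeg.det_ne)
  have he : 0 < ε y e * ε y e := by
    rw [← pow_two, hεy.sq_e]; exact abs_pos.2 hgy.nonDeg.det_ne
  have hc : ContinuousAt (fun z => ε z e * ε y e) y :=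
    (((ContinuousAlternatingMap.apply ℝ (Model p) ℝ e).continuous.continuousAt).comp hε).mul
      continuousAt_const
  -- By continuity ε keeps its sign near y, so the density may be computed with the metric and
  -- volume form at y.
  have hev : ∀ μ, (fun z => √|(gram (g z)).det| * (r • current (g z) (ε z) (B z) (X z)) μ) =ᶠ[nhds y]
      fun z => (√|(gram (g y)).det| * r) *
        pairing (g y) (ε y) (wedgeLast (B z) (dx μ)) (X z) := fun μ => by
    filter_upwards [hg, hc.eventually (lt_mem_nhds he)] with z hz hz2
    have := sqrt_mul_pairing hz.1 hz.2 hgy hεy hz2 (wedgeLast (B z) (dx μ)) (X z)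
    simp only [PiLp.smul_apply, smul_eq_mul, current_apply]
    linear_combination r * this
  have hd : ∀ μ, fderiv ℝ (fun z => √|(gram (g z)).det| *
      (r • current (g z) (ε z) (B z) (X z)) μ) y (e μ) = (√|(gram (g y)).det| * r) *
      (pairing (g y) (ε y) (wedgeLast (fderiv ℝ B y (e μ)) (dx μ)) (X y) +
        pairing (g y) (ε y) (wedgeLast (B y) (dx μ)) (fderiv ℝ X y (e μ))) := fun μ => by
    rw [(hev μ).fderiv_eq]
    have hb := isBilinearMap_pairing (g y) (ε y) (dx μ)
    have hdf : DifferentiableAt ℝ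
        (fun z => pairing (g y) (ε y) (wedgeLast (B z) (dx μ)) (X z)) y :=
      (hb.toContinuousBilinearMap.hasFDerivAt_of_bilinear hB.hasFDerivAt
        hX.hasFDerivAt).differentiableAt
    rw [fderiv_const_mul hdf]
    simp only [smul_apply, smul_eq_mul]
    rw [IsBilinearMap.fderiv_apply hb hB hX]
  simp only [hd]
  -- The derivatives falling on B assemble into dB; for even p no sign arises from placing dx^ρ
  -- last.
  rw [extDeriv, alternatizeUncurryFin_eq_sum hp, pairing_sum_left, ← Finset.sum_add_distrib,
    ← Finset.mul_sum]
  field_simp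

theorem sum_sum_eq_zero_of_antisymm {ι M : Type*} [Fintype ι] [AddCommGroup M] [Module ℝ M]
    {T : ι → ι → M} (h : ∀ i j, T i j + T j i = 0) : ∑ i, ∑ j, T i j = 0 := by
  have h1 : ∑ i, ∑ j, T i j + ∑ i, ∑ j, T i j = 0 := by
    calc _ = ∑ i, ∑ j, T i j + ∑ i, ∑ j, T j i := by rw [Finset.sum_comm (f := fun i j => T j i)]
      _ = 0 := by
        simp only [← Finset.sum_add_distrib, h, Finset.sum_const_zero]
  rw [← two_smul ℝ] at h1
  exact (smul_eq_zero.1 h1).resolve_left two_ne_zero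

end Calculus

/-! ### Closedness identities and the two first variations in coordinates -/

section Calculus

variable {p k : ℕ}

theorem pairing_sum_right {ι : Type*} (g : Bilin p) (s : Finset ι) (ε : Form p (p + 1 + (p + 1)))
    (X : Form p (p + 1)) (Y : ι → Form p (p + 1)) :
    pairing g ε X (∑ i ∈ s, Y i) = ∑ i ∈ s, pairing g ε X (Y i) := by
  classical
  induction s using Finset.induction_on with
  | empty => simpa using pairing_smul_right g ε 0 X 0
  | insert a s ha ih => rw [Finset.sum_insert ha, Finset.sum_insert ha, pairing_add_right, ih]

theorem wedgeLast_sum_left {ι : Type*} (s : Finset ι) (B : ι → Form p k) (c : Model p →L[ℝ] ℝ) :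
    wedgeLast (∑ i ∈ s, B i) c = ∑ i ∈ s, wedgeLast (B i) c := by
  classical
  induction s using Finset.induction_on with
  | empty => simpa using wedgeLast_smul_left 0 (0 : Form p k) c
  | insert a s ha ih => rw [Finset.sum_insert ha, Finset.sum_insert ha, wedgeLast_add_left, ih]

theorem form_neg_one_smul (θ : Form p k) : (-1 : ℝ) • θ = -θ := by
  ext u
  simp

theorem wedgeLast_neg_left (B : Form p k) (c : Model p →L[ℝ] ℝ) :
    wedgeLast (-B) c = -wedgeLast B c := by
  rw [← form_neg_one_smul, ← form_neg_one_smul, wedgeLast_smul_left]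

theorem fderiv_extDeriv {A : Model p → Form p k} {y : Model p} (hA : ContDiffAt ℝ ∞ A y)
    (u : Model p) : fderiv ℝ (extDeriv A) y u =
      ContinuousAlternatingMap.alternatizeUncurryFin (fderiv ℝ (fderiv ℝ A) y u) := by
  have h1 : DifferentiableAt ℝ (fderiv ℝ A) y :=
    ((hA.fderiv_right (m := 1) (by norm_cast)).differentiableAt one_ne_zero)
  have h2 := HasFDerivAt.comp (𝕜 := ℝ) (F := Model p →L[ℝ] Form p k) (G := Form p (k + 1)) y
    (ContinuousAlternatingMap.alternatizeUncurryFinCLM ℝ (Model p) ℝ (n := k)).hasFDerivAt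
    h1.hasFDerivAt
  exact congrArg (fun f => f u) h2.fderiv

theorem differentiableAt_extDeriv {A : Model p → Form p k} {y : Model p}
    (hA : ContDiffAt ℝ ∞ A y) : DifferentiableAt ℝ (extDeriv A) y :=
  ((ContinuousAlternatingMap.alternatizeUncurryFinCLM ℝ (Model p) ℝ
    (n := k)).differentiableAt.comp y
    ((hA.fderiv_right (m := 1) (by norm_cast)).differentiableAt one_ne_zero))

theorem contDiffAt_extDeriv {A : Model p → Form p k} {y : Model p}
    (hA : ContDiffAt ℝ ∞ A y) : ContDiffAt ℝ ∞ (extDeriv A) y := by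
  have h : ContDiffAt ℝ ∞ (fderiv ℝ A) y := hA.fderiv_right (m := ∞) (by norm_cast)
  exact ContDiffAt.continuousLinearMap_comp
    (ContinuousAlternatingMap.alternatizeUncurryFinCLM ℝ (Model p) ℝ (n := k)) h

/-- Contraction of the derivative of an exact form with the volume form. -/
theorem sum_pairing_fderiv_extDeriv (hp : Even p) {g : Bilin p} (hg : NonDeg g)
    (ε : Form p (p + 1 + (p + 1))) (B : Form p p) {A : Model p → Form p p} {y : Model p}
    (hA : ContDiffAt ℝ ∞ A y) :
    ∑ ρ, pairing g ε (wedgeLast B (dx ρ)) (fderiv ℝ (extDeriv A) y (e ρ)) = 0 := by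
  simp only [fderiv_extDeriv hA, alternatizeUncurryFin_eq_sum hp, pairing_sum_right]
  -- Second derivatives of A are symmetric in the two indices, while the pairing is antisymmetric in
  -- the two covectors dx. This is dF = 0.
  refine sum_sum_eq_zero_of_antisymm fun i j => ?_
  have hs : IsSymmSndFDerivAt ℝ A y := hA.isSymmSndFDerivAt (by simp; norm_cast)
  rw [hs.eq (e j) (e i), pairing_wedgeLast_swap hg]
  ring

/-- A symmetric Hessian is contracted with an expression antisymmetric in dx^ρ and dx^σ. It encodes
that ∂a is closed. -/
theorem sum_pairing_wedgeLast_hessian {g : Bilin p} (hg : NonDeg g)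
    (ε : Form p (p + 1 + (p + 1))) (Y Y' : Form p p) {H : Model p →L[ℝ] Model p →L[ℝ] ℝ}
    (hH : ∀ u w, H u w = H w u) :
    ∑ ρ, pairing g ε (wedgeLast Y (dx ρ)) (wedgeLast Y' (H (e ρ))) = 0 := by
  have h : ∀ ρ, wedgeLast Y' (H (e ρ)) = ∑ σ, H (e ρ) (e σ) • wedgeLast Y' (dx σ) := fun ρ => by
    conv_lhs => rw [eq_sum_dx (H (e ρ)), wedgeLast_sum_right]
    simp only [wedgeLast_smul_right]
  simp only [h, pairing_sum_right, pairing_smul_right]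
  refine sum_sum_eq_zero_of_antisymm fun i j => ?_
  rw [hH (e j) (e i), pairing_wedgeLast_swap hg]
  ring

theorem isBilinearMap_wedgeLast :
    IsBilinearMap ℝ fun (B : Form p k) (c : Model p →L[ℝ] ℝ) => wedgeLast B c where
  add_left _ _ _ := wedgeLast_add_left _ _ _
  smul_left _ _ _ := wedgeLast_smul_left _ _ _
  add_right _ _ _ := wedgeLast_add_right _ _ _
  smul_right _ _ _ := wedgeLast_smul_right _ _ _

theorem isBilinearMap_covWedge (hp : 0 < p) :
    IsBilinearMap ℝ fun (c : Model p →L[ℝ] ℝ) (ψ : Form p (p - 1)) =>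
      covWedge hp (fun μ => c (e μ)) ψ where
  add_left _ _ _ := covWedge_add_left _ _ _ _
  smul_left _ _ _ := covWedge_smul_left _ _ _ _
  add_right _ _ _ := covWedge_add_right _ _ _ _
  smul_right _ _ _ := covWedge_smul_right _ _ _ _

/-- The variation of the Lagrangian under the transformation with scalar parameter is the
divergence of a current. -/
theorem variation_scalar (hp : Even p) {g : Bilin p} (hg : NonDeg g)
    (ε : Form p (p + 1 + (p + 1))) {A Y : Model p → Form p p} {φ : Model p → ℝ}
    {α : Model p → Model p →L[ℝ] ℝ} {y : Model p} (hA : ContDiffAt ℝ ∞ A y)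
    (hY : DifferentiableAt ℝ Y y) (hφ : DifferentiableAt ℝ φ y) (hα : DifferentiableAt ℝ α y)
    (hH : ∀ u w, fderiv ℝ α y u w = fderiv ℝ α y w u) :
    1 / 2 * pairing g ε (extDeriv A y) (extDeriv (fun z => -(φ z) • Y z) y)
      + pairing g ε (wedgeLast (Y y) (α y)) (extDeriv (fun z => -(φ z) • Y z) y)
      - 1 / 2 * pairing g ε (wedgeLast (Y y) (fderiv ℝ φ y)) (wedgeLast (Y y) (α y)) =
    -(1 / 2) * (pairing g ε (extDeriv (fun z => -(φ z) • Y z) y)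
        (extDeriv A y + wedgeLast (Y y) (α y)) +
      ∑ ρ, pairing g ε (wedgeLast (-(φ y) • Y y) (dx ρ))
        (fderiv ℝ (fun z => extDeriv A z + wedgeLast (Y z) (α z)) y (e ρ))) := by
  have hb := isBilinearMap_wedgeLast (p := p) (k := p)
  have hYα : DifferentiableAt ℝ (fun z => wedgeLast (Y z) (α z)) y :=
    (hb.toContinuousBilinearMap.hasFDerivAt_of_bilinear hY.hasFDerivAt
        hα.hasFDerivAt).differentiableAt
  have hD : ∀ u, fderiv ℝ (fun z => extDeriv A z + wedgeLast (Y z) (α z)) y u =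
      fderiv ℝ (extDeriv A) y u +
        (wedgeLast (fderiv ℝ Y y u) (α y) + wedgeLast (Y y) (fderiv ℝ α y u)) := fun u => by
    rw [fderiv_fun_add (differentiableAt_extDeriv hA) hYα, ← IsBilinearMap.fderiv_apply hb hY hα]
    rfl
  have hX : extDeriv (fun z => -(φ z) • Y z) y =
      -(wedgeLast (Y y) (fderiv ℝ φ y) + φ y • extDeriv Y y) := by
    have h1 : ∀ u, fderiv ℝ (fun z => -(φ z) • Y z) y u =
        -(fderiv ℝ φ y u • Y y + φ y • fderiv ℝ Y y u) := fun u => by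
      rw [fderiv_fun_smul hφ.fun_neg hY]
      simp [fderiv_fun_neg, add_comm]
    rw [extDeriv, extDeriv, alternatizeUncurryFin_eq_sum hp, alternatizeUncurryFin_eq_sum hp]
    simp only [h1]
    conv_rhs => rw [eq_sum_dx (fderiv ℝ φ y), wedgeLast_sum_right]
    rw [Finset.smul_sum, ← Finset.sum_add_distrib, ← Finset.sum_neg_distrib]
    refine Finset.sum_congr rfl fun ρ _ => ?_
    rw [wedgeLast_smul_right, ← wedgeLast_smul_left, ← wedgeLast_smul_left, ← wedgeLast_add_left]
    exact wedgeLast_neg_left _ _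
  -- The derivatives of F and of ∂a cancel by symmetry of second derivatives. In the remaining terms
  -- `pairing_wedgeLast_comm` exchanges Y with its derivative, and the sum becomes a multiple of
  -- ⟨dY,Y∧α⟩.
  have hsum : ∑ ρ, pairing g ε (wedgeLast (-(φ y) • Y y) (dx ρ))
        (fderiv ℝ (fun z => extDeriv A z + wedgeLast (Y z) (α z)) y (e ρ)) =
      -(φ y) * pairing g ε (extDeriv Y y) (wedgeLast (Y y) (α y)) := by
    have h1 := sum_pairing_fderiv_extDeriv hp hg ε (-(φ y) • Y y) hA
    have h2 := sum_pairing_wedgeLast_hessian hg ε (-(φ y) • Y y) (Y y) hH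
    simp only [hD, pairing_add_right, Finset.sum_add_distrib, h1, h2]
    rw [extDeriv, alternatizeUncurryFin_eq_sum hp, pairing_sum_left, Finset.mul_sum]
    simp only [zero_add, add_zero]
    refine Finset.sum_congr rfl fun ρ _ => ?_
    rw [wedgeLast_smul_left, pairing_smul_left, pairing_wedgeLast_comm hp hg]
  rw [hsum, pairing_add_right, pairing_comm hp hg ε (extDeriv A y),
    pairing_comm hp hg ε (wedgeLast (Y y) (α y))]
  have h3 : pairing g ε (extDeriv (fun z => -(φ z) • Y z) y) (wedgeLast (Y y) (α y)) =
      -(pairing g ε (wedgeLast (Y y) (fderiv ℝ φ y)) (wedgeLast (Y y) (α y)) +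
        φ y * pairing g ε (extDeriv Y y) (wedgeLast (Y y) (α y))) := by
    rw [hX, ← pairing_smul_left, ← pairing_add_left]
    exact dot_neg_left _ _ _
  rw [h3]
  ring

/-- The product of `W ∧ α` with the exterior derivative of `α ∧ χ` vanishes for closed `α`. -/
theorem pairing_extDeriv_covWedge (hp : Even p) (hp0 : 0 < p) {g : Bilin p} (hg : NonDeg g)
    (ε : Form p (p + 1 + (p + 1))) (W : Form p p) {χ : Model p → Form p (p - 1)}
    {α : Model p → Model p →L[ℝ] ℝ} {y : Model p} (hχ : DifferentiableAt ℝ χ y)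
    (hα : DifferentiableAt ℝ α y) (hH : ∀ u w, fderiv ℝ α y u w = fderiv ℝ α y w u) :
    pairing g ε (wedgeLast W (α y))
      (extDeriv (fun z => covWedge hp0 (fun μ => α z (e μ)) (χ z)) y) = 0 := by
  have hb := isBilinearMap_covWedge hp0
  have hX : extDeriv (fun z => covWedge hp0 (fun μ => α z (e μ)) (χ z)) y =
      ∑ ρ, wedgeLast (covWedge hp0 (fun μ => α y (e μ)) (fderiv ℝ χ y (e ρ))) (dx ρ) := by
    rw [extDeriv, alternatizeUncurryFin_eq_sum hp]
    have h1 : ∀ ρ, fderiv ℝ (fun z => covWedge hp0 (fun μ => α z (e μ)) (χ z)) y (e ρ) =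
        covWedge hp0 (fun μ => fderiv ℝ α y (e ρ) (e μ)) (χ y) +
          covWedge hp0 (fun μ => α y (e μ)) (fderiv ℝ χ y (e ρ)) := fun ρ =>
      IsBilinearMap.fderiv_apply hb hα hχ (e ρ)
    simp only [h1, wedgeLast_add_left, Finset.sum_add_distrib]
    have h2 : ∀ ρ, covWedge hp0 (fun μ => fderiv ℝ α y (e ρ) (e μ)) (χ y) =
        ∑ σ, fderiv ℝ α y (e ρ) (e σ) • covWedge hp0 (fun μ => dx σ (e μ)) (χ y) := fun ρ => by
      conv_lhs => rw [eq_sum_dx (fderiv ℝ α y (e ρ))]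
      have : ∀ s : Finset (Idx p), covWedge hp0 (fun μ =>
          (∑ σ ∈ s, fderiv ℝ α y (e ρ) (e σ) • dx σ) (e μ)) (χ y) =
          ∑ σ ∈ s, fderiv ℝ α y (e ρ) (e σ) • covWedge hp0 (fun μ => dx σ (e μ)) (χ y) := by
        intro s
        induction s using Finset.induction_on with
        | empty => simpa using covWedge_smul_left hp0 0 0 (χ y)
        | insert a s ha ih =>
          rw [Finset.sum_insert ha, Finset.sum_insert ha, covWedge_add_left, ih,
            covWedge_smul_left]
      exact this Finset.univ
    simp only [h2, wedgeLast_sum_left, wedgeLast_smul_left]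
    -- The terms with a derivative of α vanish because α is closed; in the others the factor α
    -- remains.
    rw [sum_sum_eq_zero_of_antisymm, zero_add]
    intro i j
    rw [hH (e j) (e i), ← smul_add, wedgeLast_covWedge_swap, smul_zero]
  rw [hX, pairing_sum_right]
  refine Finset.sum_eq_zero fun ρ _ => ?_
  rw [pairing_comm hp hg, pairing_wedgeLast_swap hg, wedgeLast_covWedge_self]
  simp [pairing, dot, cov]

end Calculus

section Smoothness

variable {p k : ℕ} {N : Type*} [NormedAddCommGroup N] [NormedSpace ℝ N] {z : N}
  {n : WithTop ℕ∞}

/-! ### Smooth dependence on parameters -/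

/-- Taking components is an injective linear map, and a linear left inverse is continuous in finite
dimension. Smoothness of all tensor operations thus reduces to that of their components. -/
theorem contDiffAt_form_iff {θ : N → Form p k} :
    ContDiffAt ℝ n θ z ↔ ∀ μ, ContDiffAt ℝ n (fun y => cov (θ y) μ) z := by
  have hinj : LinearMap.ker (covLin (p := p) (k := k)) = ⊥ :=
    LinearMap.ker_eq_bot.2 fun _ _ h => form_ext_cov fun μ => congrFun h μ
  obtain ⟨T, hT⟩ := LinearMap.exists_leftInverse_of_injective _ hinj
  constructor
  · intro h μ
    have := (LinearMap.toContinuousLinearMap (covLin (p := p) (k := k))).contDiff.contDiffAt.comp z h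
    exact contDiffAt_pi.1 this μ
  · intro h
    have h1 : ContDiffAt ℝ n (fun y => covLin (θ y)) z := contDiffAt_pi.2 h
    have h2 := (LinearMap.toContinuousLinearMap T).contDiff.contDiffAt.comp z h1
    refine h2.congr_of_eventuallyEq (Filter.Eventually.of_forall fun y => ?_)
    exact (LinearMap.congr_fun hT (θ y)).symm

theorem form_apply_eq_sum (θ : Form p k) (u : Fin k → Model p) :
    θ u = ∑ μ : Fin k → Idx p, (∏ i, u i (μ i)) * cov θ μ := by
  have h : u = fun i => ∑ μ, u i μ • (e μ : Model p) := funext fun i => eq_sum_e (u i)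
  have h1 := θ.toMultilinearMap.map_sum fun i (μ : Idx p) => u i μ • (e μ : Model p)
  have h2 : θ u = θ.toMultilinearMap fun i => ∑ μ, u i μ • (e μ : Model p) := congrArg θ h
  rw [h2, h1]
  refine Finset.sum_congr rfl fun μ _ => ?_
  rw [MultilinearMap.map_smul_univ]
  rfl

theorem contDiffAt_form_apply {θ : N → Form p k} (hθ : ContDiffAt ℝ n θ z)
    {u : N → Fin k → Model p} (hu : ∀ i, ContDiffAt ℝ n (fun y => u y i) z) :
    ContDiffAt ℝ n (fun y => θ y (u y)) z := by
  simp only [form_apply_eq_sum]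
  refine ContDiffAt.sum fun μ _ => ContDiffAt.mul ?_ (contDiffAt_form_iff.1 hθ μ)
  exact contDiffAt_prod fun i _ => (contDiffAt_euclidean.1 (hu i)) (μ i)

theorem contDiffAt_ofComp {T : N → (Fin k → Idx p) → ℝ}
    (hT : ∀ μ, ContDiffAt ℝ n (fun y => T y μ) z) :
    ContDiffAt ℝ n (fun y => ofComp (T y)) z := by
  refine contDiffAt_form_iff.2 fun μ => ?_
  simp only [cov_ofComp]
  exact contDiffAt_const.mul (ContDiffAt.sum fun σ _ => contDiffAt_const.mul (hT _))

theorem contDiffAt_det {ι : Type*} [Fintype ι] [DecidableEq ι] {A : N → Matrix ι ι ℝ}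
    (hA : ∀ i j, ContDiffAt ℝ n (fun y => A y i j) z) :
    ContDiffAt ℝ n (fun y => (A y).det) z := by
  simp only [Matrix.det_apply']
  exact ContDiffAt.sum fun σ _ => contDiffAt_const.mul (contDiffAt_prod fun i _ => hA _ _)

/-- Cramer's rule expresses the entries of the inverse through determinants. -/
theorem contDiffAt_matrix_inv {ι : Type*} [Fintype ι] [DecidableEq ι] {A : N → Matrix ι ι ℝ}
    (hA : ∀ i j, ContDiffAt ℝ n (fun y => A y i j) z) (h0 : (A z).det ≠ 0) (i j : ι) :
    ContDiffAt ℝ n (fun y => (A y)⁻¹ i j) z := by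
  have h : ∀ y, (A y)⁻¹ i j = ((A y).det)⁻¹ * ((A y).updateRow j (Pi.single i 1)).det := fun y => by
    rw [Matrix.inv_def, Ring.inverse_eq_inv', Matrix.smul_apply, Matrix.adjugate_apply, smul_eq_mul]
  simp only [h]
  refine ((contDiffAt_det hA).inv h0).mul (contDiffAt_det fun a b => ?_)
  simp only [Matrix.updateRow_apply]
  split_ifs
  · exact contDiffAt_const
  · exact hA a b

variable {g : N → Bilin p} {ε : N → Form p (p + 1 + (p + 1))}

theorem contDiffAt_gram (hg : ContDiffAt ℝ n g z) (μ ν : Idx p) :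
    ContDiffAt ℝ n (fun y => gram (g y) μ ν) z :=
  (hg.clm_apply contDiffAt_const).clm_apply contDiffAt_const

theorem contDiffAt_eUp (hg : ContDiffAt ℝ n g z) (h0 : NonDeg (g z)) (μ : Idx p) :
    ContDiffAt ℝ n (fun y => eUp (g y) μ) z :=
  ContDiffAt.sum fun ν _ =>
    (contDiffAt_matrix_inv (contDiffAt_gram hg) h0.det_ne μ ν).smul contDiffAt_const

theorem contDiffAt_con (hg : ContDiffAt ℝ n g z) (h0 : NonDeg (g z)) {θ : N → Form p k}
    (hθ : ContDiffAt ℝ n θ z) (μ : Fin k → Idx p) :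
    ContDiffAt ℝ n (fun y => con (g y) (θ y) μ) z :=
  contDiffAt_form_apply hθ fun i => contDiffAt_eUp hg h0 (μ i)

theorem contDiffAt_dot (hg : ContDiffAt ℝ n g z) (h0 : NonDeg (g z)) {θ θ' : N → Form p k}
    (hθ : ContDiffAt ℝ n θ z) (hθ' : ContDiffAt ℝ n θ' z) :
    ContDiffAt ℝ n (fun y => dot (g y) (θ y) (θ' y)) z :=
  ContDiffAt.sum fun μ _ => (contDiffAt_form_iff.1 hθ μ).mul (contDiffAt_con hg h0 hθ' μ)

theorem contDiffAt_dual (hg : ContDiffAt ℝ n g z) (h0 : NonDeg (g z)) (hε : ContDiffAt ℝ n ε z)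
    {F : N → Form p (p + 1)} (hF : ContDiffAt ℝ n F z) :
    ContDiffAt ℝ n (fun y => dual (g y) (ε y) (F y)) z :=
  contDiffAt_ofComp fun _ => contDiffAt_const.mul (ContDiffAt.sum fun ν _ =>
    (contDiffAt_form_iff.1 hε _).mul (contDiffAt_con hg h0 hF ν))

theorem contDiffAt_pairing (hg : ContDiffAt ℝ n g z) (h0 : NonDeg (g z)) (hε : ContDiffAt ℝ n ε z)
    {F F' : N → Form p (p + 1)} (hF : ContDiffAt ℝ n F z) (hF' : ContDiffAt ℝ n F' z) :
    ContDiffAt ℝ n (fun y => pairing (g y) (ε y) (F y) (F' y)) z :=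
  contDiffAt_dot hg h0 hF (contDiffAt_dual hg h0 hε hF')

theorem contDiffAt_contractLast {θ : N → Form p (k + 1)} (hθ : ContDiffAt ℝ n θ z)
    {w : N → Model p} (hw : ContDiffAt ℝ n w z) :
    ContDiffAt ℝ n (fun y => contractLast (θ y) (w y)) z :=
  contDiffAt_ofComp fun μ => contDiffAt_form_apply hθ fun i => by
    refine Fin.lastCases ?_ (fun j => ?_) i
    · simpa using hw
    · simpa using contDiffAt_const

theorem contDiffAt_wedgeLast {B : N → Form p k} (hB : ContDiffAt ℝ n B z)
    {c : N → Model p →L[ℝ] ℝ} (hc : ContDiffAt ℝ n c z) :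
    ContDiffAt ℝ n (fun y => wedgeLast (B y) (c y)) z :=
  contDiffAt_ofComp fun _ => contDiffAt_const.mul
    ((contDiffAt_form_iff.1 hB _).mul (hc.clm_apply contDiffAt_const))

theorem contDiffAt_current (hg : ContDiffAt ℝ n g z) (h0 : NonDeg (g z)) (hε : ContDiffAt ℝ n ε z)
    {B : N → Form p p} (hB : ContDiffAt ℝ n B z) {X : N → Form p (p + 1)}
    (hX : ContDiffAt ℝ n X z) :
    ContDiffAt ℝ n (fun y => current (g y) (ε y) (B y) (X y)) z :=
  ContDiffAt.sum fun _ _ =>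
    (contDiffAt_pairing hg h0 hε (contDiffAt_wedgeLast hB contDiffAt_const) hX).smul contDiffAt_const

variable {α : N → Model p →L[ℝ] ℝ}

theorem contDiffAt_covecSq (hg : ContDiffAt ℝ n g z) (h0 : NonDeg (g z))
    (hα : ContDiffAt ℝ n α z) : ContDiffAt ℝ n (fun y => covecSq (g y) (α y)) z :=
  ContDiffAt.sum fun μ _ =>
    (hα.clm_apply contDiffAt_const).mul (hα.clm_apply (contDiffAt_eUp hg h0 μ))

theorem contDiffAt_gradNorm (hg : ContDiffAt ℝ n g z) (h0 : NonDeg (g z))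
    (hα : ContDiffAt ℝ n α z) (ht : covecSq (g z) (α z) < 0) :
    ContDiffAt ℝ n (fun y => gradNorm (g y) (α y)) z :=
  (contDiffAt_covecSq hg h0 hα).neg.sqrt (by simpa using ht.ne)

theorem contDiffAt_unitVec (hg : ContDiffAt ℝ n g z) (h0 : NonDeg (g z))
    (hα : ContDiffAt ℝ n α z) (ht : covecSq (g z) (α z) < 0) :
    ContDiffAt ℝ n (fun y => unitVec (g y) (α y)) z :=
  ContDiffAt.sum fun μ _ => ((hα.clm_apply contDiffAt_const).div
    (contDiffAt_gradNorm hg h0 hα ht) (gradNorm_pos ht).ne').smul (contDiffAt_eUp hg h0 μ)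

variable {F L : N → Form p (p + 1)}

theorem contDiffAt_fieldW (hg : ContDiffAt ℝ n g z) (h0 : NonDeg (g z)) (hε : ContDiffAt ℝ n ε z)
    (hα : ContDiffAt ℝ n α z) (ht : covecSq (g z) (α z) < 0) (hF : ContDiffAt ℝ n F z)
    (hL : ContDiffAt ℝ n L z) :
    ContDiffAt ℝ n (fun y => fieldW (g y) (ε y) (F y) (α y) (L y)) z := by
  have hv := contDiffAt_unitVec hg h0 hα ht
  have hE := contDiffAt_contractLast hF hv
  have hB := contDiffAt_contractLast (contDiffAt_dual hg h0 hε hF) hv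
  exact (hE.sub hB).add ((hB.add (contDiffAt_contractLast hL hv)).const_smul (2 : ℝ))

theorem contDiffAt_lagAlg (hg : ContDiffAt ℝ n g z) (h0 : NonDeg (g z)) (hε : ContDiffAt ℝ n ε z)
    (hα : ContDiffAt ℝ n α z) (ht : covecSq (g z) (α z) < 0) (hF : ContDiffAt ℝ n F z)
    (hL : ContDiffAt ℝ n L z) :
    ContDiffAt ℝ n (fun y => lagAlg (g y) (ε y) (F y) (α y) (L y)) z := by
  have hv := contDiffAt_unitVec hg h0 hα ht
  have hE := contDiffAt_contractLast hF hv
  have hB := contDiffAt_contractLast (contDiffAt_dual hg h0 hε hF) hv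
  have hl := hB.add (contDiffAt_contractLast hL hv)
  exact contDiffAt_const.mul (((contDiffAt_const.mul (contDiffAt_dot hg h0 hE hB)).sub
    (contDiffAt_const.mul (contDiffAt_dot hg h0 hB hB))).add (contDiffAt_dot hg h0 hl hl))

theorem contDiffAt_covWedge (hp : 0 < p) (hα : ContDiffAt ℝ n α z) {ψ : N → Form p (p - 1)}
    (hψ : ContDiffAt ℝ n ψ z) :
    ContDiffAt ℝ n (fun y => covWedge hp (fun μ => α y (e μ)) (ψ y)) z :=
  contDiffAt_ofComp fun _ => contDiffAt_const.mul
    ((hα.clm_apply contDiffAt_const).mul (contDiffAt_form_iff.1 hψ _))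

end Smoothness

/-! ### The self-dual extension of a transverse form -/

section SelfDualExtension

variable {p : ℕ}

/-- The second summand is the dual of the first: (p+1) antisymmetrised terms turn the 1/(p+1)! of
the dual into 1/p!. Self-duality then follows from the dual being an involution. -/
theorem selfDualExt_eq {g : Bilin p} (hg : NonDeg g) (ε : Form p (p + 1 + (p + 1)))
    (α : Model p →L[ℝ] ℝ) (B : Form p p) :
    selfDualExt g ε α B =
      wedgeLast B (unitForm g α) + dual g ε (wedgeLast B (unitForm g α)) := by
  have h1 : selfDualExt g ε α B = wedgeLast B (unitForm g α) + ofComp fun μ =>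
      1 / (p.factorial : ℝ) * ∑ ν : Fin (p + 1) → Idx p, cov ε (Fin.append μ ν) *
          (con g B (fun i => ν i.castSucc) * unitVec g α (ν (Fin.last p))) := by
    rw [wedgeLast, ← ofComp_add]
    simp only [selfDualExt, unitCov_eq]
  rw [h1]
  congr 1
  refine ofComp_eq_of_cov fun μ => ?_
  rw [cov, dual_wedgeLast hg, ← unitVec_eq]
  congr 1
  let M : MultilinearMap ℝ (fun _ : Fin p => Model p) ℝ :=
    (LinearMap.applyₗ (unitVec g α)).compMultilinearMap
      (rightML ε fun i => e (μ i)).curryRight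
  have hM : ∀ u, M u = ε (Fin.append (fun i => e (μ i))
      (Fin.snoc (α := fun _ => Model p) u (unitVec g α))) := fun u => by
    rw [← rightML_apply]; rfl
  -- One formula has the upper indices on B, the other on ε; frame independence of the contraction
  -- identifies them.
  have h2 := hg.dualFrames.sum_mul hg.dualFrames' M B.toMultilinearMap
  simp only [hM] at h2
  refine Eq.trans ?_ h2
  rw [sum_snoc]
  refine Finset.sum_congr rfl fun ν _ => ?_
  rw [← hM]
  have h3 : M (fun i => e (ν i)) = ∑ l, unitVec g α l *
      cov ε (Fin.append μ (Fin.snoc (α := fun _ => Idx p) ν l)) := by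
    have : M (fun i => e (ν i)) = (rightML ε fun i => e (μ i)).curryRight (fun i => e (ν i))
      (unitVec g α) := rfl
    rw [this, eq_sum_e (unitVec g α), map_sum]
    refine Finset.sum_congr rfl fun l _ => ?_
    rw [map_smul, smul_eq_mul, MultilinearMap.curryRight_apply, rightML_apply, cov, comp_append,
      comp_snoc, ← eq_sum_e]
  rw [h3, Finset.sum_mul]
  refine Finset.sum_congr rfl fun l _ => ?_
  simp only [Fin.snoc_castSucc, Fin.snoc_last]
  change _ = _ * con g B ν
  ring

end SelfDualExtension

section Charts

variable {p k : ℕ} {M : Type*} [TopologicalSpace M] [ChartedSpace (Model p) M]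

/-! ### Coordinate expressions -/

/-- The change of coordinates from the chart around `x₀` to the chart around `x₁`. -/
def coordChange (x₁ x₀ : M) (y : Model p) : Model p :=
  chartAt (Model p) x₁ ((chartAt (Model p) x₀).symm y)

variable {x₀ x₁ : M} {y : Model p}

theorem coordChange_mem (h : (chartAt (Model p) x₀).symm y ∈ (chartAt (Model p) x₁).source) :
    coordChange x₁ x₀ y ∈ (chartAt (Model p) x₁).target :=
  (chartAt (Model p) x₁).map_source h

theorem symm_coordChange (h : (chartAt (Model p) x₀).symm y ∈ (chartAt (Model p) x₁).source) :
    (chartAt (Model p) x₁).symm (coordChange x₁ x₀ y) = (chartAt (Model p) x₀).symm y :=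
  (chartAt (Model p) x₁).left_inv h

theorem coordChange_coordChange (hy : y ∈ (chartAt (Model p) x₀).target)
    (h : (chartAt (Model p) x₀).symm y ∈ (chartAt (Model p) x₁).source) :
    coordChange x₀ x₁ (coordChange x₁ x₀ y) = y := by
  rw [coordChange, symm_coordChange h, (chartAt (Model p) x₀).right_inv hy]

theorem target_mem_nhds (hy : y ∈ (chartAt (Model p) x₀).target) :
    (chartAt (Model p) x₀).target ∈ nhds y :=
  (chartAt (Model p) x₀).open_target.mem_nhds hy

theorem eventually_symm_mem (hy : y ∈ (chartAt (Model p) x₀).target)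
    (h : (chartAt (Model p) x₀).symm y ∈ (chartAt (Model p) x₁).source) :
    ∀ᶠ z in nhds y, (chartAt (Model p) x₀).symm z ∈ (chartAt (Model p) x₁).source :=
  ((chartAt (Model p) x₀).continuousAt_symm hy).preimage_mem_nhds
    ((chartAt (Model p) x₁).open_source.mem_nhds h)

theorem mem_target_self (x : M) : chartAt (Model p) x x ∈ (chartAt (Model p) x).target :=
  mem_chart_target _ x

theorem symm_self (x : M) : (chartAt (Model p) x).symm (chartAt (Model p) x x) = x :=
  (chartAt (Model p) x).left_inv (mem_chart_source _ x)

theorem SmoothForm.contDiffAt {θ : FormField p M k} (hθ : SmoothForm θ)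
    (hy : y ∈ (chartAt (Model p) x₀).target) : ContDiffAt ℝ ∞ (chartForm θ x₀) y :=
  (hθ x₀).contDiffAt (target_mem_nhds hy)

theorem SmoothVec.contDiffAt {K : VecField p M} (hK : SmoothVec K)
    (hy : y ∈ (chartAt (Model p) x₀).target) : ContDiffAt ℝ ∞ (chartVec K x₀) y :=
  (hK x₀).contDiffAt (target_mem_nhds hy)

theorem LorentzMetric.contDiffAt (g : LorentzMetric p M)
    (hy : y ∈ (chartAt (Model p) x₀).target) : ContDiffAt ℝ ∞ (chartBilin g.val x₀) y :=
  (g.smooth x₀).contDiffAt (target_mem_nhds hy)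

variable [IsManifold (mdl p) ∞ M]

theorem contDiffAt_coordChange (hy : y ∈ (chartAt (Model p) x₀).target)
    (h : (chartAt (Model p) x₀).symm y ∈ (chartAt (Model p) x₁).source) :
    ContDiffAt ℝ ∞ (coordChange x₁ x₀) y := by
  have h1 : ContMDiffAt (mdl p) (mdl p) ∞ (chartAt (Model p) x₀).symm y :=
    (contMDiffOn_chart_symm (I := mdl p) (n := ∞) (x := x₀)).contMDiffAt (target_mem_nhds hy)
  have h2 : ContMDiffAt (mdl p) (mdl p) ∞ (chartAt (Model p) x₁) ((chartAt (Model p) x₀).symm y) :=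
    (contMDiffOn_chart (I := mdl p) (n := ∞) (x := x₁)).contMDiffAt
      ((chartAt (Model p) x₁).open_source.mem_nhds h)
  exact (h2.comp y h1).contDiffAt

variable (p M) in
theorem isManifold_one : IsManifold (mdl p) 1 M := IsManifold.of_le (n := ∞) (by norm_cast)

theorem chart_mdifferentiable (x : M) :
    (chartAt (Model p) x).MDifferentiable (mdl p) (mdl p) :=
  haveI := isManifold_one p M
  mdifferentiable_chart x

theorem fderiv_coordChange (hy : y ∈ (chartAt (Model p) x₀).target)
    (h : (chartAt (Model p) x₀).symm y ∈ (chartAt (Model p) x₁).source) :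
    (chartFrame x₁ (coordChange x₁ x₀ y)).comp (fderiv ℝ (coordChange x₁ x₀) y) =
      chartFrame x₀ y := by
  have h1 : fderiv ℝ (coordChange x₁ x₀) y =
      (mfderiv (mdl p) (mdl p) (chartAt (Model p) x₁) ((chartAt (Model p) x₀).symm y)).comp
        (mfderiv (mdl p) (mdl p) (chartAt (Model p) x₀).symm y) := by
    rw [← mfderiv_eq_fderiv]
    exact mfderiv_comp y ((chart_mdifferentiable x₁).mdifferentiableAt h)
      ((chart_mdifferentiable x₀).mdifferentiableAt_symm hy)
  have h2 := (chart_mdifferentiable x₁).symm_comp_deriv h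
  rw [h1]
  ext1 u
  exact congrArg (fun T => T (chartFrame x₀ y u)) h2

/-- A tangent vector is stored as its coordinates in the preferred chart at its base point, so the
frame is the derivative of the transition map to that chart. -/
theorem chartFrame_eq (hy : y ∈ (chartAt (Model p) x₀).target) :
    chartFrame x₀ y = fderiv ℝ (coordChange ((chartAt (Model p) x₀).symm y) x₀) y := by
  have h := ((chart_mdifferentiable x₀).mdifferentiableAt_symm hy).mfderiv
  rw [chartFrame, h, ← fderivWithin_univ]
  simp [writtenInExtChartAt, mfld_simps]
  rfl

theorem chartFrame_self (x : M) :
    chartFrame x (chartAt (Model p) x x) = ContinuousLinearMap.id ℝ (Model p) := by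
  rw [chartFrame_eq (mem_target_self x), symm_self]
  have : coordChange x x =ᶠ[nhds (chartAt (Model p) x x)] id := by
    filter_upwards [target_mem_nhds (mem_target_self x)] with z hz
    exact (chartAt (Model p) x).right_inv hz
  rw [this.fderiv_eq, fderiv_id]

/-- The differential of the inverse of a chart, as a linear equivalence. -/
def frameEquiv (x₀ : M) {y : Model p} (hy : y ∈ (chartAt (Model p) x₀).target) :
    Model p ≃L[ℝ] Model p :=
  ContinuousLinearEquiv.equivOfInverse (chartFrame x₀ y)
    (mfderiv (mdl p) (mdl p) (chartAt (Model p) x₀) ((chartAt (Model p) x₀).symm y))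
    (fun u => congrArg (fun T => T u) ((chart_mdifferentiable x₀).comp_symm_deriv hy))
    (fun u => by
      have := (chart_mdifferentiable x₀).symm_comp_deriv
        ((chartAt (Model p) x₀).map_target hy)
      rw [(chartAt (Model p) x₀).right_inv hy] at this
      exact congrArg (fun T => T u) this)

theorem coe_frameEquiv (hy : y ∈ (chartAt (Model p) x₀).target) :
    (frameEquiv x₀ hy : Model p →L[ℝ] Model p) = chartFrame x₀ y := rfl

theorem chartForm_eq (θ : FormField p M k) (hy : y ∈ (chartAt (Model p) x₀).target) :
    chartForm θ x₀ y = pullForm (θ ((chartAt (Model p) x₀).symm y)) (frameEquiv x₀ hy) := rfl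

theorem frameEquiv_chartVec (K : VecField p M) (hy : y ∈ (chartAt (Model p) x₀).target) :
    frameEquiv x₀ hy (chartVec K x₀ y) = K ((chartAt (Model p) x₀).symm y) :=
  (frameEquiv x₀ hy).apply_symm_apply _

theorem chartForm_self (θ : FormField p M k) (x : M) :
    chartForm θ x (chartAt (Model p) x x) = θ x := by
  rw [chartForm, chartFrame_self, symm_self]
  rfl

theorem chartBilin_self (g : BilinField p M) (x : M) :
    chartBilin g x (chartAt (Model p) x x) = g x := by
  rw [chartBilin, chartFrame_self, symm_self]
  rfl

theorem chartForm_coordChange (θ : FormField p M k) (hy : y ∈ (chartAt (Model p) x₀).target)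
    (h : (chartAt (Model p) x₀).symm y ∈ (chartAt (Model p) x₁).source) :
    chartForm θ x₀ y = (chartForm θ x₁ (coordChange x₁ x₀ y)).compContinuousLinearMap
      (fderiv ℝ (coordChange x₁ x₀) y) := by
  rw [chartForm, chartForm, symm_coordChange h, ← fderiv_coordChange hy h]
  rfl

theorem chartVec_coordChange (K : VecField p M) (hy : y ∈ (chartAt (Model p) x₀).target)
    (h : (chartAt (Model p) x₀).symm y ∈ (chartAt (Model p) x₁).source) :
    chartVec K x₁ (coordChange x₁ x₀ y) = fderiv ℝ (coordChange x₁ x₀) y (chartVec K x₀ y) := by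
  apply (frameEquiv x₁ (coordChange_mem h)).injective
  rw [frameEquiv_chartVec, symm_coordChange h, ← frameEquiv_chartVec K hy]
  have := fderiv_coordChange hy h
  exact (congrArg (fun T => T (chartVec K x₀ y)) this).symm

/-- The exterior derivative does not depend on the chart. -/
theorem chartForm_extD {A : FormField p M k} (hA : SmoothForm A)
    (hy : y ∈ (chartAt (Model p) x₀).target) :
    chartForm (extD A) x₀ y = extDeriv (chartForm A x₀) y := by
  set x := (chartAt (Model p) x₀).symm y with hx
  have hs : (chartAt (Model p) x₀).symm y ∈ (chartAt (Model p) x).source :=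
    mem_chart_source (Model p) x
  have h1 : chartForm A x₀ =ᶠ[nhds y] fun z =>
      (chartForm A x (coordChange x x₀ z)).compContinuousLinearMap
        (fderiv ℝ (coordChange x x₀) z) := by
    filter_upwards [target_mem_nhds hy, eventually_symm_mem hy hs] with z hz hz'
    exact chartForm_coordChange A hz hz'
  -- The exterior derivative commutes with pullback along the transition map to the preferred chart
  -- at the given point, where `extD` is computed.
  rw [h1.extDeriv_eq, extDeriv_pullback (r := ∞)
    ((hA.contDiffAt (coordChange_mem hs)).differentiableAt (by simp))
    (contDiffAt_coordChange hy hs) (by simp; norm_cast), ← chartFrame_eq hy]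
  rfl

theorem smoothForm_extD {A : FormField p M k} (hA : SmoothForm A) : SmoothForm (extD A) :=
  fun _ _ hy => ((contDiffAt_extDeriv (hA.contDiffAt hy)).congr_of_eventuallyEq
    (Filter.eventually_of_mem (target_mem_nhds hy) fun _ hz =>
      chartForm_extD hA hz)).contDiffWithinAt

theorem contDiffAt_chart {a : M → ℝ} (ha : ContMDiff (mdl p) 𝓘(ℝ, ℝ) ∞ a)
    (hy : y ∈ (chartAt (Model p) x₀).target) :
    ContDiffAt ℝ ∞ (fun z => a ((chartAt (Model p) x₀).symm z)) y := by
  have h1 : ContMDiffAt (mdl p) (mdl p) ∞ (chartAt (Model p) x₀).symm y :=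
    (contMDiffOn_chart_symm (I := mdl p) (n := ∞) (x := x₀)).contMDiffAt (target_mem_nhds hy)
  exact (ha.contMDiffAt.comp y h1).contDiffAt

theorem grad_comp_chartFrame {a : M → ℝ} (ha : ContMDiff (mdl p) 𝓘(ℝ, ℝ) ∞ a)
    (hy : y ∈ (chartAt (Model p) x₀).target) :
    pullCov (grad a ((chartAt (Model p) x₀).symm y)) (frameEquiv x₀ hy) =
      fderiv ℝ (fun z => a ((chartAt (Model p) x₀).symm z)) y := by
  rw [← mfderiv_eq_fderiv]
  exact (mfderiv_comp y (ha.mdifferentiable (by simp) _)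
    ((chart_mdifferentiable x₀).mdifferentiableAt_symm hy)).symm

end Charts

section Fields

variable {p k : ℕ} {M : Type*} [TopologicalSpace M] [ChartedSpace (Model p) M]

/-! ### The fields in charts -/

theorem LorentzMetric.lorentzian (g : LorentzMetric p M) (x : M) : Lorentzian (g.val x) :=
  ⟨g.symm x, g.signature x⟩

theorem LeviCivita.isVolume {g : LorentzMetric p M} (ε : LeviCivita g) (x : M) :
    IsVolume (g.val x) (ε.val x) := ε.sq x

theorem LeviCivita.timelikeData {g : LorentzMetric p M} (ε : LeviCivita g) {a : M → ℝ}
    (ha : Timelike g a) (x : M) : TimelikeData (g.val x) (ε.val x) (grad a x) :=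
  ⟨g.lorentzian x, ε.isVolume x, ha x⟩

/-- Smoothness is checked on an explicit formula in each chart; the formulas come from the
naturality of the pointwise operations under `frameEquiv`. -/
theorem smoothForm_congr {θ : FormField p M k} {f : M → Model p → Form p k}
    (hf : ∀ (x₀ : M) (y : Model p), y ∈ (chartAt (Model p) x₀).target →
      ContDiffAt ℝ ∞ (f x₀) y ∧ chartForm θ x₀ y = f x₀ y) : SmoothForm θ := fun x₀ y hy =>
  ((hf x₀ y hy).1.congr_of_eventuallyEq (Filter.eventually_of_mem (target_mem_nhds hy)
    fun z hz => (hf x₀ z hz).2)).contDiffWithinAt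

theorem SmoothForm.add {θ θ' : FormField p M k} (h : SmoothForm θ) (h' : SmoothForm θ') :
    SmoothForm fun x => θ x + θ' x :=
  smoothForm_congr fun _ _ hy => ⟨(h.contDiffAt hy).add (h'.contDiffAt hy), rfl⟩

variable [IsManifold (mdl p) ∞ M] {x₀ : M} {y : Model p} (g : LorentzMetric p M)
  (ε : LeviCivita g)

theorem LorentzMetric.lorentzian_chart (hy : y ∈ (chartAt (Model p) x₀).target) :
    Lorentzian (chartBilin g.val x₀ y) :=
  (g.lorentzian _).pull (frameEquiv x₀ hy)

variable {g} in
theorem LeviCivita.isVolume_chart (hy : y ∈ (chartAt (Model p) x₀).target) :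
    IsVolume (chartBilin g.val x₀ y) (chartForm ε.val x₀ y) :=
  (ε.isVolume _).pull (frameEquiv x₀ hy)

theorem SmoothForm.fun_smul {θ : FormField p M k} (h : SmoothForm θ) {f : M → ℝ}
    (hf : ContMDiff (mdl p) 𝓘(ℝ, ℝ) ∞ f) : SmoothForm fun x => f x • θ x :=
  smoothForm_congr fun _ _ hy => ⟨(contDiffAt_chart hf hy).smul (h.contDiffAt hy), rfl⟩

variable {a : M → ℝ}

theorem contDiffAt_grad (ha : ContMDiff (mdl p) 𝓘(ℝ, ℝ) ∞ a)
    (hy : y ∈ (chartAt (Model p) x₀).target) :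
    ContDiffAt ℝ ∞ (fun y => fderiv ℝ (fun z => a ((chartAt (Model p) x₀).symm z)) y) y :=
  (contDiffAt_chart ha hy).fderiv_right (m := ∞) (by norm_cast)

theorem covecSq_chart (ha : ContMDiff (mdl p) 𝓘(ℝ, ℝ) ∞ a)
    (hy : y ∈ (chartAt (Model p) x₀).target) :
    covecSq (chartBilin g.val x₀ y) (fderiv ℝ (fun z => a ((chartAt (Model p) x₀).symm z)) y) =
      covecSq (g.val ((chartAt (Model p) x₀).symm y))
        (grad a ((chartAt (Model p) x₀).symm y)) := by
  rw [← grad_comp_chartFrame ha hy]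
  exact covecSq_pull (frameEquiv x₀ hy) (g.lorentzian _).nonDeg _

theorem gradNorm_chart (ha : ContMDiff (mdl p) 𝓘(ℝ, ℝ) ∞ a)
    (hy : y ∈ (chartAt (Model p) x₀).target) :
    gradNorm (chartBilin g.val x₀ y) (fderiv ℝ (fun z => a ((chartAt (Model p) x₀).symm z)) y) =
      gradNorm (g.val ((chartAt (Model p) x₀).symm y))
        (grad a ((chartAt (Model p) x₀).symm y)) := by
  rw [gradNorm, gradNorm, covecSq_chart g ha hy]

theorem covecSq_chart_neg (ha : ContMDiff (mdl p) 𝓘(ℝ, ℝ) ∞ a) (hat : Timelike g a)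
    (hy : y ∈ (chartAt (Model p) x₀).target) :
    covecSq (chartBilin g.val x₀ y)
      (fderiv ℝ (fun z => a ((chartAt (Model p) x₀).symm z)) y) < 0 := by
  rw [covecSq_chart g ha hy]
  exact hat _

theorem contDiffAt_gradNorm_chart (ha : ContMDiff (mdl p) 𝓘(ℝ, ℝ) ∞ a) (hat : Timelike g a)
    (hy : y ∈ (chartAt (Model p) x₀).target) :
    ContDiffAt ℝ ∞ (fun y => gradNorm (g.val ((chartAt (Model p) x₀).symm y))
        (grad a ((chartAt (Model p) x₀).symm y))) y :=
  (contDiffAt_gradNorm (g.contDiffAt hy) (g.lorentzian_chart hy).nonDeg (contDiffAt_grad ha hy)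
    (covecSq_chart_neg g ha hat hy)).congr_of_eventuallyEq
      (Filter.eventually_of_mem (target_mem_nhds hy) fun _ hz => (gradNorm_chart g ha hz).symm)

theorem SmoothForm.inv_gradNorm_smul {θ : FormField p M k} (h : SmoothForm θ)
    (ha : ContMDiff (mdl p) 𝓘(ℝ, ℝ) ∞ a) (hat : Timelike g a) :
    SmoothForm fun x => (gradNorm (g.val x) (grad a x))⁻¹ • θ x :=
  smoothForm_congr fun _ _ hy => ⟨((contDiffAt_gradNorm_chart g ha hat hy).inv
    (gradNorm_pos (hat _)).ne').smul (h.contDiffAt hy), rfl⟩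

variable {g}

theorem chartForm_fieldW (ha : ContMDiff (mdl p) 𝓘(ℝ, ℝ) ∞ a) (F L : FormField p M (p + 1))
    (hy : y ∈ (chartAt (Model p) x₀).target) :
    chartForm (fun x => fieldW (g.val x) (ε.val x) (F x) (grad a x) (L x)) x₀ y =
      fieldW (chartBilin g.val x₀ y) (chartForm ε.val x₀ y) (chartForm F x₀ y)
        (fderiv ℝ (fun z => a ((chartAt (Model p) x₀).symm z)) y) (chartForm L x₀ y) := by
  rw [← grad_comp_chartFrame ha hy]
  exact (fieldW_pull (frameEquiv x₀ hy) (g.lorentzian _).nonDeg _ _ _ _).symm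

theorem smoothForm_fieldW (ha : ContMDiff (mdl p) 𝓘(ℝ, ℝ) ∞ a) (hat : Timelike g a)
    {F L : FormField p M (p + 1)} (hF : SmoothForm F) (hL : SmoothForm L) :
    SmoothForm fun x => fieldW (g.val x) (ε.val x) (F x) (grad a x) (L x) :=
  smoothForm_congr fun _ _ hy => ⟨contDiffAt_fieldW (g.contDiffAt hy)
    (g.lorentzian_chart hy).nonDeg (ε.smooth.contDiffAt hy) (contDiffAt_grad ha hy)
    (covecSq_chart_neg g ha hat hy) (hF.contDiffAt hy) (hL.contDiffAt hy),
    chartForm_fieldW ε ha F L hy⟩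

theorem chartForm_wedgeLast (ha : ContMDiff (mdl p) 𝓘(ℝ, ℝ) ∞ a) (B : FormField p M k)
    (hy : y ∈ (chartAt (Model p) x₀).target) :
    chartForm (fun x => wedgeLast (B x) (grad a x)) x₀ y =
      wedgeLast (chartForm B x₀ y)
        (fderiv ℝ (fun z => a ((chartAt (Model p) x₀).symm z)) y) := by
  rw [← grad_comp_chartFrame ha hy]
  exact (wedgeLast_pull (frameEquiv x₀ hy) _ _).symm

theorem SmoothForm.wedgeLast_grad (ha : ContMDiff (mdl p) 𝓘(ℝ, ℝ) ∞ a)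
    {B : FormField p M k} (hB : SmoothForm B) :
    SmoothForm fun x => wedgeLast (B x) (grad a x) :=
  smoothForm_congr fun _ _ hy => ⟨contDiffAt_wedgeLast (hB.contDiffAt hy) (contDiffAt_grad ha hy),
    chartForm_wedgeLast ha B hy⟩

theorem chartForm_covWedge (hp : 0 < p) (ha : ContMDiff (mdl p) 𝓘(ℝ, ℝ) ∞ a)
    (ψ : FormField p M (p - 1)) (hy : y ∈ (chartAt (Model p) x₀).target) :
    chartForm (fun x => covWedge hp (fun μ => grad a x (e μ)) (ψ x)) x₀ y =
      covWedge hp (fun μ => fderiv ℝ (fun z => a ((chartAt (Model p) x₀).symm z)) y (e μ))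
        (chartForm ψ x₀ y) := by
  rw [← grad_comp_chartFrame ha hy]
  exact (covWedge_pull (frameEquiv x₀ hy) hp _ _).symm

theorem SmoothForm.covWedge_grad (hp : 0 < p) (ha : ContMDiff (mdl p) 𝓘(ℝ, ℝ) ∞ a)
    {ψ : FormField p M (p - 1)} (hψ : SmoothForm ψ) :
    SmoothForm fun x => covWedge hp (fun μ => grad a x (e μ)) (ψ x) :=
  smoothForm_congr fun _ _ hy => ⟨contDiffAt_covWedge hp (contDiffAt_grad ha hy)
    (hψ.contDiffAt hy), chartForm_covWedge hp ha ψ hy⟩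

theorem chartForm_dual (F : FormField p M (p + 1)) (hy : y ∈ (chartAt (Model p) x₀).target) :
    chartForm (fun x => dual (g.val x) (ε.val x) (F x)) x₀ y =
      dual (chartBilin g.val x₀ y) (chartForm ε.val x₀ y) (chartForm F x₀ y) :=
  (dual_pull (frameEquiv x₀ hy) (g.lorentzian _).nonDeg _ _).symm

theorem SmoothForm.dual {F : FormField p M (p + 1)} (hF : SmoothForm F) :
    SmoothForm fun x => dual (g.val x) (ε.val x) (F x) :=
  smoothForm_congr fun _ _ hy => ⟨contDiffAt_dual (g.contDiffAt hy)
    (g.lorentzian_chart hy).nonDeg (ε.smooth.contDiffAt hy) (hF.contDiffAt hy),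
    chartForm_dual ε F hy⟩

theorem chartForm_contractLast (ha : ContMDiff (mdl p) 𝓘(ℝ, ℝ) ∞ a) (θ : FormField p M (k + 1))
    (hy : y ∈ (chartAt (Model p) x₀).target) :
    chartForm (fun x => contractLast (θ x) (unitVec (g.val x) (grad a x))) x₀ y =
      contractLast (chartForm θ x₀ y) (unitVec (chartBilin g.val x₀ y)
        (fderiv ℝ (fun z => a ((chartAt (Model p) x₀).symm z)) y)) := by
  rw [← grad_comp_chartFrame ha hy]
  have h := unitVec_pull (frameEquiv x₀ hy) (g.lorentzian ((chartAt (Model p) x₀).symm y)).nonDeg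
    (grad a ((chartAt (Model p) x₀).symm y))
  rw [chartForm_eq _ hy, chartForm_eq _ hy, ← h, contractLast_pull]
  rfl

theorem SmoothForm.contractLast_unitVec (ha : ContMDiff (mdl p) 𝓘(ℝ, ℝ) ∞ a)
    (hat : Timelike g a) {θ : FormField p M (k + 1)} (hθ : SmoothForm θ) :
    SmoothForm fun x => contractLast (θ x) (unitVec (g.val x) (grad a x)) :=
  smoothForm_congr fun _ _ hy => ⟨contDiffAt_contractLast (hθ.contDiffAt hy) (contDiffAt_unitVec
    (g.contDiffAt hy) (g.lorentzian_chart hy).nonDeg (contDiffAt_grad ha hy)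
    (covecSq_chart_neg g ha hat hy)), chartForm_contractLast ha θ hy⟩

theorem smoothForm_selfDualExt (ha : ContMDiff (mdl p) 𝓘(ℝ, ℝ) ∞ a) (hat : Timelike g a)
    {B : FormField p M p} (hB : SmoothForm B) :
    SmoothForm fun x => selfDualExt (g.val x) (ε.val x) (grad a x) (B x) := by
  have h1 := (hB.inv_gradNorm_smul g ha hat).wedgeLast_grad ha
  have h2 := h1.add (h1.dual ε)
  convert h2 using 2 with x
  -- The normalisation of v is moved onto B, so that only the exterior product with ∂a itself is
  -- needed.
  rw [selfDualExt_eq (g.lorentzian x).nonDeg, unitForm, wedgeLast_smul_right, wedgeLast_smul_left]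

/-! ### Currents -/

theorem chartVec_current (B : FormField p M p) (X : FormField p M (p + 1)) (r : ℝ)
    (hy : y ∈ (chartAt (Model p) x₀).target) :
    chartVec (fun x => r • current (g.val x) (ε.val x) (B x) (X x)) x₀ y =
      r • current (chartBilin g.val x₀ y) (chartForm ε.val x₀ y) (chartForm B x₀ y)
        (chartForm X x₀ y) := by
  apply (frameEquiv x₀ hy).injective
  rw [frameEquiv_chartVec, map_smul]
  congr 1
  exact (current_pull (frameEquiv x₀ hy) (g.lorentzian _).nonDeg _ _ _).symm

theorem smoothVec_current {B : FormField p M p} {X : FormField p M (p + 1)} (hB : SmoothForm B)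
    (hX : SmoothForm X) (r : ℝ) :
    SmoothVec fun x => r • current (g.val x) (ε.val x) (B x) (X x) := fun _ _ hy =>
  (((contDiffAt_current (g.contDiffAt hy) (g.lorentzian_chart hy).nonDeg
    (ε.smooth.contDiffAt hy) (hB.contDiffAt hy) (hX.contDiffAt hy)).const_smul
      r).congr_of_eventuallyEq (Filter.eventually_of_mem (target_mem_nhds hy)
        fun _ hz => chartVec_current ε B X r hz)).contDiffWithinAt

theorem divergence_current_field (hp : Even p) {B : FormField p M p} {X : FormField p M (p + 1)}
    (hB : SmoothForm B) (hX : SmoothForm X) (r : ℝ) (x : M) :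
    divergence g (fun x => r • current (g.val x) (ε.val x) (B x) (X x)) x =
      r * (pairing (g.val x) (ε.val x) (extDeriv (chartForm B x) (chartAt (Model p) x x)) (X x) +
        ∑ ρ, pairing (g.val x) (ε.val x) (wedgeLast (B x) (dx ρ))
          (fderiv ℝ (chartForm X x) (chartAt (Model p) x x) (e ρ))) := by
  have hy := mem_target_self (p := p) x
  have h := divergence_current (y := chartAt (Model p) x x) hp
    (g := chartBilin g.val x) (ε := chartForm ε.val x) (B := chartForm B x) (X := chartForm X x)
    (Filter.eventually_of_mem (target_mem_nhds hy) fun z hz =>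
      ⟨g.lorentzian_chart hz, ε.isVolume_chart hz⟩)
    (ε.smooth.contDiffAt hy).continuousAt ((hB.contDiffAt hy).differentiableAt (by simp))
    ((hX.contDiffAt hy).differentiableAt (by simp)) r
  rw [chartBilin_self, chartForm_self, chartForm_self, chartForm_self] at h
  rw [← h, divergence, sqrtDet, chartBilin_self]
  congr 1
  refine Finset.sum_congr rfl fun μ _ => ?_
  have he : (fun y : Model p => sqrtDet g x y *
      chartVec (fun x => r • current (g.val x) (ε.val x) (B x) (X x)) x y μ) =ᶠ[nhds
        (chartAt (Model p) x x)] fun z => √|(gram (chartBilin g.val x z)).det| *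
      (r • current (chartBilin g.val x z) (chartForm ε.val x z) (chartForm B x z)
        (chartForm X x z)) μ :=
    Filter.eventually_of_mem (target_mem_nhds hy) fun z hz => by
      simp only [chartVec_current ε B X r hz, sqrtDet]
  rw [he.fderiv_eq]

end Fields

section Variation

variable {p k : ℕ} {M : Type*} [TopologicalSpace M] [ChartedSpace (Model p) M]
  {g : LorentzMetric p M} (ε : LeviCivita g) {Φ : Config p M}

/-! ### Variation of the Lagrangian -/

/-- The field `((E - B) + 2 (B + λ)) / √(-∂a·∂a)`. -/
def fieldY {g : LorentzMetric p M} (ε : LeviCivita g) (Φ : Config p M) : FormField p M p :=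
  fun x => (gradNorm (g.val x) (grad Φ.a x))⁻¹ •
    fieldW (g.val x) (ε.val x) (extD Φ.A x) (grad Φ.a x) (Φ.L x)

/-- The boundary current of the transformation with scalar parameter. -/
def currentPhi {g : LorentzMetric p M} (ε : LeviCivita g) (Φ : Config p M) (φ : M → ℝ) :
    VecField p M :=
  fun x => (-(1 / (2 * ((p + 1).factorial : ℝ)))) • current (g.val x) (ε.val x)
    ((deltaPhi g ε Φ φ).A x) (extD Φ.A x + wedgeLast (fieldY ε Φ x) (grad Φ.a x))

/-- The boundary current of the transformation whose parameter is a form. -/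
def currentPsi {g : LorentzMetric p M} (ε : LeviCivita g) (Φ : Config p M) (hp : 0 < p)
    (ψ : FormField p M (p - 1)) : VecField p M :=
  fun x => (-(1 / (2 * ((p + 1).factorial : ℝ)))) • current (g.val x) (ε.val x)
    ((deltaPsi g Φ hp ψ).A x) (extD Φ.A x)

theorem deltaPhi_A (φ : M → ℝ) (x : M) :
    (deltaPhi g ε Φ φ).A x = -(φ x) • fieldY ε Φ x := by
  rw [fieldY, smul_smul, neg_mul, ← div_eq_mul_inv]
  rfl

/-- Moving the normalisation from v to ψ exhibits δA as an exterior product with the closed covector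
∂a, which is what the vanishing of ⟨W∧v,dδA⟩ requires. -/
theorem deltaPsi_A (hp : 0 < p) (ψ : FormField p M (p - 1)) (x : M) :
    (deltaPsi g Φ hp ψ).A x = covWedge hp (fun μ => grad Φ.a x (e μ))
      ((gradNorm (g.val x) (grad Φ.a x))⁻¹ • ψ x) := by
  rw [covWedge_smul_right, ← covWedge_smul_left]
  change covWedge hp (unitCov (g.val x) (grad Φ.a x)) (ψ x) = _
  congr 1
  ext μ
  rw [unitCov_eq, unitForm]

theorem extD_add_smul {A δA : FormField p M k} (hA : SmoothForm A) (hδ : SmoothForm δA) (s : ℝ)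
    (x : M) : extD (fun x => A x + s • δA x) x = extD A x + s • extD δA x := by
  have hy := mem_target_self (p := p) x
  have h1 := (hA.contDiffAt hy).differentiableAt (by simp)
  have h2 := (hδ.contDiffAt hy).differentiableAt (by simp)
  have h3 : chartForm (fun x => A x + s • δA x) x =
      fun z => chartForm A x z + s • chartForm δA x z := rfl
  rw [extD, h3, extDeriv_fun_add h1 (h2.fun_const_smul s)]
  exact congrArg _ (extDeriv_fun_smul s (chartForm δA x))

variable [IsManifold (mdl p) ∞ M] {x₀ : M} {y : Model p}

theorem grad_eq_fderiv {a : M → ℝ} (ha : ContMDiff (mdl p) 𝓘(ℝ, ℝ) ∞ a) (x : M) :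
    grad a x = fderiv ℝ (fun z => a ((chartAt (Model p) x).symm z)) (chartAt (Model p) x x) := by
  rw [← grad_comp_chartFrame ha (mem_target_self x), symm_self, pullCov, coe_frameEquiv,
    chartFrame_self]
  rfl

theorem grad_add_mul {a φ : M → ℝ} (ha : ContMDiff (mdl p) 𝓘(ℝ, ℝ) ∞ a)
    (hφ : ContMDiff (mdl p) 𝓘(ℝ, ℝ) ∞ φ) (s : ℝ) (x : M) :
    grad (p := p) (fun x => a x + s * φ x) x = grad a x + s • grad φ x := by
  have hy := mem_target_self (p := p) x
  have h1 := (contDiffAt_chart ha hy).differentiableAt (by simp)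
  have h2 := (contDiffAt_chart hφ hy).differentiableAt (by simp)
  have h3 : ContMDiff (mdl p) 𝓘(ℝ, ℝ) ∞ fun x => a x + s * φ x := ha.add (contMDiff_const.mul hφ)
  rw [grad_eq_fderiv h3, grad_eq_fderiv ha, grad_eq_fderiv hφ]
  rw [fderiv_fun_add h1 (h2.const_mul s), fderiv_const_mul h2]

/-- The Lagrangian of a varied configuration. -/
theorem lagINZ_vary {δΦ : Config p M} (hA : SmoothForm Φ.A) (hδA : SmoothForm δΦ.A)
    (ha : ContMDiff (mdl p) 𝓘(ℝ, ℝ) ∞ Φ.a) (hδa : ContMDiff (mdl p) 𝓘(ℝ, ℝ) ∞ δΦ.a)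
    (V : Interaction p M) (s : ℝ) (x : M) :
    lagINZ g ε (Φ.vary δΦ s) V x =
      lagAlg (g.val x) (ε.val x) (extD Φ.A x + s • extD δΦ.A x) (grad Φ.a x + s • grad δΦ.a x)
        (Φ.L x + s • δΦ.L x) - V x (Φ.L x + s • δΦ.L x) (g.val x) := by
  rw [← extD_add_smul hA hδA, ← grad_add_mul ha hδa]
  rfl

variable (hp : Even p) (hA : SmoothForm Φ.A) (ha : ContMDiff (mdl p) 𝓘(ℝ, ℝ) ∞ Φ.a)
  (hat : Timelike g Φ.a) (hL : SmoothForm Φ.L) (hsd : SelfDual g ε Φ.L)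

include hA ha hat hL in
theorem smoothForm_fieldY : SmoothForm (fieldY ε Φ) :=
  (smoothForm_fieldW ε ha hat (smoothForm_extD hA) hL).inv_gradNorm_smul g ha hat

include hA ha hat hL in
theorem smoothForm_deltaPhi {φ : M → ℝ} (hφ : ContMDiff (mdl p) 𝓘(ℝ, ℝ) ∞ φ) :
    SmoothForm (deltaPhi g ε Φ φ).A := by
  have := (smoothForm_fieldY ε hA ha hat hL).fun_smul hφ.neg
  convert this using 2 with x
  exact deltaPhi_A ε φ x

include ha hat in
theorem smoothForm_deltaPsi (hp : 0 < p) {ψ : FormField p M (p - 1)} (hψ : SmoothForm ψ) :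
    SmoothForm (deltaPsi g Φ hp ψ).A := by
  have := (hψ.inv_gradNorm_smul g ha hat).covWedge_grad hp ha
  convert this using 2 with x
  exact deltaPsi_A hp ψ x

theorem fderiv_fderiv_symm {a : M → ℝ} (ha : ContMDiff (mdl p) 𝓘(ℝ, ℝ) ∞ a)
    (hy : y ∈ (chartAt (Model p) x₀).target) (u w : Model p) :
    fderiv ℝ (fun y => fderiv ℝ (fun z => a ((chartAt (Model p) x₀).symm z)) y) y u w =
      fderiv ℝ (fun y => fderiv ℝ (fun z => a ((chartAt (Model p) x₀).symm z)) y) y w u :=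
  ((contDiffAt_chart ha hy).isSymmSndFDerivAt (by simp; norm_cast)).eq u w

include hp hA ha hat hL hsd in
/-- The variation of the Lagrangian under the transformation with scalar parameter. -/
theorem hasDerivAt_lagINZ_deltaPhi (V : Interaction p M) {φ : M → ℝ}
    (hφ : ContMDiff (mdl p) 𝓘(ℝ, ℝ) ∞ φ) (x : M) :
    HasDerivAt (fun s : ℝ => lagINZ g ε (Φ.vary (deltaPhi g ε Φ φ) s) V x)
      (divergence g (currentPhi ε Φ φ) x) 0 := by
  have hδ := smoothForm_deltaPhi ε hA ha hat hL hφ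
  have hY := smoothForm_fieldY ε hA ha hat hL
  have hy := mem_target_self (p := p) x
  have h1 := (ε.timelikeData hat x).hasDerivAt_lagAlg hp (extD Φ.A x)
    (extD (deltaPhi g ε Φ φ).A x) (grad φ x) (hsd x)
  have hX : SmoothForm fun x => extD Φ.A x + wedgeLast (fieldY ε Φ x) (grad Φ.a x) :=
    (smoothForm_extD hA).add (hY.wedgeLast_grad ha)
  have h2 := divergence_current_field ε hp hδ hX (-(1 / (2 * ((p + 1).factorial : ℝ)))) x
  have h3 := variation_scalar hp (g.lorentzian x).nonDeg (ε.val x) (hA.contDiffAt hy)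
    ((hY.contDiffAt hy).differentiableAt (by simp))
    ((contDiffAt_chart hφ hy).differentiableAt (by simp))
    ((contDiffAt_grad ha hy).differentiableAt (by simp)) (fderiv_fderiv_symm ha hy)
  have hδc : chartForm (deltaPhi g ε Φ φ).A x = fun z =>
      -(φ ((chartAt (Model p) x).symm z)) • chartForm (fieldY ε Φ) x z := by
    rw [show (deltaPhi g ε Φ φ).A = fun x => -(φ x) • fieldY ε Φ x from
      funext fun x => deltaPhi_A ε φ x]
    rfl
  have hXc : chartForm (fun x => extD Φ.A x + wedgeLast (fieldY ε Φ x) (grad Φ.a x)) x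
      =ᶠ[nhds (chartAt (Model p) x x)] fun z => extDeriv (chartForm Φ.A x) z +
        wedgeLast (chartForm (fieldY ε Φ) x z)
          (fderiv ℝ (fun z => Φ.a ((chartAt (Model p) x).symm z)) z) :=
    Filter.eventually_of_mem (target_mem_nhds hy) fun z hz => by
      have := chartForm_wedgeLast ha (fieldY ε Φ) hz
      simp only
      rw [← chartForm_extD hA hz, ← this]
      rfl
  -- The factor -1/(2(p+1)!) in the current is the -½ of `variation_scalar` times the 1/(p+1)! of
  -- the first variation; W∧v is rewritten as Y∧∂a.
  have hval : divergence g (currentPhi ε Φ φ) x = 1 / ((p + 1).factorial : ℝ) *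
      (1 / 2 * pairing (g.val x) (ε.val x) (extD Φ.A x) (extD (deltaPhi g ε Φ φ).A x) +
        pairing (g.val x) (ε.val x) (wedgeLast (fieldW (g.val x) (ε.val x) (extD Φ.A x)
          (grad Φ.a x) (Φ.L x)) (unitForm (g.val x) (grad Φ.a x)))
          (extD (deltaPhi g ε Φ φ).A x) -
        1 / 2 * pairing (g.val x) (ε.val x)
          (wedgeLast (fieldY ε Φ x) (grad φ x)) (wedgeLast (fieldY ε Φ x) (grad Φ.a x))) := by
    refine h2.trans ?_
    rw [hXc.fderiv_eq, hδc]
    rw [chartForm_self, symm_self, ← grad_eq_fderiv ha, ← grad_eq_fderiv hφ] at h3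
    rw [unitForm, wedgeLast_smul_right, ← wedgeLast_smul_left]
    have h4 : extD (deltaPhi g ε Φ φ).A x = extDeriv (fun z =>
        -(φ ((chartAt (Model p) x).symm z)) • chartForm (fieldY ε Φ) x z)
          (chartAt (Model p) x x) := by rw [extD, hδc]
    rw [h4]
    change _ = 1 / ((p + 1).factorial : ℝ) *
      (1 / 2 * pairing (g.val x) (ε.val x) (extDeriv (chartForm Φ.A x) (chartAt (Model p) x x)) _ +
        pairing (g.val x) (ε.val x) (wedgeLast (fieldY ε Φ x) _) _ - _)
    rw [h3, deltaPhi_A]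
    have : ((p + 1).factorial : ℝ) ≠ 0 := by positivity
    rw [extD]
    field_simp
  rw [hval]
  refine (h1.sub_const (V x (Φ.L x) (g.val x))).congr_of_eventuallyEq
    (Filter.Eventually.of_forall fun s => ?_)
  simp only
  rw [lagINZ_vary ε hA hδ ha hφ]
  simp [deltaPhi]

include hp hA ha hat hsd in
/-- The variation of the Lagrangian under the transformation whose parameter is a form. -/
theorem hasDerivAt_lagINZ_deltaPsi (hp0 : 0 < p) (V : Interaction p M)
    {ψ : FormField p M (p - 1)} (hψ : SmoothForm ψ) (x : M) :
    HasDerivAt (fun s : ℝ => lagINZ g ε (Φ.vary (deltaPsi g Φ hp0 ψ) s) V x)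
      (divergence g (currentPsi ε Φ hp0 ψ) x) 0 := by
  have hδ := smoothForm_deltaPsi ha hat hp0 hψ
  have hy := mem_target_self (p := p) x
  have hn := (g.lorentzian x).nonDeg
  have h1 := (ε.timelikeData hat x).hasDerivAt_lagAlg hp (extD Φ.A x)
    (extD (deltaPsi g Φ hp0 ψ).A x) 0 (hsd x)
  have h2 := divergence_current_field ε hp hδ (smoothForm_extD hA)
    (-(1 / (2 * ((p + 1).factorial : ℝ)))) x
  have hχ := hψ.inv_gradNorm_smul g ha hat
  have hδc : chartForm (deltaPsi g Φ hp0 ψ).A x =ᶠ[nhds (chartAt (Model p) x x)] fun z =>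
      covWedge hp0 (fun μ => fderiv ℝ (fun z => Φ.a ((chartAt (Model p) x).symm z)) z (e μ))
        (chartForm (fun x => (gradNorm (g.val x) (grad Φ.a x))⁻¹ • ψ x) x z) :=
    Filter.eventually_of_mem (target_mem_nhds hy) fun z hz => by
      simp only
      rw [← chartForm_covWedge hp0 ha _ hz]
      congr 1
      exact funext fun x => deltaPsi_A hp0 ψ x
  have h3 := pairing_extDeriv_covWedge hp hp0 hn (ε.val x)
    (fieldW (g.val x) (ε.val x) (extD Φ.A x) (grad Φ.a x) (Φ.L x))
    ((hχ.contDiffAt hy).differentiableAt (by simp))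
    ((contDiffAt_grad ha hy).differentiableAt (by simp)) (fderiv_fderiv_symm ha hy)
  rw [← hδc.extDeriv_eq, ← grad_eq_fderiv ha] at h3
  have hFc : chartForm (extD Φ.A) x =ᶠ[nhds (chartAt (Model p) x x)]
      extDeriv (chartForm Φ.A x) :=
    Filter.eventually_of_mem (target_mem_nhds hy) fun z hz => chartForm_extD hA hz
  -- Since dF = 0, only ⟨dδA,F⟩ is left in the divergence; antisymmetry of the pairing turns the
  -- factor -½ into +½.
  have hval : divergence g (currentPsi ε Φ hp0 ψ) x = 1 / ((p + 1).factorial : ℝ) *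
      (1 / 2 * pairing (g.val x) (ε.val x) (extD Φ.A x) (extD (deltaPsi g Φ hp0 ψ).A x)) := by
    refine h2.trans ?_
    rw [hFc.fderiv_eq, sum_pairing_fderiv_extDeriv hp hn _ _ (hA.contDiffAt hy), add_zero,
      pairing_comm hp hn _ (extD Φ.A x)]
    have : ((p + 1).factorial : ℝ) ≠ 0 := by positivity
    simp only [extD]
    field_simp
  rw [hval]
  refine ((h1.sub_const (V x (Φ.L x) (g.val x))).congr_of_eventuallyEq
    (Filter.Eventually.of_forall fun s => ?_)).congr_deriv ?_
  · simp only
    rw [lagINZ_vary ε hA hδ ha contMDiff_const]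
    have h0 : grad (p := p) (deltaPsi g Φ hp0 ψ).a x = 0 := mfderiv_const
    rw [h0]
    simp [deltaPsi]
  · have h4 : wedgeLast (fieldW (g.val x) (ε.val x) (extD Φ.A x) (grad Φ.a x) (Φ.L x))
        (unitForm (g.val x) (grad Φ.a x)) = (gradNorm (g.val x) (grad Φ.a x))⁻¹ •
        wedgeLast (fieldW (g.val x) (ε.val x) (extD Φ.A x) (grad Φ.a x) (Φ.L x))
          (grad Φ.a x) := wedgeLast_smul_right _ _ _
    have h5 : ∀ B : Form p p, wedgeLast B (0 : Model p →L[ℝ] ℝ) = 0 := fun B => by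
      simpa using wedgeLast_smul_right 0 B 0
    have h6 : ∀ X, pairing (g.val x) (ε.val x) 0 X = 0 := fun X => by
      simpa using pairing_smul_left (g.val x) (ε.val x) 0 0 X
    rw [h4, pairing_smul_left, h5, h6]
    change _ * (_ + _ * pairing (g.val x) (ε.val x) _ (extDeriv _ _) - _) = _
    rw [h3]
    simp

end Variation

section Measure

open MeasureTheory

variable {p k : ℕ} {M : Type*} [TopologicalSpace M] [ChartedSpace (Model p) M]

/-! ### The volume measure -/

theorem measurableSet_target_inter_preimage [MeasurableSpace M] [BorelSpace M] (x₀ : M)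
    {s : Set M} (hs : MeasurableSet s) :
    MeasurableSet ((chartAt (Model p) x₀).target ∩ (chartAt (Model p) x₀).symm ⁻¹' s) := by
  have hc : Continuous ((chartAt (Model p) x₀).target.domRestrict (chartAt (Model p) x₀).symm) :=
    continuousOn_iff_continuous_domRestrict.1 (chartAt (Model p) x₀).continuousOn_symm
  have := ((chartAt (Model p) x₀).open_target.measurableSet).subtype_image (hc.measurable hs)
  convert this using 1
  ext y
  simp [Set.domRestrict, and_comm]

theorem aemeasurable_chart_symm [MeasurableSpace M] [BorelSpace M] (g : LorentzMetric p M)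
    (x₀ : M) : AEMeasurable (chartAt (Model p) x₀).symm
      (((volume : Measure (Model p)).restrict (chartAt (Model p) x₀).target).withDensity
        fun y => ENNReal.ofReal (sqrtDet g x₀ y)) :=
  ((chartAt (Model p) x₀).continuousOn_symm.aemeasurable
    (chartAt (Model p) x₀).open_target.measurableSet).mono_ac (withDensity_absolutelyContinuous _ _)

theorem chartMeasure_apply [MeasurableSpace M] [BorelSpace M] (g : LorentzMetric p M) (x₀ : M)
    {s : Set M} (hs : MeasurableSet s) :
    chartMeasure g x₀ s =
      ∫⁻ y in (chartAt (Model p) x₀).target ∩ (chartAt (Model p) x₀).symm ⁻¹' s,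
        ENNReal.ofReal (sqrtDet g x₀ y) := by
  rw [chartMeasure, Measure.map_apply_of_aemeasurable (aemeasurable_chart_symm g x₀) hs,
    withDensity_apply', Measure.restrict_restrict' (chartAt (Model p) x₀).open_target.measurableSet,
    Set.inter_comm]

variable [IsManifold (mdl p) ∞ M] {x₀ x₁ : M} {y : Model p} {g : LorentzMetric p M}

/-- With √(-g) written as the absolute value of a component of ε, its transformation law becomes
that of a top form. -/
theorem sqrtDet_eq (ε : LeviCivita g) (hy : y ∈ (chartAt (Model p) x₀).target) :
    sqrtDet g x₀ y = |chartForm ε.val x₀ y e| := by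
  rw [sqrtDet, ← (ε.isVolume_chart hy).sq_e, Real.sqrt_sq_eq_abs]

variable (g) in
theorem sqrtDet_pos (hy : y ∈ (chartAt (Model p) x₀).target) : 0 < sqrtDet g x₀ y :=
  Real.sqrt_pos.2 (abs_pos.2 (g.lorentzian_chart hy).nonDeg.det_ne)

theorem volume_comp_eq_det (η : Form p (p + 1 + (p + 1))) (T : Model p →L[ℝ] Model p) :
    η (fun i => T (e i)) = T.det * η e := by
  rw [map_eq_det, mul_comm, ContinuousLinearMap.det,
    ← LinearMap.det_toMatrix (EuclideanSpace.basisFun (Idx p) ℝ).toBasis, ← Matrix.det_transpose]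
  congr 2

theorem sqrtDet_coordChange (ε : LeviCivita g) (hy : y ∈ (chartAt (Model p) x₀).target)
    (h : (chartAt (Model p) x₀).symm y ∈ (chartAt (Model p) x₁).source) :
    sqrtDet g x₀ y =
      |(fderiv ℝ (coordChange x₁ x₀) y).det| * sqrtDet g x₁ (coordChange x₁ x₀ y) := by
  rw [sqrtDet_eq ε hy, sqrtDet_eq ε (coordChange_mem h), ← abs_mul, ← volume_comp_eq_det,
    chartForm_coordChange ε.val hy h]
  rfl

theorem contDiffAt_sqrtDet (g : LorentzMetric p M) (hy : y ∈ (chartAt (Model p) x₀).target) :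
    ContDiffAt ℝ ∞ (sqrtDet g x₀) y := by
  have h : ContDiffAt ℝ ∞ (fun y => √(-(gram (chartBilin g.val x₀ y)).det)) y :=
    (contDiffAt_det (contDiffAt_gram (g.contDiffAt hy))).neg.sqrt
      (by simpa using (g.lorentzian_chart hy).nonDeg.det_ne)
  refine h.congr_of_eventuallyEq (Filter.eventually_of_mem (target_mem_nhds hy) fun z hz => ?_)
  rw [sqrtDet, abs_of_neg (g.lorentzian_chart hz).det_gram_neg]

theorem continuousOn_sqrtDet (g : LorentzMetric p M) (x₀ : M) :
    ContinuousOn (sqrtDet g x₀) (chartAt (Model p) x₀).target := fun _ hy =>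
  (contDiffAt_sqrtDet g hy).continuousAt.continuousWithinAt

variable [MeasurableSpace M] [BorelSpace M]

/-- Change of variables along the transition map: √(-g) absorbs the Jacobian. An inequality
suffices, because the volume measure is a supremum. -/
theorem chartMeasure_inter_source_le (ε : LeviCivita g) (x₀ x₁ : M) {s : Set M}
    (hs : MeasurableSet s) :
    chartMeasure g x₁ (s ∩ (chartAt (Model p) x₀).source) ≤ chartMeasure g x₀ s := by
  have hs0 := (chartAt (Model p) x₀).open_source.measurableSet
  have hs1 := (chartAt (Model p) x₁).open_source.measurableSet
  rw [chartMeasure_apply g x₁ (hs.inter hs0), chartMeasure_apply g x₀ hs]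
  set T : Set (Model p) := (chartAt (Model p) x₀).target ∩
    (chartAt (Model p) x₀).symm ⁻¹' (s ∩ (chartAt (Model p) x₁).source) with hT
  have hTm : MeasurableSet T := measurableSet_target_inter_preimage x₀ (hs.inter hs1)
  have himg : (chartAt (Model p) x₁).target ∩ (chartAt (Model p) x₁).symm ⁻¹'
      (s ∩ (chartAt (Model p) x₀).source) ⊆ coordChange x₁ x₀ '' T := by
    rintro z ⟨hz, hzs, hz0⟩
    refine ⟨coordChange x₀ x₁ z, ⟨coordChange_mem hz0, ?_⟩, coordChange_coordChange hz hz0⟩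
    rw [Set.mem_preimage, symm_coordChange hz0]
    exact ⟨hzs, (chartAt (Model p) x₁).map_target hz⟩
  have hinj : Set.InjOn (coordChange x₁ x₀) T := fun y hy z hz h => by
    rw [← coordChange_coordChange hy.1 hy.2.2, h, coordChange_coordChange hz.1 hz.2.2]
  have hd : ∀ y ∈ T, HasFDerivWithinAt (coordChange x₁ x₀) (fderiv ℝ (coordChange x₁ x₀) y) T y :=
    fun y hy => ((contDiffAt_coordChange hy.1 hy.2.2).differentiableAt
      (by simp)).hasFDerivAt.hasFDerivWithinAt
  calc _ ≤ ∫⁻ z in coordChange x₁ x₀ '' T, ENNReal.ofReal (sqrtDet g x₁ z) :=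
        lintegral_mono_set himg
    _ = ∫⁻ y in T, ENNReal.ofReal |(fderiv ℝ (coordChange x₁ x₀) y).det| *
          ENNReal.ofReal (sqrtDet g x₁ (coordChange x₁ x₀ y)) :=
        lintegral_image_eq_lintegral_abs_det_fderiv_mul volume hTm hd hinj _
    _ = ∫⁻ y in T, ENNReal.ofReal (sqrtDet g x₀ y) :=
        setLIntegral_congr_fun hTm fun y hy => by
          rw [sqrtDet_coordChange ε hy.1 hy.2.2, ENNReal.ofReal_mul (abs_nonneg _)]
    _ ≤ _ := lintegral_mono_set (Set.inter_subset_inter_right _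
        (Set.preimage_mono Set.inter_subset_left))

/-- The volume measure restricts to the volume measures of the chart domains. -/
theorem volMeasure_restrict_source (ε : LeviCivita g) (x₀ : M) :
    (volMeasure g).restrict (chartAt (Model p) x₀).source = chartMeasure g x₀ := by
  have hs0 := (chartAt (Model p) x₀).open_source.measurableSet
  have hc : (chartMeasure g x₀) (chartAt (Model p) x₀).sourceᶜ = 0 := by
    rw [chartMeasure_apply g x₀ hs0.compl]
    have : (chartAt (Model p) x₀).target ∩ (chartAt (Model p) x₀).symm ⁻¹'
        (chartAt (Model p) x₀).sourceᶜ = ∅ :=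
      Set.eq_empty_of_forall_notMem fun y hy => hy.2 ((chartAt (Model p) x₀).map_target hy.1)
    rw [this]
    simp
  apply le_antisymm
  -- The supremum is bounded by a single measure that is sharp on the chart domain and as large as
  -- possible outside; restricting to the domain discards the crude part.
  · have h1 : volMeasure g ≤ chartMeasure g x₀ +
        (⊤ : Measure M).restrict (chartAt (Model p) x₀).sourceᶜ := by
      refine iSup_le fun x₁ => Measure.le_iff.2 fun s hs => ?_
      rw [← measure_inter_add_sdiff s hs0, Measure.add_apply]
      refine add_le_add (chartMeasure_inter_source_le ε x₀ x₁ hs) ?_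
      rw [Measure.restrict_apply hs, Set.sdiff_eq]
      exact Measure.le_iff'.1 le_top _
    refine (Measure.restrict_mono le_rfl h1).trans ?_
    rw [Measure.restrict_add, Measure.restrict_restrict hs0, Set.inter_compl_self,
      Measure.restrict_empty, add_zero]
    exact Measure.restrict_le_self
  · have h2 : (chartMeasure g x₀).restrict (chartAt (Model p) x₀).source = chartMeasure g x₀ :=
      Measure.restrict_eq_self_of_ae_mem (by rw [ae_iff]; exact hc)
    rw [← h2]
    exact Measure.restrict_mono le_rfl (le_iSup (fun x => chartMeasure g x) x₀)

theorem volMeasure_apply (ε : LeviCivita g) (x₀ : M) {s : Set M} (hs : MeasurableSet s)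
    (hs0 : s ⊆ (chartAt (Model p) x₀).source) :
    volMeasure g s = ∫⁻ y in (chartAt (Model p) x₀).target ∩ (chartAt (Model p) x₀).symm ⁻¹' s,
        ENNReal.ofReal (sqrtDet g x₀ y) := by
  rw [← chartMeasure_apply g x₀ hs, ← volMeasure_restrict_source ε x₀, Measure.restrict_apply hs,
    Set.inter_eq_left.2 hs0]

/-- Integration in a chart. -/
theorem integral_volMeasure (ε : LeviCivita g) (x₀ : M) {f : M → ℝ}
    (hf : AEStronglyMeasurable f (volMeasure g))
    (h0 : ∀ x, x ∉ (chartAt (Model p) x₀).source → f x = 0) :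
    ∫ x, f x ∂(volMeasure g) = ∫ y in (chartAt (Model p) x₀).target,
      sqrtDet g x₀ y * f ((chartAt (Model p) x₀).symm y) := by
  have hm := (chartAt (Model p) x₀).open_target.measurableSet
  rw [← setIntegral_eq_integral_of_forall_compl_eq_zero h0, volMeasure_restrict_source ε]
  have hf' : AEStronglyMeasurable f (chartMeasure g x₀) := by
    rw [← volMeasure_restrict_source ε]
    exact hf.restrict
  rw [chartMeasure] at hf' ⊢
  rw [integral_map (aemeasurable_chart_symm g x₀) hf',
    integral_withDensity_eq_integral_toReal_smul₀]
  · refine setIntegral_congr_fun hm fun y hy => ?_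
    simp only [ENNReal.toReal_ofReal (sqrtDet_pos g hy).le, smul_eq_mul]
  · exact ((continuousOn_sqrtDet g x₀).aemeasurable hm).ennreal_ofReal
  · exact Filter.Eventually.of_forall fun _ => ENNReal.ofReal_lt_top

theorem isLocallyFiniteMeasure_volMeasure (ε : LeviCivita g) :
    IsLocallyFiniteMeasure (volMeasure g) := by
  refine ⟨fun x => ?_⟩
  have hx := mem_target_self (p := p) x
  obtain ⟨r, hr, hrs⟩ := Metric.nhds_basis_closedBall.mem_iff.1 (target_mem_nhds hx)
  set s := (chartAt (Model p) x).source ∩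
    (chartAt (Model p) x) ⁻¹' (Metric.ball (chartAt (Model p) x x) r) with hs
  have hso : IsOpen s := (chartAt (Model p) x).isOpen_inter_preimage Metric.isOpen_ball
  refine ⟨s, hso.mem_nhds ⟨mem_chart_source _ x, Metric.mem_ball_self hr⟩, ?_⟩
  rw [volMeasure_apply ε x hso.measurableSet Set.inter_subset_left]
  have hi : IntegrableOn (sqrtDet g x) (Metric.closedBall (chartAt (Model p) x x) r) :=
    ((continuousOn_sqrtDet g x).mono hrs).integrableOn_compact (isCompact_closedBall _ _)
  refine lt_of_le_of_lt (lintegral_mono_set fun y hy => ?_) hi.lintegral_lt_top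
  have := hy.2.2
  rw [Set.mem_preimage, (chartAt (Model p) x).right_inv hy.1] at this
  exact Metric.ball_subset_closedBall this

theorem isOpenPosMeasure_volMeasure (ε : LeviCivita g) :
    (volMeasure g).IsOpenPosMeasure := by
  refine ⟨fun U hU hne h0 => ?_⟩
  obtain ⟨x, hx⟩ := hne
  have hso : IsOpen (U ∩ (chartAt (Model p) x).source) :=
    hU.inter (chartAt (Model p) x).open_source
  have h1 := measure_mono_null (Set.inter_subset_left (t := (chartAt (Model p) x).source)) h0
  rw [volMeasure_apply ε x hso.measurableSet Set.inter_subset_right] at h1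
  have hto : IsOpen ((chartAt (Model p) x).target ∩
      (chartAt (Model p) x).symm ⁻¹' (U ∩ (chartAt (Model p) x).source)) :=
    (chartAt (Model p) x).isOpen_inter_preimage_symm hso
  have hmem : chartAt (Model p) x x ∈ (chartAt (Model p) x).target ∩
      (chartAt (Model p) x).symm ⁻¹' (U ∩ (chartAt (Model p) x).source) := by
    refine ⟨mem_target_self x, ?_⟩
    rw [Set.mem_preimage, symm_self]
    exact ⟨hx, mem_chart_source _ x⟩
  rw [lintegral_eq_zero_iff' (((continuousOn_sqrtDet g x).mono Set.inter_subset_left).aemeasurable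
    hto.measurableSet).ennreal_ofReal, Filter.EventuallyEq, ae_restrict_iff' hto.measurableSet] at h1
  refine (hto.measure_pos volume ⟨_, hmem⟩).ne' (measure_mono_null (fun y hy => ?_) (ae_iff.1 h1))
  exact fun hy' => (ENNReal.ofReal_pos.2 (sqrtDet_pos g hy.1)).ne' (hy' hy)

end Measure

section Divergence

variable {p k : ℕ}

/-! ### The divergence theorem -/

/-- The contraction of a vector with the first argument of a volume form. -/
abbrev interior (η : Form p (p + 1 + (p + 1))) (K : Model p) : Form p (p + 1 + p) :=
  ContinuousAlternatingMap.curryLeft (n := p + 1 + p) η K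

theorem interior_removeNth (η : Form p (p + 1 + (p + 1))) (K : Model p) (i : Idx p) :
    interior η K (Fin.removeNth (n := p + 1 + p) i (e : Idx p → Model p)) =
      (-1 : ℝ) ^ (i : ℕ) * (η e * K i) := by
  have h1 : η (Function.update e i K) = η e * K i := by
    conv_lhs => rw [eq_sum_e K]
    have := η.toMultilinearMap.map_update_sum Finset.univ i (fun j => K j • (e j : Model p)) e
    refine this.trans ?_
    rw [Finset.sum_eq_single i]
    · rw [MultilinearMap.map_update_smul, Function.update_eq_self, smul_eq_mul, mul_comm]
      rfl
    · intro j _ hj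
      rw [MultilinearMap.map_update_smul]
      have : η.toAlternatingMap (Function.update e i (e j)) = 0 :=
        η.toAlternatingMap.map_update_self e hj.symm
      change K j • η.toAlternatingMap (Function.update e i (e j)) = 0
      rw [this, smul_zero]
    · simp
  have h2 := AlternatingMap.map_insertNth (n := p + 1 + p) η.toAlternatingMap i K
    (Fin.removeNth (n := p + 1 + p) i (e : Idx p → Model p))
  rw [Fin.insertNth_removeNth] at h2
  have h3 : interior η K (Fin.removeNth (n := p + 1 + p) i (e : Idx p → Model p)) =
      η.toAlternatingMap (Fin.cons (α := fun _ => Model p) K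
        (Fin.removeNth (n := p + 1 + p) i (e : Idx p → Model p))) := rfl
  have h4 : η.toAlternatingMap (Function.update e i K) = η e * K i := h1
  rw [h4] at h2
  have h5 : (-1 : ℝ) ^ (i : ℕ) * (-1 : ℝ) ^ (i : ℕ) = 1 := by
    rw [← mul_pow]; simp
  rw [h3, h2]
  simp only [Matrix.vecCons]
  rw [zsmul_eq_mul]
  push_cast
  rw [← mul_assoc, h5, one_mul]

theorem isBilinearMap_interior : IsBilinearMap ℝ
    fun (η : Form p (p + 1 + (p + 1))) (K : Model p) => interior η K where
  add_left _ _ _ := rfl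
  smul_left _ _ _ := rfl
  add_right _ _ _ := map_add _ _ _
  smul_right _ _ _ := map_smul _ _ _

/-- The exterior derivative of the interior product, in components. -/
theorem extDeriv_interior {η : Model p → Form p (p + 1 + (p + 1))} {K : Model p → Model p}
    {y : Model p} (hη : DifferentiableAt ℝ η y) (hK : DifferentiableAt ℝ K y) :
    extDeriv (fun z => interior (η z) (K z)) y (e : Idx p → Model p) =
      ∑ μ : Idx p, fderiv ℝ (fun z => η z e * K z μ) y (e μ) := by
  have hd : DifferentiableAt ℝ (fun z => interior (η z) (K z)) y := by
    have hb := isBilinearMap_interior (p := p)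
    exact (hb.toContinuousBilinearMap.hasFDerivAt_of_bilinear hη.hasFDerivAt
        hK.hasFDerivAt).differentiableAt
  rw [extDeriv_apply hd]
  refine Finset.sum_congr rfl fun i _ => ?_
  simp only [interior_removeNth]
  have hd2 : DifferentiableAt ℝ (fun z => η z e * K z i) y := by
    refine DifferentiableAt.mul ?_ (differentiableAt_euclidean.1 hK i)
    have h1 : ContDiff ℝ 1 fun θ : Form p (p + 1 + (p + 1)) => θ e :=
      contDiff_iff_contDiffAt.2 fun θ => contDiffAt_form_apply contDiffAt_id
        fun i => contDiffAt_const
    exact (h1.differentiable one_ne_zero).differentiableAt.comp y hη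
  rw [fderiv_const_mul hd2, smul_apply]
  -- The sign of the i-th term of the exterior derivative cancels the sign from moving K to the
  -- first slot.
  rcases Nat.even_or_odd (i : ℕ) with h | h <;> simp [h.neg_one_pow]

variable {M : Type*} [TopologicalSpace M] [ChartedSpace (Model p) M] [IsManifold (mdl p) ∞ M]
  {x₀ x₁ : M} {y : Model p} {g : LorentzMetric p M}

/-- The coordinate expression of the divergence in the chart around `x₀`. -/
def coordDiv (g : LorentzMetric p M) (K : VecField p M) (x₀ : M) (y : Model p) : ℝ :=
  (1 / sqrtDet g x₀ y) *
    ∑ μ : Idx p, fderiv ℝ (fun z : Model p => sqrtDet g x₀ z * chartVec K x₀ z μ) y (e μ)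

/-- This is d(i_K ε) = (div K) ε, the coordinate-free description from which chart independence
follows. -/
theorem coordDiv_mul_volume (ε : LeviCivita g) {K : VecField p M} (hK : SmoothVec K)
    (hy : y ∈ (chartAt (Model p) x₀).target) :
    coordDiv g K x₀ y * chartForm ε.val x₀ y e =
      extDeriv (fun z => interior (chartForm ε.val x₀ z) (chartVec K x₀ z)) y
        (e : Idx p → Model p) := by
  have hε := ε.smooth.contDiffAt hy
  have hr := sqrtDet_pos g hy
  rw [extDeriv_interior (hε.differentiableAt (by simp))
    ((hK.contDiffAt hy).differentiableAt (by simp)), coordDiv]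
  set c := chartForm ε.val x₀ y e with hc
  have hce : sqrtDet g x₀ y = |c| := sqrtDet_eq ε hy
  have hc0 : c ≠ 0 := by rw [hce] at hr; exact abs_pos.1 hr
  have hcont : ContinuousAt (fun z => chartForm ε.val x₀ z e) y :=
    (contDiffAt_form_apply hε (u := fun _ => e) fun i => contDiffAt_const).continuousAt
  have hpos : ∀ᶠ z in nhds y, 0 < chartForm ε.val x₀ z e * c :=
    (hcont.mul continuousAt_const).eventually_const_lt (mul_self_pos.2 hc0)
  -- Near y the density and the component of ε differ by a constant sign.
  have hev : ∀ᶠ z in nhds y, sqrtDet g x₀ z = |c| / c * chartForm ε.val x₀ z e := by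
    filter_upwards [hpos, target_mem_nhds hy] with z hz hzt
    rw [sqrtDet_eq ε hzt]
    rcases lt_or_gt_of_ne hc0 with h | h
    · rw [abs_of_neg h, abs_of_neg (by nlinarith)]
      field_simp
    · rw [abs_of_pos h, abs_of_pos (by nlinarith)]
      field_simp
  have hd : ∀ μ, DifferentiableAt ℝ (fun z => chartForm ε.val x₀ z e * chartVec K x₀ z μ) y :=
    fun μ => ((contDiffAt_form_apply hε (u := fun _ => e)
      fun i => contDiffAt_const).differentiableAt (by simp)).mul
      (differentiableAt_euclidean.1 ((hK.contDiffAt hy).differentiableAt (by simp)) μ)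
  have hsum : ∀ μ, fderiv ℝ (fun z : Model p => sqrtDet g x₀ z * chartVec K x₀ z μ) y (e μ) =
      |c| / c * fderiv ℝ (fun z => chartForm ε.val x₀ z e * chartVec K x₀ z μ) y (e μ) := by
    intro μ
    have : (fun z : Model p => sqrtDet g x₀ z * chartVec K x₀ z μ) =ᶠ[nhds y]
        fun z => |c| / c * (chartForm ε.val x₀ z e * chartVec K x₀ z μ) := by
      filter_upwards [hev] with z hz
      rw [hz, mul_assoc]
    rw [this.fderiv_eq, fderiv_const_mul (hd μ), smul_apply, smul_eq_mul]
  simp only [hsum, ← Finset.mul_sum, hce]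
  have : |c| ≠ 0 := abs_ne_zero.2 hc0
  field_simp

/-- The divergence does not depend on the chart. -/
theorem coordDiv_coordChange (ε : LeviCivita g) {K : VecField p M} (hK : SmoothVec K)
    (hy : y ∈ (chartAt (Model p) x₀).target)
    (h : (chartAt (Model p) x₀).symm y ∈ (chartAt (Model p) x₁).source) :
    coordDiv g K x₀ y = coordDiv g K x₁ (coordChange x₁ x₀ y) := by
  have hy1 := coordChange_mem h
  have hc0 : chartForm ε.val x₀ y e ≠ 0 := by
    have := sqrtDet_pos g hy
    rw [sqrtDet_eq ε hy] at this
    exact abs_pos.1 this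
  have hd : DifferentiableAt ℝ
      (fun z => interior (chartForm ε.val x₁ z) (chartVec K x₁ z)) (coordChange x₁ x₀ y) := by
    have hb := isBilinearMap_interior (p := p)
    exact (hb.toContinuousBilinearMap.hasFDerivAt_of_bilinear
      ((ε.smooth.contDiffAt hy1).differentiableAt (by simp)).hasFDerivAt
      ((hK.contDiffAt hy1).differentiableAt (by simp)).hasFDerivAt).differentiableAt
  have hev : (fun z => interior (chartForm ε.val x₀ z) (chartVec K x₀ z)) =ᶠ[nhds y] fun z =>
      (interior (chartForm ε.val x₁ (coordChange x₁ x₀ z))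
        (chartVec K x₁ (coordChange x₁ x₀ z))).compContinuousLinearMap
          (fderiv ℝ (coordChange x₁ x₀) z) := by
    filter_upwards [target_mem_nhds hy, eventually_symm_mem hy h] with z hz hz'
    rw [chartForm_coordChange ε.val hz hz', chartVec_coordChange K hz hz']
    ext u
    change chartForm ε.val x₁ (coordChange x₁ x₀ z) _ = chartForm ε.val x₁ (coordChange x₁ x₀ z) _
    congr 1
    funext i
    refine Fin.cases ?_ (fun j => ?_) i <;> rfl
  -- Both ε and d(i_K ε) are top forms, so pulling back multiplies each by the same Jacobian
  -- determinant, and the nonzero component of ε can be cancelled.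
  have h1 := coordDiv_mul_volume ε hK hy
  rw [hev.extDeriv_eq, extDeriv_pullback (r := ∞) hd (contDiffAt_coordChange hy h)
    (by simp; norm_cast)] at h1
  have h2 := volume_comp_eq_det (p := p) (extDeriv (fun z => interior (chartForm ε.val x₁ z)
    (chartVec K x₁ z)) (coordChange x₁ x₀ y)) (fderiv ℝ (coordChange x₁ x₀) y)
  have h3 := volume_comp_eq_det (chartForm ε.val x₁ (coordChange x₁ x₀ y))
    (fderiv ℝ (coordChange x₁ x₀) y)
  have h4 : chartForm ε.val x₀ y e = chartForm ε.val x₁ (coordChange x₁ x₀ y)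
      fun i => fderiv ℝ (coordChange x₁ x₀) y (e i) := by
    rw [chartForm_coordChange ε.val hy h]; rfl
  have h5 := h1.trans h2
  rw [← coordDiv_mul_volume ε hK hy1, mul_left_comm, ← h3, ← h4] at h5
  exact mul_right_cancel₀ hc0 h5

theorem coordDiv_eq_divergence (ε : LeviCivita g) {K : VecField p M} (hK : SmoothVec K)
    (hy : y ∈ (chartAt (Model p) x₀).target) :
    coordDiv g K x₀ y = divergence g K ((chartAt (Model p) x₀).symm y) :=
  coordDiv_coordChange ε hK hy (mem_chart_source _ _)

end Divergence

/-! ### Integration of divergences of compactly supported fields -/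

section DivergenceTheorem

open MeasureTheory

/-- Integration by parts against the constant function one. -/
theorem integral_fderiv_eq_zero {E : Type*} [NormedAddCommGroup E] [NormedSpace ℝ E]
    [MeasurableSpace E] [BorelSpace E] [FiniteDimensional ℝ E] {μ : Measure E}
    [μ.IsAddHaarMeasure] {f : E → ℝ} (hf : ContDiff ℝ 1 f) (hc : HasCompactSupport f) (v : E) :
    ∫ x, fderiv ℝ f x v ∂μ = 0 := by
  have h1 : Continuous fun x => fderiv ℝ f x v :=
    (hf.continuous_fderiv one_ne_zero).clm_apply continuous_const
  have h2 := integral_mul_fderiv_eq_neg_fderiv_mul_of_integrable (μ := μ) (f := fun _ : E => (1 : ℝ))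
    (g := f) (v := v) (by simp)
    (by simpa using h1.integrable_of_hasCompactSupport (hc.fderiv_apply (𝕜 := ℝ) v))
    (by simpa using hf.continuous.integrable_of_hasCompactSupport hc)
    (fun _ _ => differentiableAt_const _) (fun x _ => (hf.differentiable one_ne_zero) x)
  simpa using h2

variable {p k : ℕ} {M : Type*} [TopologicalSpace M] [ChartedSpace (Model p) M]
  {g : LorentzMetric p M}

theorem continuous_of_chart {f : M → ℝ}
    (h : ∀ x : M, ContinuousAt (fun y => f ((chartAt (Model p) x).symm y)) (chartAt (Model p) x x)) :
    Continuous f := continuous_iff_continuousAt.2 fun x => by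
  have h1 := (h x).comp ((chartAt (Model p) x).continuousAt (mem_chart_source _ x))
  refine h1.congr ?_
  filter_upwards [(chartAt (Model p) x).open_source.mem_nhds (mem_chart_source _ x)] with z hz
  simp [(chartAt (Model p) x).left_inv hz]

theorem divergence_eq_zero {K : VecField p M} {x : M} (h : ∀ᶠ z in nhds x, K z = 0) :
    divergence g K x = 0 := by
  have hy := mem_target_self (p := p) x
  have h1 : ∀ᶠ z in nhds (chartAt (Model p) x x), K ((chartAt (Model p) x).symm z) = 0 := by
    have := (chartAt (Model p) x).continuousAt_symm hy
    rw [ContinuousAt, symm_self] at this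
    exact this.eventually h
  rw [divergence, Finset.sum_eq_zero, mul_zero]
  intro μ _
  have h2 : (fun y : Model p => sqrtDet g x y * chartVec K x y μ) =ᶠ[nhds
      (chartAt (Model p) x x)] fun _ => 0 := by
    filter_upwards [h1] with z hz
    have : chartVec K x z = 0 := by
      rw [chartVec, hz]; exact map_zero _
    rw [this]; simp
  rw [h2.fderiv_eq]
  simp

variable [IsManifold (mdl p) ∞ M] {x₀ x₁ : M} {y : Model p}

theorem contDiffAt_sqrtDet_mul_chartVec {K : VecField p M} (hK : SmoothVec K)
    (hy : y ∈ (chartAt (Model p) x₀).target) (μ : Idx p) :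
    ContDiffAt ℝ ∞ (fun z => sqrtDet g x₀ z * chartVec K x₀ z μ) y :=
  (contDiffAt_sqrtDet g hy).mul (contDiffAt_euclidean.1 (hK.contDiffAt hy) μ)

theorem continuous_divergence (ε : LeviCivita g) {K : VecField p M} (hK : SmoothVec K) :
    Continuous (divergence g K) := by
  refine continuous_of_chart (p := p) fun x => ?_
  have hy := mem_target_self (p := p) x
  have h1 : ContinuousAt (coordDiv g K x) (chartAt (Model p) x x) := by
    refine ContinuousAt.mul (continuousAt_const.div (contDiffAt_sqrtDet g hy).continuousAt
      (sqrtDet_pos g hy).ne') ?_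
    refine tendsto_finsetSum _ fun μ _ => ?_
    exact (((contDiffAt_sqrtDet_mul_chartVec hK hy μ).fderiv_right (m := ∞)
      (by norm_cast)).continuousAt.clm_apply continuousAt_const)
  refine h1.congr ?_
  filter_upwards [target_mem_nhds hy] with z hz
  exact coordDiv_eq_divergence ε hK hz

theorem divergence_sum {ι : Type*} (s : Finset ι) {K : ι → VecField p M}
    (hK : ∀ i ∈ s, SmoothVec (K i)) (x : M) :
    divergence g (fun z => ∑ i ∈ s, K i z) x = ∑ i ∈ s, divergence g (K i) x := by
  have hy := mem_target_self (p := p) x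
  simp only [divergence, ← Finset.mul_sum]
  rw [Finset.sum_comm]
  congr 1
  refine Finset.sum_congr rfl fun μ _ => ?_
  have h1 : (fun y : Model p => sqrtDet g x y * chartVec (fun z => ∑ i ∈ s, K i z) x y μ) =
      fun y => ∑ i ∈ s, sqrtDet g x y * chartVec (K i) x y μ := by
    funext y
    rw [← Finset.mul_sum]
    congr 1
    have : chartVec (fun z => ∑ i ∈ s, K i z) x y = ∑ i ∈ s, chartVec (K i) x y :=
      map_sum (mfderiv (mdl p) (mdl p) (chartAt (Model p) x) ((chartAt (Model p) x).symm y))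
        (fun i => K i ((chartAt (Model p) x).symm y)) s
    rw [this]
    simp
  rw [h1, fderiv_fun_sum fun i hi =>
    (contDiffAt_sqrtDet_mul_chartVec (hK i hi) hy μ).differentiableAt (by simp)]
  simp

theorem SmoothVec.fun_smul {K : VecField p M} (hK : SmoothVec K) {f : M → ℝ}
    (hf : ContMDiff (mdl p) 𝓘(ℝ, ℝ) ∞ f) : SmoothVec fun x => f x • K x := fun _ _ hy =>
  (((contDiffAt_chart hf hy).smul (hK.contDiffAt hy)).congr_of_eventuallyEq
    (Filter.Eventually.of_forall fun _ => map_smul _ _ _)).contDiffWithinAt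

variable [T2Space M] [MeasurableSpace M] [BorelSpace M]

theorem integral_divergence_of_chart (ε : LeviCivita g) {K : VecField p M} (hK : SmoothVec K)
    {C : Set M} (hC : IsCompact C) (hC0 : C ⊆ (chartAt (Model p) x₀).source)
    (h0 : ∀ x, x ∉ C → K x = 0) : ∫ x, divergence g K x ∂(volMeasure g) = 0 := by
  have hdiv0 : ∀ x, x ∉ C → divergence g K x = 0 := fun x hx =>
    divergence_eq_zero (Filter.eventually_of_mem (hC.isClosed.isOpen_compl.mem_nhds hx) h0)
  have hm := (chartAt (Model p) x₀).open_target.measurableSet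
  rw [integral_volMeasure ε x₀ (continuous_divergence ε hK).aestronglyMeasurable
    fun x hx => hdiv0 x fun h => hx (hC0 h)]
  set T := (chartAt (Model p) x₀).target with hT
  -- The component densities are extended by zero. The extension is differentiable because the field
  -- vanishes outside a compact subset of the chart domain.
  let G : Idx p → Model p → ℝ := fun μ => T.indicator fun z => sqrtDet g x₀ z * chartVec K x₀ z μ
  have hCi : IsCompact (chartAt (Model p) x₀ '' C) :=
    hC.image_of_continuousOn ((chartAt (Model p) x₀).continuousOn.mono hC0)
  have hG0 : ∀ μ z, z ∉ chartAt (Model p) x₀ '' C → G μ z = 0 := by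
    intro μ z hz
    by_cases hzT : z ∈ T
    · have hK0 : K ((chartAt (Model p) x₀).symm z) = 0 := h0 _ fun h =>
        hz ⟨_, h, (chartAt (Model p) x₀).right_inv hzT⟩
      have : chartVec K x₀ z = 0 := by
        rw [chartVec, hK0]; exact map_zero _
      simp [G, this]
    · exact Set.indicator_of_notMem hzT _
  have hGd : ∀ μ, ContDiff ℝ 1 (G μ) := fun μ => contDiff_iff_contDiffAt.2 fun z => by
    by_cases hzT : z ∈ T
    · refine ((contDiffAt_sqrtDet_mul_chartVec (g := g) hK hzT μ).of_le
        (by norm_cast)).congr_of_eventuallyEq ?_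
      filter_upwards [target_mem_nhds hzT] with w hw
      exact Set.indicator_of_mem hw _
    · have hz : z ∉ chartAt (Model p) x₀ '' C := by
        rintro ⟨x, hx, rfl⟩
        exact hzT ((chartAt (Model p) x₀).map_source (hC0 hx))
      refine (contDiffAt_const (c := (0 : ℝ))).congr_of_eventuallyEq ?_
      filter_upwards [hCi.isClosed.isOpen_compl.mem_nhds hz] with w hw
      exact hG0 μ w hw
  have hGc : ∀ μ, HasCompactSupport (G μ) := fun μ =>
    HasCompactSupport.intro hCi fun z hz => hG0 μ z hz
  have h1 : ∀ z, T.indicator (fun y => sqrtDet g x₀ y *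
      divergence g K ((chartAt (Model p) x₀).symm y)) z = ∑ μ, fderiv ℝ (G μ) z (e μ) := by
    intro z
    by_cases hzT : z ∈ T
    · rw [Set.indicator_of_mem hzT, ← coordDiv_eq_divergence ε hK hzT, coordDiv, ← mul_assoc,
        mul_one_div_cancel (sqrtDet_pos g hzT).ne', one_mul]
      refine Finset.sum_congr rfl fun μ _ => ?_
      have : G μ =ᶠ[nhds z] fun z => sqrtDet g x₀ z * chartVec K x₀ z μ := by
        filter_upwards [target_mem_nhds hzT] with w hw
        exact Set.indicator_of_mem hw _
      rw [this.fderiv_eq]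
    · rw [Set.indicator_of_notMem hzT]
      have hz : z ∉ chartAt (Model p) x₀ '' C := by
        rintro ⟨x, hx, rfl⟩
        exact hzT ((chartAt (Model p) x₀).map_source (hC0 hx))
      refine (Finset.sum_eq_zero fun μ _ => ?_).symm
      have : G μ =ᶠ[nhds z] fun _ => 0 := by
        filter_upwards [hCi.isClosed.isOpen_compl.mem_nhds hz] with w hw
        exact hG0 μ w hw
      rw [this.fderiv_eq]
      simp
  rw [← integral_indicator hm]
  simp only [h1]
  rw [integral_finsetSum _ fun μ _ => (((hGd μ).continuous_fderiv one_ne_zero).clm_apply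
    continuous_const).integrable_of_hasCompactSupport ((hGc μ).fderiv_apply (𝕜 := ℝ) (e μ))]
  exact Finset.sum_eq_zero fun μ _ => integral_fderiv_eq_zero (hGd μ) (hGc μ) (e μ)

variable [SecondCountableTopology M]

/-- The divergence theorem for vector fields that vanish outside a compact set. -/
theorem integral_divergence (ε : LeviCivita g) {K : VecField p M} (hK : SmoothVec K)
    {D : Set M} (hD : IsCompact D) (h0 : ∀ x, x ∉ D → K x = 0) :
    ∫ x in D, divergence g K x ∂(volMeasure g) = 0 := by
  have : LocallyCompactSpace M := ChartedSpace.locallyCompactSpace (Model p) M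
  have : IsLocallyFiniteMeasure (volMeasure g) := isLocallyFiniteMeasure_volMeasure ε
  have hdiv0 : ∀ x, x ∉ D → divergence g K x = 0 := fun x hx =>
    divergence_eq_zero (Filter.eventually_of_mem (hD.isClosed.isOpen_compl.mem_nhds hx) h0)
  rw [setIntegral_eq_integral_of_forall_compl_eq_zero hdiv0]
  obtain ⟨f, hf⟩ := SmoothPartitionOfUnity.exists_isSubordinate_chartAt_source (mdl p) M
  have hfin := f.locallyFinite.finite_nonempty_inter_compact hD
  set s := hfin.toFinset with hs
  have hKi : ∀ i, SmoothVec fun x => f i x • K x := fun i => hK.fun_smul (f i).contMDiff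
  -- Only finitely many members of the partition of unity meet the compact set D, so K is a finite
  -- sum of fields supported in single charts.
  have hsum : K = fun x => ∑ i ∈ s, f i x • K x := by
    funext x
    by_cases hx : x ∈ D
    · rw [← Finset.sum_smul]
      have h1 : ∑ᶠ i, f i x = 1 := f.sum_eq_one (Set.mem_univ x)
      rw [finsum_eq_sum_of_support_subset (s := s)] at h1
      · rw [h1, one_smul]
      · intro i hi
        rw [hs, Set.Finite.coe_toFinset]
        exact ⟨x, hi, hx⟩
    · simp [h0 x hx]
  rw [hsum]
  simp only [divergence_sum s fun i _ => hKi i]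
  have hz : ∀ i x, x ∉ D ∩ tsupport (f i) → f i x • K x = 0 := fun i x hx => by
    by_cases hxD : x ∈ D
    · rw [image_eq_zero_of_notMem_tsupport fun h => hx ⟨hxD, h⟩, zero_smul]
    · rw [h0 x hxD, smul_zero]
  have hcomp : ∀ i, IsCompact (D ∩ tsupport (f i)) := fun i => hD.inter_right (isClosed_tsupport _)
  rw [integral_finsetSum]
  · exact Finset.sum_eq_zero fun i _ => integral_divergence_of_chart ε (hKi i) (hcomp i)
      (fun x hx => hf i hx.2) (hz i)
  · intro i _
    refine (continuous_divergence ε (hKi i)).integrable_of_hasCompactSupport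
      (HasCompactSupport.intro (hcomp i) fun x hx => divergence_eq_zero (Filter.eventually_of_mem
        ((hcomp i).isClosed.isOpen_compl.mem_nhds hx) (hz i)))

end DivergenceTheorem

section ParametricIntegral

open MeasureTheory

variable {p k : ℕ} {M : Type*} [TopologicalSpace M] [ChartedSpace (Model p) M]

/-! ### Derivatives of integrals over compact regions -/

theorem hasDerivAt_of_chart {f : ℝ → M → ℝ} {x z : M} {s : ℝ}
    (hz : z ∈ (chartAt (Model p) x).source)
    (hf : DifferentiableAt ℝ (fun q : ℝ × Model p => f q.1 ((chartAt (Model p) x).symm q.2))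
      (s, chartAt (Model p) x z)) :
    HasDerivAt (fun s => f s z)
      (fderiv ℝ (fun q : ℝ × Model p => f q.1 ((chartAt (Model p) x).symm q.2))
        (s, chartAt (Model p) x z) (1, 0)) s := by
  have h1 : HasDerivAt (fun s : ℝ => (s, chartAt (Model p) x z)) ((1 : ℝ), (0 : Model p)) s :=
    (hasDerivAt_id s).prodMk (hasDerivAt_const s _)
  have h2 := hf.hasFDerivAt.comp_hasDerivAt s h1
  refine h2.congr_of_eventuallyEq (Filter.Eventually.of_forall fun t => ?_)
  simp [(chartAt (Model p) x).left_inv hz]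

/-- Joint C¹ dependence on the parameter and the coordinates gives a bound near each point;
induction over the compact set makes the parameter interval and the bound uniform. -/
theorem exists_uniform_deriv_bound {f : ℝ → M → ℝ} {D : Set M} (hD : IsCompact D)
    (hf : ∀ x : M, ContDiffAt ℝ 1
      (fun q : ℝ × Model p => f q.1 ((chartAt (Model p) x).symm q.2)) (0, chartAt (Model p) x x)) :
    ∃ δ > 0, ∃ C, ∀ s : ℝ, |s| < δ → ∀ z ∈ D, DifferentiableAt ℝ (fun s => f s z) s ∧
      |deriv (fun s => f s z) s| ≤ C ∧ ContinuousAt (f s) z ∧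
        ContinuousAt (fun z => deriv (fun s => f s z) s) z := by
  refine hD.induction_on (p := fun D => ∃ δ > 0, ∃ C, ∀ s : ℝ, |s| < δ → ∀ z ∈ D,
      DifferentiableAt ℝ (fun s => f s z) s ∧
      |deriv (fun s => f s z) s| ≤ C ∧ ContinuousAt (f s) z ∧
        ContinuousAt (fun z => deriv (fun s => f s z) s) z) ?_ ?_ ?_ ?_
  · exact ⟨1, one_pos, 0, fun s _ z hz => hz.elim⟩
  · rintro S T hST ⟨δ, hδ, C, h⟩
    exact ⟨δ, hδ, C, fun s hs z hz => h s hs z (hST hz)⟩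
  · rintro S T ⟨δ, hδ, C, h⟩ ⟨δ', hδ', C', h'⟩
    refine ⟨min δ δ', lt_min hδ hδ', max C C', fun s hs z hz => ?_⟩
    rcases hz with hz | hz
    · obtain ⟨h1, h2, h3⟩ := h s (hs.trans_le (min_le_left _ _)) z hz
      exact ⟨h1, h2.trans (le_max_left _ _), h3⟩
    · obtain ⟨h1, h2, h3⟩ := h' s (hs.trans_le (min_le_right _ _)) z hz
      exact ⟨h1, h2.trans (le_max_right _ _), h3⟩
  · intro x _
    set F := fun q : ℝ × Model p => f q.1 ((chartAt (Model p) x).symm q.2) with hF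
    set C := ‖fderiv ℝ F (0, chartAt (Model p) x x) (1, 0)‖ + 1 with hC
    have hcd : ∀ q, ContDiffAt ℝ 1 F q → ContinuousAt (fun q => fderiv ℝ F q (1, 0)) q :=
      fun q hq => (hq.fderiv_right (m := 0) (by simp)).continuousAt.clm_apply continuousAt_const
    have hev : ∀ᶠ q in nhds ((0 : ℝ), chartAt (Model p) x x),
        ContDiffAt ℝ 1 F q ∧ ‖fderiv ℝ F q (1, 0)‖ < C :=
      ((hf x).eventually (by simp)).and
        ((hcd _ (hf x)).norm.eventually_lt_const (by rw [hC]; exact lt_add_one _))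
    rw [nhds_prod_eq] at hev
    obtain ⟨pa, ha, pb, hb, hab⟩ := Filter.eventually_prod_iff.1 hev
    obtain ⟨δ, hδ, hδa⟩ := Metric.eventually_nhds_iff.1 ha
    have hsrc : (chartAt (Model p) x).source ∈ nhds x :=
      (chartAt (Model p) x).open_source.mem_nhds (mem_chart_source _ x)
    have hbx : ∀ᶠ z in nhds x, pb (chartAt (Model p) x z) :=
      ((chartAt (Model p) x).continuousAt (mem_chart_source _ x)).eventually hb
    refine ⟨_, mem_nhdsWithin_of_mem_nhds (Filter.inter_mem hsrc hbx), δ, hδ, C,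
      fun s hs z hz => ?_⟩
    obtain ⟨h1, h2⟩ := hab (hδa (by simpa using hs)) hz.2
    have h3 := hasDerivAt_of_chart hz.1 (h1.differentiableAt one_ne_zero)
    have hcz : ContinuousAt (fun w => (s, chartAt (Model p) x w)) z :=
      continuousAt_const.prodMk ((chartAt (Model p) x).continuousAt hz.1)
    have hsz : ∀ᶠ w in nhds z, w ∈ (chartAt (Model p) x).source :=
      (chartAt (Model p) x).open_source.mem_nhds hz.1
    refine ⟨h3.differentiableAt, ?_, ?_, ?_⟩
    · rw [h3.deriv]
      exact h2.le
    · refine (ContinuousAt.comp (f := fun w => (s, chartAt (Model p) x w)) (g := F)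
        h1.continuousAt hcz).congr ?_
      filter_upwards [hsz] with w hw
      simp [hF, (chartAt (Model p) x).left_inv hw]
    · refine (ContinuousAt.comp (f := fun w => (s, chartAt (Model p) x w))
        (g := fun q => fderiv ℝ F q (1, 0)) (hcd _ h1) hcz).congr ?_
      filter_upwards [hsz, hcz.eventually (h1.eventually (by simp))] with w hw hw'
      exact (hasDerivAt_of_chart hw (hw'.differentiableAt one_ne_zero)).deriv.symm

variable [T2Space M] [MeasurableSpace M] [BorelSpace M] {μ : Measure M}
  [IsLocallyFiniteMeasure μ]

/-- Differentiation under the integral with a constant dominating function. The term `v` will be the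
interaction, which is independent of the parameter but merely integrable, so it is kept apart from
the smooth part. -/
theorem hasDerivAt_setIntegral {f : ℝ → M → ℝ} {v : M → ℝ} {D : Set M} (hD : IsCompact D)
    (hf : ∀ x : M, ContDiffAt ℝ 1
      (fun q : ℝ × Model p => f q.1 ((chartAt (Model p) x).symm q.2)) (0, chartAt (Model p) x x))
    (hv : IntegrableOn v D μ) :
    HasDerivAt (fun s => ∫ x in D, (f s x - v x) ∂μ) (∫ x in D, deriv (fun s => f s x) 0 ∂μ) 0 := by
  obtain ⟨δ, hδ, C, h⟩ := exists_uniform_deriv_bound hD hf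
  have hDm := hD.isClosed.measurableSet
  have hcont : ∀ s : ℝ, |s| < δ → ContinuousOn (f s) D := fun s hs z hz =>
    (h s hs z hz).2.2.1.continuousWithinAt
  have h0 : |(0 : ℝ)| < δ := by simpa using hδ
  have hball : ∀ s ∈ Metric.ball (0 : ℝ) δ, |s| < δ := fun s hs => by simpa using hs
  have : IsFiniteMeasure (μ.restrict D) := ⟨by simpa using hD.measure_lt_top⟩
  refine (hasDerivAt_integral_of_dominated_loc_of_deriv_le (μ := μ.restrict D)
    (F := fun s x => f s x - v x) (F' := fun s x => deriv (fun s => f s x) s)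
    (bound := fun _ => C) (Metric.ball_mem_nhds (0 : ℝ) hδ) ?_ ?_ ?_ ?_ (integrable_const C) ?_).2
  · filter_upwards [Metric.ball_mem_nhds (0 : ℝ) hδ] with s hs
    exact ((hcont s (hball s hs)).aestronglyMeasurable_of_isCompact hD hDm).sub
      hv.aestronglyMeasurable
  · exact ((hcont 0 h0).integrableOn_compact hD).sub hv
  · exact ContinuousOn.aestronglyMeasurable_of_isCompact (fun z hz =>
      (h 0 h0 z hz).2.2.2.continuousWithinAt) hD hDm
  · filter_upwards [ae_restrict_mem hDm] with z hz s hs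
    exact (h s (hball s hs) z hz).2.1
  · filter_upwards [ae_restrict_mem hDm] with z hz s hs
    exact (h s (hball s hs) z hz).1.hasDerivAt.sub_const _

end ParametricIntegral

/-! ### Variation of the action -/

section Action

open MeasureTheory

variable {p k : ℕ} {M : Type*} [TopologicalSpace M] [ChartedSpace (Model p) M]
  [IsManifold (mdl p) ∞ M] {g : LorentzMetric p M} (ε : LeviCivita g) {Φ δΦ : Config p M}

theorem contDiffAt_lagAlg_vary (hA : SmoothForm Φ.A) (hδA : SmoothForm δΦ.A)
    (ha : ContMDiff (mdl p) 𝓘(ℝ, ℝ) ∞ Φ.a) (hδa : ContMDiff (mdl p) 𝓘(ℝ, ℝ) ∞ δΦ.a)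
    (hat : Timelike g Φ.a) (hL : SmoothForm Φ.L) (hδL : SmoothForm δΦ.L) {x₀ : M} {y : Model p}
    (hy : y ∈ (chartAt (Model p) x₀).target) :
    ContDiffAt ℝ ∞ (fun q : ℝ × Model p => (fun (s : ℝ) (x : M) =>
      lagAlg (g.val x) (ε.val x) (extD Φ.A x + s • extD δΦ.A x) (grad Φ.a x + s • grad δΦ.a x)
        (Φ.L x + s • δΦ.L x)) q.1 ((chartAt (Model p) x₀).symm q.2)) (0, y) := by
  have hc : ∀ {E : Type _} [NormedAddCommGroup E] [NormedSpace ℝ E] {f : Model p → E},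
      ContDiffAt ℝ ∞ f y → ContDiffAt ℝ ∞ (fun q : ℝ × Model p => f q.2) (0, y) :=
    fun hf => ContDiffAt.comp (g := _) (f := Prod.snd) ((0 : ℝ), y) hf contDiffAt_snd
  have hs : ContDiffAt ℝ ∞ (fun q : ℝ × Model p => q.1) (0, y) := contDiffAt_fst
  have h := contDiffAt_lagAlg (z := ((0 : ℝ), y)) (hc (g.contDiffAt hy))
    (g.lorentzian_chart hy).nonDeg (hc (ε.smooth.contDiffAt hy))
    (α := fun q => fderiv ℝ (fun z => Φ.a ((chartAt (Model p) x₀).symm z)) q.2 +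
      q.1 • fderiv ℝ (fun z => δΦ.a ((chartAt (Model p) x₀).symm z)) q.2)
    ((hc (contDiffAt_grad ha hy)).add (hs.smul (hc (contDiffAt_grad hδa hy))))
    (by simpa using covecSq_chart_neg g ha hat hy)
    (F := fun q => chartForm (extD Φ.A) x₀ q.2 + q.1 • chartForm (extD δΦ.A) x₀ q.2)
    ((hc ((smoothForm_extD hA).contDiffAt hy)).add
      (hs.smul (hc ((smoothForm_extD hδA).contDiffAt hy))))
    (L := fun q => chartForm Φ.L x₀ q.2 + q.1 • chartForm δΦ.L x₀ q.2)
    ((hc (hL.contDiffAt hy)).add (hs.smul (hc (hδL.contDiffAt hy))))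
  refine h.congr_of_eventuallyEq ?_
  have ht : ∀ᶠ q : ℝ × Model p in nhds (0, y), q.2 ∈ (chartAt (Model p) x₀).target :=
    continuousAt_snd.eventually (target_mem_nhds hy)
  filter_upwards [ht] with q hq
  rw [← grad_comp_chartFrame ha hq, ← grad_comp_chartFrame hδa hq]
  exact (lagAlg_pull (frameEquiv x₀ hq) (g.lorentzian _).nonDeg _ _ _ _).symm

variable [T2Space M] [MeasurableSpace M] [BorelSpace M]

/-- The variation of the action is the integral of the variation of the Lagrangian. -/
theorem hasDerivAt_actionINZ (hA : SmoothForm Φ.A) (hδA : SmoothForm δΦ.A)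
    (ha : ContMDiff (mdl p) 𝓘(ℝ, ℝ) ∞ Φ.a) (hδa : ContMDiff (mdl p) 𝓘(ℝ, ℝ) ∞ δΦ.a)
    (hat : Timelike g Φ.a) (hL : SmoothForm Φ.L) (hδL : SmoothForm δΦ.L) {V : Interaction p M}
    (hV : ∀ (s : ℝ) x, V x (Φ.L x + s • δΦ.L x) (g.val x) = V x (Φ.L x) (g.val x)) {D : Set M}
    (hD : IsCompact D) (hVi : IntegrableOn (fun x => V x (Φ.L x) (g.val x)) D (volMeasure g))
    {f : M → ℝ}
    (hf : ∀ x, HasDerivAt (fun s : ℝ => lagINZ g ε (Φ.vary δΦ s) V x) (f x) 0) :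
    HasDerivAt (fun s : ℝ => actionINZ g ε (Φ.vary δΦ s) V D)
      (∫ x in D, f x ∂(volMeasure g)) 0 := by
  have := isLocallyFiniteMeasure_volMeasure ε
  have h := hasDerivAt_setIntegral (p := p) (μ := volMeasure g) (f := fun (s : ℝ) (x : M) =>
      lagAlg (g.val x) (ε.val x) (extD Φ.A x + s • extD δΦ.A x) (grad Φ.a x + s • grad δΦ.a x)
        (Φ.L x + s • δΦ.L x)) hD (fun x => (contDiffAt_lagAlg_vary ε hA hδA
    ha hδa hat hL hδL (mem_target_self x)).of_le (by norm_cast)) hVi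
  have heq : ∀ (s : ℝ) x, lagINZ g ε (Φ.vary δΦ s) V x =
      lagAlg (g.val x) (ε.val x) (extD Φ.A x + s • extD δΦ.A x) (grad Φ.a x + s • grad δΦ.a x)
        (Φ.L x + s • δΦ.L x) - V x (Φ.L x) (g.val x) := fun s x => by
    rw [lagINZ_vary ε hA hδA ha hδa, hV]
  simp only [actionINZ, heq]
  refine h.congr_deriv ?_
  congr 1
  -- The parameter derivative in the integral is identified with the given variation by uniqueness
  -- of derivatives; the interaction is constant in s.
  funext x
  have h1 := hf x
  simp only [heq] at h1
  have h2 := h1.deriv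
  rwa [deriv_sub_const] at h2

end Action

section Invariance

open MeasureTheory

variable {p k : ℕ} {M : Type*} [TopologicalSpace M] [ChartedSpace (Model p) M]
  {g : LorentzMetric p M} (ε : LeviCivita g) {Φ δΦ : Config p M}

/-! ### Invariance of the action -/

theorem smoothForm_zero : SmoothForm (fun _ : M => (0 : Form p k)) :=
  smoothForm_congr fun _ _ _ => ⟨contDiffAt_const (c := 0), rfl⟩

theorem current_zero (g : Bilin p) (ε : Form p (p + 1 + (p + 1))) (X : Form p (p + 1)) :
    current g ε 0 X = 0 := by
  have h : ∀ ρ, pairing g ε (wedgeLast (0 : Form p p) (dx ρ)) X = 0 := fun ρ => by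
    have := wedgeLast_smul_left 0 (0 : Form p p) (dx ρ)
    rw [zero_smul, zero_smul] at this
    rw [this]
    simpa using pairing_smul_left g ε 0 0 X
  simp [current, h]

variable [IsManifold (mdl p) ∞ M] [T2Space M] [SecondCountableTopology M] [MeasurableSpace M]
  [BorelSpace M]

/-- Once the Lagrangian varies by a divergence, the statements on the action follow from
differentiation under the integral, and the last one from the divergence theorem. -/
theorem invariantUpToBoundary (hA : SmoothForm Φ.A) (hδA : SmoothForm δΦ.A)
    (ha : ContMDiff (mdl p) 𝓘(ℝ, ℝ) ∞ Φ.a) (hδa : ContMDiff (mdl p) 𝓘(ℝ, ℝ) ∞ δΦ.a)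
    (hat : Timelike g Φ.a) (hL : SmoothForm Φ.L) (hδL : δΦ.L = fun _ => 0) (V : Interaction p M)
    {Z : Set M} {K : VecField p M} (hK : SmoothVec K) (hKZ : ∀ x ∈ Z, K x = 0)
    (hd : ∀ x, HasDerivAt (fun s : ℝ => lagINZ g ε (Φ.vary δΦ s) V x) (divergence g K x) 0) :
    InvariantUpToBoundary g ε Φ V δΦ Z := by
  refine ⟨K, hK, hKZ, hd, fun hV D hD => ?_⟩
  have h := hasDerivAt_actionINZ ε hA hδA ha hδa hat hL (by rw [hδL]; exact smoothForm_zero)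
    (V := V) (fun s x => by simp [hδL]) hD (hV.integrableOn_isCompact hD) hd
  refine ⟨h, fun hZ => ?_⟩
  rwa [integral_divergence ε hK hD fun x hx => hKZ x (hZ x hx)] at h

variable (hp : Even p) (hA : SmoothForm Φ.A) (ha : ContMDiff (mdl p) 𝓘(ℝ, ℝ) ∞ Φ.a)
  (hat : Timelike g Φ.a) (hL : SmoothForm Φ.L) (hsd : SelfDual g ε Φ.L)

include hp hA ha hat hL hsd in
theorem invariant_deltaPhi (V : Interaction p M) {φ : M → ℝ}
    (hφ : ContMDiff (mdl p) 𝓘(ℝ, ℝ) ∞ φ) :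
    InvariantUpToBoundary g ε Φ V (deltaPhi g ε Φ φ) {x | φ x = 0} := by
  have hδ := smoothForm_deltaPhi ε hA ha hat hL hφ
  refine invariantUpToBoundary ε hA hδ ha hφ hat hL rfl V (K := currentPhi ε Φ φ)
    (smoothVec_current ε hδ ((smoothForm_extD hA).add
      ((smoothForm_fieldY ε hA ha hat hL).wedgeLast_grad ha)) _) (fun x hx => ?_)
    (hasDerivAt_lagINZ_deltaPhi ε hp hA ha hat hL hsd V hφ)
  have hx' : φ x = 0 := hx
  rw [currentPhi, deltaPhi_A, hx', neg_zero, zero_smul, current_zero, smul_zero]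

include hp hA ha hat hL hsd in
theorem invariant_deltaPsi (V : Interaction p M) (hp0 : 0 < p) {ψ : FormField p M (p - 1)}
    (hψ : SmoothForm ψ) :
    InvariantUpToBoundary g ε Φ V (deltaPsi g Φ hp0 ψ) {x | ψ x = 0} := by
  have hδ := smoothForm_deltaPsi ha hat hp0 hψ
  refine invariantUpToBoundary ε hA hδ ha contMDiff_const hat hL rfl V (K := currentPsi ε Φ hp0 ψ)
    (smoothVec_current ε hδ (smoothForm_extD hA) _) (fun x hx => ?_)
    (hasDerivAt_lagINZ_deltaPsi ε hp hA ha hat hsd hp0 V hψ)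
  have hx' : ψ x = 0 := hx
  have h0 : covWedge hp0 (fun μ => grad Φ.a x (e μ)) (0 : Form p (p - 1)) = 0 := by
    simpa using covWedge_smul_right hp0 0 (grad Φ.a x) 0
  rw [currentPsi, deltaPsi_A, hx', smul_zero, h0, current_zero, smul_zero]

end Invariance

section Elimination

open MeasureTheory

variable {p k : ℕ}

/-! ### Elimination of the auxiliary form -/

namespace TimelikeData

variable {g : Bilin p} {ε : Form p (p + 1 + (p + 1))} {α : Model p →L[ℝ] ℝ}

theorem dual_selfDualExt (hp : Even p) (h : TimelikeData g ε α) (B : Form p p) :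
    dual g ε (selfDualExt g ε α B) = selfDualExt g ε α B := by
  rw [selfDualExt_eq h.lorentzian.nonDeg, dual_add, dual_dual hp h.lorentzian h.volume]
  exact add_comm _ _

/-- The dual summand has no electric part, and the sign is v_μ v^μ = -1. -/
theorem contractLast_selfDualExt (h : TimelikeData g ε α) {B : Form p p}
    (hB : ∀ u i, u i = unitVec g α → B u = 0) :
    contractLast (selfDualExt g ε α B) (unitVec g α) = -B := by
  rw [selfDualExt_eq h.lorentzian.nonDeg, contractLast_add, h.contractLast_dual_wedgeLast,
    h.contractLast_wedgeLast hB, add_zero]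

/-- A self-dual form is determined by its electric part. -/
theorem eq_selfDualExt (hp : Even p) (h : TimelikeData g ε α) {L : Form p (p + 1)}
    (hL : dual g ε L = L) {B : Form p p} (hB : B + contractLast L (unitVec g α) = 0) :
    L = selfDualExt g ε α B := by
  have h1 := h.decompose hp L
  rw [hL, ← neg_eq_of_add_eq_zero_right hB, wedgeLast_neg_left, dual_neg] at h1
  rw [selfDualExt_eq h.lorentzian.nonDeg]
  refine h1.trans ?_
  abel

end TimelikeData

variable {M : Type*} [TopologicalSpace M] [ChartedSpace (Model p) M]
  {g : LorentzMetric p M} (ε : LeviCivita g) {Φ : Config p M}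

theorem magnetic_apply_eq_zero {x : M} {u : Fin p → Model p} {i : Fin p}
    (hu : u i = vVec g Φ x) : magnetic g ε Φ x u = 0 :=
  contractLast_apply_eq_zero _ hu

theorem lam_apply_eq_zero {x : M} {u : Fin p → Model p} {i : Fin p}
    (hu : u i = vVec g Φ x) : lam g Φ x u = 0 :=
  contractLast_apply_eq_zero _ hu

variable (hp : Even p) (hat : Timelike g Φ.a) (hsd : SelfDual g ε Φ.L)

include hp hat hsd in
theorem magnetic_add_lam_eq_zero_iff :
    (∀ x, magnetic g ε Φ x + lam g Φ x = 0) ↔ Φ.L = lambdaSol g ε Φ := by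
  constructor
  · intro h
    funext x
    exact (ε.timelikeData hat x).eq_selfDualExt hp (hsd x) (h x)
  · intro h x
    have h1 := (ε.timelikeData hat x).contractLast_selfDualExt (B := magnetic g ε Φ x)
      fun u i hu => magnetic_apply_eq_zero ε hu
    have h2 : lam g Φ x = -magnetic g ε Φ x := by
      rw [lam, h]
      exact h1
    rw [h2]
    exact add_neg_cancel _

theorem actionINZ_eq_actionPST [MeasurableSpace M]
    (h : ∀ x, magnetic g ε Φ x + lam g Φ x = 0) (D : Set M) :
    actionINZ g ε Φ (fun _ _ _ => 0) D = actionPST g ε Φ D := by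
  have h0 : ∀ b : Bilin p, dot b (0 : Form p p) 0 = 0 := fun b => by
    simpa using dot_smul_left b 0 (0 : Form p p) 0
  have : ∀ x, lagINZ g ε Φ (fun _ _ _ => 0) x = lagPST g ε Φ x := fun x => by
    rw [lagINZ, lagPST, h x, h0, add_zero, sub_zero]
  simp only [actionINZ, actionPST, this]

variable [IsManifold (mdl p) ∞ M] (hA : SmoothForm Φ.A)
  (ha : ContMDiff (mdl p) 𝓘(ℝ, ℝ) ∞ Φ.a) (hL : SmoothForm Φ.L)

include hA ha hat in
theorem smoothForm_magnetic : SmoothForm (magnetic g ε Φ) :=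
  ((smoothForm_extD hA).dual ε).contractLast_unitVec ha hat

include hA ha hat in
theorem smoothForm_lambdaSol : SmoothForm (lambdaSol g ε Φ) :=
  smoothForm_selfDualExt ε ha hat (smoothForm_magnetic ε hat hA ha)

include hA ha hat hL in
theorem smoothForm_magnetic_add_lam : SmoothForm fun x => magnetic g ε Φ x + lam g Φ x :=
  (smoothForm_magnetic ε hat hA ha).add (hL.contractLast_unitVec ha hat)

theorem continuous_dot {θ θ' : FormField p M k} (hθ : SmoothForm θ) (hθ' : SmoothForm θ') :
    Continuous fun x => dot (g.val x) (θ x) (θ' x) := by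
  refine continuous_of_chart (p := p) fun x => ?_
  have hy := mem_target_self (p := p) x
  refine (contDiffAt_dot (g.contDiffAt hy) (g.lorentzian_chart hy).nonDeg (hθ.contDiffAt hy)
    (hθ'.contDiffAt hy)).continuousAt.congr ?_
  filter_upwards [target_mem_nhds hy] with z hz
  exact dot_pull (frameEquiv x hz) (g.lorentzian _).nonDeg _ _

include hA ha in
/-- The variation of the free Lagrangian under a variation of `Λ`. -/
theorem hasDerivAt_lagINZ_lambda (δL : FormField p M (p + 1)) (x : M) :
    HasDerivAt (fun s : ℝ => lagINZ g ε
        (Φ.vary { A := fun _ => 0, a := fun _ => 0, L := δL } s) (fun _ _ _ => 0) x)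
      (2 / (p.factorial : ℝ) * dot (g.val x) (magnetic g ε Φ x + lam g Φ x)
        (contractLast (δL x) (vVec g Φ x))) 0 := by
  have hn := (g.lorentzian x).nonDeg
  have hv : HasDerivAt (fun s : ℝ => unitVec (g.val x) (grad Φ.a x + s • (0 : Model p →L[ℝ] ℝ)))
      0 0 := by
    simpa using hasDerivAt_const (0 : ℝ) (unitVec (g.val x) (grad Φ.a x))
  have h := hasDerivAt_lagAlg hn (ε.val x) (extD Φ.A x) 0 (grad Φ.a x) 0 (Φ.L x) (δL x) hv
  have hc0 : ∀ θ : Form p (p + 1), contractLast θ (0 : Model p) = 0 := fun θ => by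
    rw [contractLast_eq]; simp
  have hd0 : dual (g.val x) (ε.val x) 0 = 0 := by
    simpa using dual_smul (g.val x) (ε.val x) 0 0
  have hc1 : ∀ w : Model p, contractLast (0 : Form p (p + 1)) w = 0 := fun w => by
    simpa using contractLast_smul 0 (0 : Form p (p + 1)) w
  have h0 : ∀ θ : Form p p, dot (g.val x) θ 0 = 0 := fun θ => by
    simpa using dot_smul_right (g.val x) 0 θ 0
  refine (h.congr_of_eventuallyEq (Filter.Eventually.of_forall fun s => ?_)).congr_deriv ?_
  · simp only
    rw [lagINZ_vary ε hA smoothForm_zero ha contMDiff_const, sub_zero]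
    have h1 : grad (p := p) (fun _ : M => (0 : ℝ)) x = 0 := mfderiv_const
    have h2 : extD (fun _ : M => (0 : Form p p)) x = 0 := by
      have := extD_add_smul (p := p) (A := fun _ : M => (0 : Form p p)) smoothForm_zero
        smoothForm_zero 1 x
      simpa using this
    rw [h1, h2]
  · simp only [hc0, hd0, hc1, zero_add, h0]
    change _ = 2 / (p.factorial : ℝ) * dot (g.val x)
      (contractLast (dual (g.val x) (ε.val x) (extD Φ.A x)) (unitVec (g.val x) (grad Φ.a x)) +
        contractLast (Φ.L x) (unitVec (g.val x) (grad Φ.a x)))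
      (contractLast (δL x) (unitVec (g.val x) (grad Φ.a x)))
    ring

variable [T2Space M] [MeasurableSpace M] [BorelSpace M]

include hp hA ha hat hL in
-- Self-duality leaves the electric part of δΛ an arbitrary transverse p-form, so it can be chosen
-- proportional to B+λ itself.
theorem lambdaStationary_iff :
    LambdaStationary g ε Φ ↔ ∀ x, magnetic g ε Φ x + lam g Φ x = 0 := by
  have hder : ∀ δL : FormField p M (p + 1), SmoothForm δL → ∀ D : Set M, IsCompact D →
      HasDerivAt (fun s : ℝ => actionINZ g ε
        (Φ.vary { A := fun _ => 0, a := fun _ => 0, L := δL } s) (fun _ _ _ => 0) D)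
        (∫ x in D, 2 / (p.factorial : ℝ) * dot (g.val x) (magnetic g ε Φ x + lam g Φ x)
          (contractLast (δL x) (vVec g Φ x)) ∂(volMeasure g)) 0 := fun δL hδL D hD =>
    hasDerivAt_actionINZ ε hA smoothForm_zero ha contMDiff_const hat hL hδL (fun _ _ => rfl) hD
      integrableOn_zero (hasDerivAt_lagINZ_lambda ε hA ha δL)
  constructor
  · intro hst x
    set b : FormField p M p := fun x => magnetic g ε Φ x + lam g Φ x with hb
    have hbs : SmoothForm b := smoothForm_magnetic_add_lam ε hat hA ha hL
    have hb0 : ∀ x (u : Fin p → Model p) i, u i = unitVec (g.val x) (grad Φ.a x) → b x u = 0 :=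
      fun x u i hu => by
        change magnetic g ε Φ x u + lam g Φ x u = 0
        rw [magnetic_apply_eq_zero ε hu, lam_apply_eq_zero hu, add_zero]
    have hpos : ∀ x, 0 ≤ dot (g.val x) (b x) (b x) ∧ (dot (g.val x) (b x) (b x) = 0 → b x = 0) :=
      fun x => dot_self_nonneg (g.lorentzian x) (ε.timelikeData hat x).unitVec_sq (hb0 x)
    by_contra hx
    obtain ⟨χ⟩ : Nonempty (SmoothBumpFunction (mdl p) x) := inferInstance
    have hχs : ContMDiff (mdl p) 𝓘(ℝ, ℝ) ∞ χ := χ.contMDiff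
    -- The test variation is the self-dual extension of b = B+λ, localised by a bump function; its
    -- electric part is -χ b, so the integrand has a fixed sign.
    set δL : FormField p M (p + 1) := fun z =>
      χ z • selfDualExt (g.val z) (ε.val z) (grad Φ.a z) (b z) with hδL
    have hs : SmoothForm δL := (smoothForm_selfDualExt ε ha hat hbs).fun_smul hχs
    have hsdL : SelfDual g ε δL := fun z => by
      rw [hδL, dual_smul, (ε.timelikeData hat z).dual_selfDualExt hp]
    have hD : IsCompact (tsupport χ) := χ.hasCompactSupport
    have hzero : ∀ z, z ∉ tsupport χ → χ z = 0 := fun z hz => image_eq_zero_of_notMem_tsupport hz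
    have h1 := hst δL hs hsdL (tsupport χ) hD fun z hz => by
      rw [hδL]
      simp only [hzero z hz, zero_smul]
    have h2 := (hder δL hs (tsupport χ) hD).unique h1
    have h3 : ∀ z, 2 / (p.factorial : ℝ) * dot (g.val z) (magnetic g ε Φ z + lam g Φ z)
        (contractLast (δL z) (vVec g Φ z)) =
        -(2 / (p.factorial : ℝ) * (χ z * dot (g.val z) (b z) (b z))) := fun z => by
      have : contractLast (δL z) (vVec g Φ z) = -(χ z • b z) := by
        have h4 := (ε.timelikeData hat z).contractLast_selfDualExt (hb0 z)
        rw [hδL, contractLast_smul, vVec, h4]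
        ext u
        simp
      rw [this, dot_neg_right, dot_smul_right]
      ring
    have := isLocallyFiniteMeasure_volMeasure ε
    have := isOpenPosMeasure_volMeasure ε
    have hcont : Continuous fun z => 2 / (p.factorial : ℝ) * (χ z * dot (g.val z) (b z) (b z)) :=
      continuous_const.mul (hχs.continuous.mul (continuous_dot hbs hbs))
    simp only [h3] at h2
    rw [integral_neg, neg_eq_zero, setIntegral_eq_integral_of_forall_compl_eq_zero
      fun z hz => by rw [hzero z hz, zero_mul, mul_zero]] at h2
    -- A continuous nonnegative function that is nonzero at the centre of the bump has positive
    -- integral, because the volume measure charges open sets.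
    refine (hcont.integral_pos_of_hasCompactSupport_nonneg_nonzero (x := x)
      (HasCompactSupport.intro hD fun z hz => by rw [hzero z hz, zero_mul, mul_zero])
      (fun z => mul_nonneg (by positivity) (mul_nonneg χ.nonneg (hpos z).1)) ?_).ne' h2
    rw [χ.eq_one, one_mul]
    exact mul_ne_zero (by positivity) fun h => hx ((hpos x).2 h)
  · intro h δL hδL _ D hD _
    have h0 : ∀ z (θ : Form p p), dot (g.val z) 0 θ = 0 := fun z θ => by
      simpa using dot_smul_left (g.val z) 0 0 θ
    simpa [h, h0] using hder δL hδL D hD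

end Elimination

end ChiralForm

end

open scoped Manifold ContDiff in
open ChiralForm in
theorem mainTheorem9 (n : ℕ) {M : Type*} [TopologicalSpace M] [T2Space M]
    [SecondCountableTopology M] [ChartedSpace (Model (2 * n)) M] [IsManifold (mdl (2 * n)) ∞ M]
    [MeasurableSpace M] [BorelSpace M]
    (g : LorentzMetric (2 * n) M) (ε : LeviCivita g) (Φ : Config (2 * n) M)
    (hA : SmoothForm Φ.A) (ha : ContMDiff (mdl (2 * n)) 𝓘(ℝ, ℝ) ∞ Φ.a) (hat : Timelike g Φ.a)
    (hL : SmoothForm Φ.L) (hsd : SelfDual g ε Φ.L) :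
    -- invariance under both transformations, for every interaction
    (∀ V : Interaction (2 * n) M,
      (∀ φ : M → ℝ, ContMDiff (mdl (2 * n)) 𝓘(ℝ, ℝ) ∞ φ →
        InvariantUpToBoundary g ε Φ V (deltaPhi g ε Φ φ) {x | φ x = 0}) ∧
      (∀ (hp : 0 < 2 * n) (ψ : FormField (2 * n) M (2 * n - 1)), SmoothForm ψ →
        InvariantUpToBoundary g ε Φ V (deltaPsi g Φ hp ψ) {x | ψ x = 0})) ∧
    -- elimination of the auxiliary form in the free theory
    (LambdaStationary g ε Φ ↔ ∀ x, magnetic g ε Φ x + lam g Φ x = 0) ∧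
    (LambdaStationary g ε Φ ↔ Φ.L = lambdaSol g ε Φ) ∧
    (SmoothForm (lambdaSol g ε Φ) ∧ SelfDual g ε (lambdaSol g ε Φ)) ∧
    (LambdaStationary g ε Φ → ∀ D : Set M,
      actionINZ g ε Φ (fun _ _ _ => 0) D = actionPST g ε Φ D) := by
  have hp : Even (2 * n) := even_two_mul n
  have hiff := lambdaStationary_iff ε hp hat hA ha hL
  refine ⟨fun V => ⟨fun φ hφ => invariant_deltaPhi ε hp hA ha hat hL hsd V hφ,
    fun hp0 ψ hψ => invariant_deltaPsi ε hp hA ha hat hL hsd V hp0 hψ⟩, hiff,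
    hiff.trans (magnetic_add_lam_eq_zero_iff ε hp hat hsd),
    ⟨smoothForm_lambdaSol ε hat hA ha, fun x => (ε.timelikeData hat x).dual_selfDualExt hp _⟩,
    fun h D => actionINZ_eq_actionPST ε (hiff.1 h) D⟩
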